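/- Let $d\ge 1$. For a lattice $\Lambda\subset\mathbb{R}^d$ and the ball $B_T\subset\mathbb{R}^d$ of radius $T$ centred at the origin, put $$\mathcal{R}_{B_T}(\Lambda)=\#(\Lambda\cap B_T)-\frac{\mathrm{vol}(B_T)}{\mathrm{vol}(\mathbb{R}^d/\Lambda)}.$$ Let $U_d$ denote the group of $d\times d$ upper triangular matrices with ones on the diagonal, and let $du$ be Lebesgue measure on $U_d(\mathbb{R})\cong\mathbb{R}^{d(d-1)/2}$ (the coordinates being the entries above the diagonal) and also the measure which it induces on the quotient $U_d(\mathbb{Z})\backslash U_d(\mathbb{R})$ by left multiplication. For $g\in \mathrm{GL}_d(\mathbb{R})$ and $u\in U_d(\mathbb{Z})\backslash U_d(\mathbb{R})$ let $\mathbb{Z}^d u g$ be the lattice of all $nug$, where $n$ runs over the integral row vectors. Then for every $g\in \mathrm{GL}_d(\mathbb{R})$ there is a constant $c=c(g)$ such that for all $T\ge 2$ the function $u\mapsto|\mathcal{R}_{B_T}(\mathbb{Z}^d u g)|^2$ is integrable and $$\int_{U_d(\mathbb{Z})\backslash U_d(\mathbb{R})}|\mathcal{R}_{B_T}(\mathbb{Z}^d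 u g)|^2\,du\le c\,T^{d-1}\log^2(T).$$ -/

import Mathlib

open MeasureTheory

noncomputable section

namespace LatticeShear

/-! ### The unipotent upper triangular group -/

/-- `U_d(R)`: the subgroup of `GL_d(R)` of upper triangular matrices with ones on the diagonal. -/
def unip (d : ℕ) (R : Type*) [CommRing R] : Subgroup (GL (Fin d) R) where
  carrier := {g | (∀ i j, j < i → g i j = 0) ∧ ∀ i, g i i = 1}
  one_mem' := ⟨fun i j h => by simp [Matrix.one_apply_ne h.ne'], fun i => by simp⟩
  mul_mem' := by
    rintro a b ⟨ha, ha'⟩ ⟨hb, hb'⟩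
    refine ⟨fun i j h => ?_, fun i => ?_⟩
    · rw [Matrix.GeneralLinearGroup.coe_mul, Matrix.mul_apply]
      refine Finset.sum_eq_zero fun k _ => ?_
      rcases lt_or_ge k i with hk | hk
      · rw [ha i k hk, zero_mul]
      · rw [hb k j (h.trans_le hk), mul_zero]
    · rw [Matrix.GeneralLinearGroup.coe_mul, Matrix.mul_apply, Finset.sum_eq_single i]
      · rw [ha' i, hb' i, one_mul]
      · intro k _ hk
        rcases lt_or_gt_of_ne hk with hk | hk
        · rw [ha i k hk, zero_mul]
        · rw [hb k i hk, mul_zero]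
      · simp
  inv_mem' := by
    rintro a ⟨ha, ha'⟩
    have htri : ∀ i j, j < i → (a⁻¹ : GL (Fin d) R) i j = 0 := by
      have h1 : Matrix.BlockTriangular (a : Matrix (Fin d) (Fin d) R) id := fun i j h => ha i j h
      have : Invertible (a : Matrix (Fin d) (Fin d) R) := a.invertible
      have h2 := Matrix.blockTriangular_inv_of_blockTriangular h1
      intro i j h
      rw [Matrix.coe_units_inv]
      exact h2 h
    refine ⟨htri, fun i => ?_⟩
    have h1 : (a * a⁻¹ : GL (Fin d) R) i i = 1 := by simp
    rw [Matrix.GeneralLinearGroup.coe_mul, Matrix.mul_apply, Finset.sum_eq_single i] at h1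
    · rwa [ha' i, one_mul] at h1
    · intro k _ hk
      rcases lt_or_gt_of_ne hk with hk | hk
      · rw [ha i k hk, zero_mul]
      · rw [htri k i hk, mul_zero]
    · simp

/-- `U_d(ℤ)`, as a subgroup of `U_d(ℝ)`. -/
def unipInt (d : ℕ) : Subgroup (unip d ℝ) :=
  ((unip d ℤ).map (Matrix.GeneralLinearGroup.map (Int.castRingHom ℝ))).subgroupOf (unip d ℝ)

/-- The positions strictly above the diagonal; there are `d (d - 1) / 2` of them. -/
abbrev AboveDiag (d : ℕ) : Type := {p : Fin d × Fin d // p.1 < p.2}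

/-- The upper triangular unipotent matrix with prescribed entries above the diagonal. -/
def ofCoord {d : ℕ} {R : Type*} [CommRing R] (x : AboveDiag d → R) : unip d R :=
  let A : Matrix (Fin d) (Fin d) R := Matrix.of fun i j =>
    if h : i < j then x ⟨(i, j), h⟩ else if i = j then 1 else 0
  ⟨Matrix.GeneralLinearGroup.mk'' A (by
      have hA : A.IsUpperTriangular := fun i j (h : j < i) => by
        simp [A, h.not_gt, h.ne']
      rw [Matrix.det_of_isUpperTriangular hA]
      simp [A]),
    fun i j h => by
      change A i j = 0
      simp [A, h.not_gt, h.ne'],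
    fun i => by
      change A i i = 1
      simp [A]⟩

/-- The coordinates `U_d(R) ≃ R^{d(d-1)/2}`: the entries above the diagonal. -/
def coord (d : ℕ) (R : Type*) [CommRing R] : unip d R ≃ (AboveDiag d → R) where
  toFun u p := u.1 p.1.1 p.1.2
  invFun := ofCoord
  left_inv u := by
    apply Subtype.ext
    apply Matrix.GeneralLinearGroup.ext
    intro i j
    change (if h : i < j then u.1 i j else if i = j then (1 : R) else 0) = u.1 i j
    rcases lt_trichotomy i j with h | h | h
    · simp [h]
    · subst h
      simp [u.2.2 i]
    · simp [h.not_gt, h.ne', u.2.1 i j h]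
  right_inv x := by
    funext p
    change (if h : p.1.1 < p.1.2 then x ⟨(p.1.1, p.1.2), h⟩
      else if p.1.1 = p.1.2 then (1 : R) else 0) = x p
    simp [p.2]

/-- The measurable structure of `U_d(ℝ) ≃ ℝ^{d(d-1)/2}`. -/
instance (d : ℕ) : MeasurableSpace (unip d ℝ) :=
  MeasurableSpace.comap (coord d ℝ) inferInstance

/-- The coordinates of `U_d(ℝ)` as a measurable equivalence. -/
def mcoord (d : ℕ) : unip d ℝ ≃ᵐ (AboveDiag d → ℝ) where
  toEquiv := coord d ℝ
  measurable_toFun := comap_measurable _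
  measurable_invFun := by
    rintro _ ⟨t, ht, rfl⟩
    rw [← Set.preimage_comp]
    simpa using ht

/-- Lebesgue measure `du` on `U_d(ℝ) ≃ ℝ^{d(d-1)/2}`. -/
def du (d : ℕ) : Measure (unip d ℝ) := (volume : Measure (AboveDiag d → ℝ)).map (mcoord d).symm

/-! ### The space of shears `U_d(ℤ) \ U_d(ℝ)` -/

/-- The quotient `U_d(ℤ) \ U_d(ℝ)` (by left multiplication). -/
abbrev ShearSpace (d : ℕ) : Type := Quotient (QuotientGroup.rightRel (unipInt d))

/-- The matrices in `U_d(ℝ)` whose entries above the diagonal lie in `[0, 1)`. -/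
def fundDomain (d : ℕ) : Set (unip d ℝ) := {u | ∀ i j, i < j → u.1 i j ∈ Set.Ico (0 : ℝ) 1}

/-- The measure `du` on `U_d(ℤ) \ U_d(ℝ)`. -/
def shearMeasure (d : ℕ) : Measure (ShearSpace d) :=
  ((du d).restrict (fundDomain d)).map (Quotient.mk _)

theorem measurableSet_fundDomain (d : ℕ) : MeasurableSet (fundDomain d) := by
  have h : fundDomain d = mcoord d ⁻¹' Set.pi Set.univ fun _ => Set.Ico (0 : ℝ) 1 := by
    ext u
    simp only [fundDomain, Set.mem_ofPred_eq, Set.mem_preimage, Set.mem_pi, Set.mem_univ,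
      forall_true_left]
    exact ⟨fun h p => h _ _ p.2, fun h i j hij => h ⟨(i, j), hij⟩⟩
  rw [h]
  exact (mcoord d).measurable (MeasurableSet.univ_pi fun _ => measurableSet_Ico)

theorem mem_unipInt {d : ℕ} {u : unip d ℝ} :
    u ∈ unipInt d ↔ ∀ i j, ∃ n : ℤ, u.1 i j = n := by
  constructor
  · rintro ⟨γ, _, hγ⟩ i j
    refine ⟨γ i j, ?_⟩
    have h2 : Matrix.GeneralLinearGroup.map (Int.castRingHom ℝ) γ = u.1 := hγ
    rw [← h2]
    simp
  · intro h
    choose n hn using h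
    refine ⟨(ofCoord fun p => n p.1.1 p.1.2 : unip d ℤ).1, (ofCoord _).2, ?_⟩
    change _ = u.1
    apply Matrix.GeneralLinearGroup.ext
    intro i j
    change ((if h : i < j then n i j else if i = j then (1 : ℤ) else 0 : ℤ) : ℝ) = u.1 i j
    rcases lt_trichotomy i j with h | h | h
    · simp [h, hn]
    · subst h
      simp [u.2.2 i]
    · simp [h.not_gt, h.ne', u.2.1 i j h]

theorem mul_entry {d : ℕ} (a u : unip d ℝ) (i j : Fin d) :
    (a * u).1 i j = ∑ k ∈ Finset.univ.filter (· < j), a.1 i k * u.1 k j + a.1 i j := by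
  have h : (a * u).1 i j = ∑ k, a.1 i k * u.1 k j := by
    rw [Subgroup.coe_mul, Matrix.GeneralLinearGroup.coe_mul, Matrix.mul_apply]
  rw [h, ← Finset.sum_filter_add_sum_filter_not Finset.univ (· < j)]
  congr 1
  rw [Finset.sum_eq_single j]
  · rw [u.2.2 j, mul_one]
  · intro k hk hkj
    have : j < k := lt_of_le_of_ne (by simpa using hk) hkj.symm
    rw [u.2.1 k j this, mul_zero]
  · simp

/-- The integral row operations that bring the entries of `u` into `[0, 1)`. -/
def reduceEntry {d : ℕ} (u : unip d ℝ) (i j : Fin d) : ℤ :=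
  if j < i then 0 else if i = j then 1 else
    -⌊∑ k : {k : Fin d // k < j}, (reduceEntry u i k.1 : ℝ) * u.1 k.1 j⌋
termination_by j
decreasing_by exact k.2

/-- The set `fundDomain d` is a fundamental domain of `U_d(ℤ)` acting on `U_d(ℝ)`. -/
theorem isFundamentalDomain (d : ℕ) :
    IsFundamentalDomain (unipInt d) (fundDomain d) (du d) := by
  refine IsFundamentalDomain.mk' (measurableSet_fundDomain d).nullMeasurableSet fun u => ?_
  set γ : unip d ℝ := ofCoord fun p => (reduceEntry u p.1.1 p.1.2 : ℝ) with hγdef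
  have hγ : ∀ i j, γ.1 i j = reduceEntry u i j := by
    intro i j
    change (if h : i < j then (reduceEntry u i j : ℝ) else if i = j then (1 : ℝ) else 0) = _
    rcases lt_trichotomy i j with h | h | h
    · simp [h]
    · subst h
      rw [reduceEntry]
      simp
    · rw [reduceEntry]
      simp [h, h.not_gt, h.ne']
  refine ⟨⟨γ, mem_unipInt.2 fun i j => ⟨_, hγ i j⟩⟩, ?_, ?_⟩
  · intro i j hij
    change (γ * u).1 i j ∈ _
    have hS : ∑ k ∈ Finset.univ.filter (· < j), γ.1 i k * u.1 k j =
        ∑ k : {k : Fin d // k < j}, (reduceEntry u i k.1 : ℝ) * u.1 k.1 j := by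
      simp only [hγ]
      exact Finset.sum_subtype _ (by simp) _
    rw [mul_entry, hS, hγ i j, reduceEntry, if_neg hij.not_gt, if_neg hij.ne]
    push_cast
    rw [← sub_eq_add_neg]
    have h1 := Int.lt_floor_add_one
      (∑ k : {k : Fin d // k < j}, (reduceEntry u i k.1 : ℝ) * u.1 k.1 j)
    exact ⟨sub_nonneg.2 (Int.floor_le _), by linarith⟩
  · rintro ⟨β, hβ⟩ hmem
    apply Subtype.ext
    apply Subtype.ext
    apply Matrix.GeneralLinearGroup.ext
    intro i j
    change β.1 i j = γ.1 i j
    induction j using WellFoundedLT.induction with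
    | ind j ih =>
      rcases lt_trichotomy i j with h | h | h
      · obtain ⟨n, hn⟩ := mem_unipInt.1 hβ i j
        have h1 : (β * u).1 i j ∈ Set.Ico (0 : ℝ) 1 := hmem i j h
        have hS : ∑ k ∈ Finset.univ.filter (· < j), β.1 i k * u.1 k j =
            ∑ k : {k : Fin d // k < j}, (reduceEntry u i k.1 : ℝ) * u.1 k.1 j := by
          rw [Finset.sum_congr rfl fun k hk => by rw [ih k (by simpa using hk), hγ]]
          exact Finset.sum_subtype _ (by simp) _
        rw [mul_entry, hS, hn] at h1
        rw [hγ i j, reduceEntry, if_neg h.not_gt, if_neg h.ne, hn, Int.cast_inj]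
        refine (neg_eq_iff_eq_neg.2 (Int.floor_eq_iff.2 ?_)).symm
        push_cast
        exact ⟨by linarith [h1.1], by linarith [h1.2]⟩
      · subst h
        rw [β.2.2, γ.2.2]
      · rw [β.2.1 i j h, γ.2.1 i j h]

/-! ### Lattices and the remainder in the lattice point count -/

/-- The lattice `ℤ^d g ⊂ ℝ^d` of all `n g`, where `n` runs over the integral row vectors. -/
def latticeOf {d : ℕ} (g : GL (Fin d) ℝ) : Submodule ℤ (EuclideanSpace ℝ (Fin d)) where
  carrier := {v | ∃ n : Fin d → ℤ, v = WithLp.toLp 2 (Matrix.vecMul (fun i => (n i : ℝ)) g.1)}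
  zero_mem' := ⟨0, by ext i; simp [Matrix.vecMul, dotProduct]⟩
  add_mem' := by
    rintro _ _ ⟨m, rfl⟩ ⟨n, rfl⟩
    refine ⟨m + n, ?_⟩
    rw [← WithLp.toLp_add, ← Matrix.add_vecMul]
    congr 2
    funext i
    simp
  smul_mem' := by
    rintro c _ ⟨n, rfl⟩
    refine ⟨c • n, ?_⟩
    ext i
    simp [Matrix.vecMul, dotProduct, Finset.mul_sum, mul_assoc]

theorem latticeOf_unipInt_mul_le {d : ℕ} {γ : unip d ℝ} (hγ : γ ∈ unipInt d) (g : GL (Fin d) ℝ) :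
    latticeOf (γ.1 * g) ≤ latticeOf g := by
  choose a ha using mem_unipInt.1 hγ
  rintro _ ⟨n, rfl⟩
  refine ⟨fun j => ∑ i, n i * a i j, ?_⟩
  rw [Units.val_mul, ← Matrix.vecMul_vecMul]
  congr 2
  funext j
  simp [Matrix.vecMul, dotProduct, ha]

/-- The shear `ℤ^d u g` of the lattice `ℤ^d g`, for `u ∈ U_d(ℤ) \ U_d(ℝ)`. -/
def shear {d : ℕ} (g : GL (Fin d) ℝ) :
    ShearSpace d → Submodule ℤ (EuclideanSpace ℝ (Fin d)) :=
  Quotient.lift (fun u : unip d ℝ => latticeOf (u.1 * g)) (by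
    have key : ∀ u v : unip d ℝ, v * u⁻¹ ∈ unipInt d →
        latticeOf (v.1 * g) ≤ latticeOf (u.1 * g) := fun u v h => by
      have h1 := latticeOf_unipInt_mul_le h (u.1 * g)
      simpa [mul_assoc] using h1
    intro u v h
    have h1 : v * u⁻¹ ∈ unipInt d := QuotientGroup.rightRel_apply.1 h
    refine le_antisymm (key v u ?_) (key u v h1)
    simpa using (unipInt d).inv_mem h1)

/-- The remainder `R_{B_T}(Λ) = #(Λ ∩ B_T) - vol(B_T) / vol(ℝ^d / Λ)`, where `B_T` is the open
ball of radius `T` centred at the origin. -/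
def remainder {d : ℕ} (T : ℝ) (Λ : Submodule ℤ (EuclideanSpace ℝ (Fin d))) : ℝ :=
  (Set.ncard ((Λ : Set (EuclideanSpace ℝ (Fin d))) ∩ Metric.ball 0 T) : ℝ)
    - volume.real (Metric.ball (0 : EuclideanSpace ℝ (Fin d)) T) / ZLattice.covolume Λ

end LatticeShear

end

/-! The proof is an induction on the dimension that averages over one row of `u` at a time. Split
`u` into its first row `r` and a smaller unipotent block `x`. Completing the square gives, for `v =
(m, k)`, `|v u g|² = a m² + |(m w + k) x W'|²` with `w = (r + c) x⁻¹`, where `a`, `c`, `W'` depend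
only on `g` (`exists_qf_split`, `qf_unipMat_consRow`). Counting lattice points by `m` writes the
discrepancy as three terms (`disc_consRow`). The slice `m = 0` is the same discrepancy in dimension
`d - 1`, left to the induction, which ends in dimension zero where nothing is lost. The slices `m ≠
0` count the points of `ℤ^(d-1) + m w` in ellipsoids of size at most `T`, each minus its volume. The
last term compares the sum of the slice volumes with the full volume and does not depend on `u`.

The middle term decides the exponent. For fixed `x`, its mean square over `r` is at most a constant
times its mean square over `w` in a unit cube. The Fourier coefficient at `ξ` of the count in slice
`m` vanishes unless `m` divides `ξ`, and is then the Fourier transform of the ellipsoid at `ξ / m`,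
of size `O(T^((d-2)/2) |ξ/m|^(-d/2))`. In Parseval's identity a pair `m, m'` meets only at multiples
`ξ` of the lcm, so it contributes at most a constant times `T^(d-2) (gcd/lcm)^(d/2) ≤ T^(d-2)
gcd/lcm`. The sum of `gcd/lcm` over `m, m' ≪ T` is `O(T log² T)`, which gives `T^(d-1) log² T`
(`setIntegral_sliceDiscrepancy_sq_le`, `sum_gcd_div_lcm_le`).

The volumes of the slices are proportional to `(T² - a m²)_+^((d-1)/2)`; Poisson summation bounds
the last term by `O(T^((d-1)/2))` (`exists_abs_sum_volume_slices_sub_le`). Both this and the decay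
for ellipsoids rest on one cosine transform, that of `(1 - t²)^(n/2)`. The constants are uniform in
`x` because its entries lie in `[0, 1)` and its determinant is one. -/

namespace LatticeShear

/-! ### Oscillatory integrals -/

/-- Integration by parts against a bounded oscillating factor, for a nonnegative increasing
amplitude. -/
theorem abs_integral_mul_le_of_monotone {b K : ℝ} (hb : 0 ≤ b) {h h' v w : ℝ → ℝ}
    (hh : ∀ t ∈ Set.Icc 0 b, HasDerivAt h (h' t) t) (hcont : ContinuousOn h' (Set.Icc 0 b))
    (h0 : 0 ≤ h 0) (hpos : ∀ t ∈ Set.Icc 0 b, 0 ≤ h' t)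
    (hv : ∀ t, HasDerivAt v (w t) t) (hw : Continuous w) (hK : ∀ t, |v t| ≤ K) :
    |∫ t in 0..b, h t * w t| ≤ 2 * K * h b := by
  have hI : Set.uIcc 0 b = Set.Icc 0 b := Set.uIcc_of_le hb
  have hint : IntervalIntegrable h' volume 0 b :=
    ContinuousOn.intervalIntegrable (by rwa [hI])
  have hvc : Continuous v := continuous_iff_continuousAt.2 fun t => (hv t).continuousAt
  have hmono : h b - h 0 = ∫ t in 0..b, h' t :=
    (intervalIntegral.integral_eq_sub_of_hasDerivAt (fun t ht => hh t (hI ▸ ht)) hint).symm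
  have hge : 0 ≤ h b - h 0 := by
    rw [hmono]
    exact intervalIntegral.integral_nonneg hb hpos
  have hK0 : 0 ≤ K := (abs_nonneg _).trans (hK 0)
  rw [intervalIntegral.integral_mul_deriv_eq_deriv_mul (fun t ht => hh t (hI ▸ ht))
    (fun t _ => hv t) hint (hw.intervalIntegrable _ _)]
  have h2 : |∫ t in 0..b, h' t * v t| ≤ K * (h b - h 0) := by
    rw [hmono, ← intervalIntegral.integral_const_mul]
    refine intervalIntegral.norm_integral_le_of_norm_le hb (f := fun t => h' t * v t) ?_
      (hint.const_mul K)
    refine Filter.Eventually.of_forall fun t ht => ?_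
    rw [Real.norm_eq_abs, abs_mul, abs_of_nonneg (hpos t ⟨ht.1.le, ht.2⟩), mul_comm]
    exact mul_le_mul_of_nonneg_right (hK t) (hpos t ⟨ht.1.le, ht.2⟩)
  have h3 : |h b * v b| ≤ h b * K := by
    rw [abs_mul, abs_of_nonneg (by linarith)]
    exact mul_le_mul_of_nonneg_left (hK b) (by linarith)
  have h4 : |h 0 * v 0| ≤ h 0 * K := by
    rw [abs_mul, abs_of_nonneg h0]
    exact mul_le_mul_of_nonneg_left (hK 0) h0
  -- The three pieces add up to `K * (h b + h 0 + (h b - h 0))`, hence the factor 2.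
  rw [abs_le] at *
  constructor <;> linarith

/-- The factor `1 + t` of `1 - t ^ 2` is at least one, so the singularity at 1 is no worse than that
of `(1 - t) ^ α`. -/
theorem one_sub_sq_rpow_le {α t : ℝ} (hα : α ≤ 0) (ht : 0 ≤ t) (ht1 : t < 1) :
    (1 - t ^ 2) ^ α ≤ (1 - t) ^ α :=
  Real.rpow_le_rpow_of_nonpos (by linarith) (by nlinarith) hα

theorem intervalIntegrable_one_sub_rpow {α : ℝ} (hα : -1 < α) (a b : ℝ) :
    IntervalIntegrable (fun t : ℝ => (1 - t) ^ α) volume a b := by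
  have h := (intervalIntegral.intervalIntegrable_rpow' hα (a := 1 - a) (b := 1 - b)).comp_sub_left
    (c := 1)
  simpa using h

theorem measurable_one_sub_sq_rpow (α : ℝ) : Measurable fun t : ℝ => (1 - t ^ 2) ^ α := by
  fun_prop

theorem intervalIntegrable_one_sub_sq_rpow {α : ℝ} (hα : -1 < α) {a b : ℝ} (ha : 0 ≤ a)
    (hab : a ≤ b) (hb : b ≤ 1) :
    IntervalIntegrable (fun t : ℝ => (1 - t ^ 2) ^ α) volume a b := by
  rcases le_or_gt 0 α with h | h
  · exact (Continuous.rpow_const (by fun_prop) fun _ => Or.inr h).intervalIntegrable _ _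
  · refine (intervalIntegrable_one_sub_rpow hα a b).mono_fun
      (measurable_one_sub_sq_rpow α).aestronglyMeasurable ?_
    have hne : ∀ᵐ t : ℝ ∂volume.restrict (Set.uIoc a b), t ≠ 1 := by
      refine ae_restrict_of_ae ?_
      simp [ae_iff]
    filter_upwards [hne, ae_restrict_mem measurableSet_uIoc] with t ht1 ht
    rw [Set.uIoc_of_le hab] at ht
    have ht0 : 0 ≤ t := ha.trans ht.1.le
    have ht2 : t < 1 := lt_of_le_of_ne (ht.2.trans hb) ht1
    rw [Real.norm_eq_abs, Real.norm_eq_abs, abs_of_nonneg (Real.rpow_nonneg (by nlinarith) _),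
      abs_of_nonneg (Real.rpow_nonneg (by linarith) _)]
    exact one_sub_sq_rpow_le h.le ht0 ht2

/-- The oscillatory integral of an amplitude `g t * (1 - t ^ 2) ^ α` with an integrable singularity
at `1`. -/
theorem abs_integral_oscillatory_le {α l : ℝ} (hα : -1 < α) (hα0 : α ≤ 0) (hl : 1 ≤ l)
    {g g' v w : ℝ → ℝ} (hg : ∀ t, HasDerivAt g (g' t) t) (hg'c : Continuous g')
    (hg' : ∀ t, 0 ≤ g' t) (hg0 : ∀ t ∈ Set.Icc (0 : ℝ) 1, 0 ≤ g t)
    (hg1 : ∀ t ∈ Set.Icc (0 : ℝ) 1, g t ≤ 1)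
    (hv : ∀ t, HasDerivAt v (w t) t) (hw : Continuous w) (hw1 : ∀ t, |w t| ≤ 1)
    (hK : ∀ t, |v t| ≤ l⁻¹) :
    |∫ t in (0 : ℝ)..1, g t * (1 - t ^ 2) ^ α * w t| ≤ (2 + (α + 1)⁻¹) * l ^ (-(α + 1)) := by
  -- Cut at distance `1 / l` from the singularity. Before `b` the amplitude increases to at most `l
  -- ^ (-α)` and oscillation saves `1 / l`; after `b` the integral of `(1 - t) ^ α` is already of
  -- order `l ^ (-(α + 1))`.
  set b : ℝ := 1 - l⁻¹ with hbdef
  have hl0 : 0 < l := by linarith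
  have hlinv : 0 < l⁻¹ := by positivity
  have hlinv1 : l⁻¹ ≤ 1 := inv_le_one_of_one_le₀ hl
  have hb0 : 0 ≤ b := by rw [hbdef]; linarith
  have hb1 : b < 1 := by rw [hbdef]; linarith
  have hgc : Continuous g := continuous_iff_continuousAt.2 fun t => (hg t).continuousAt
  have hint : ∀ a c : ℝ, 0 ≤ a → a ≤ c → c ≤ 1 → IntervalIntegrable
      (fun t : ℝ => g t * (1 - t ^ 2) ^ α * w t) volume a c := fun a c h1 h2 h3 =>
    ((intervalIntegrable_one_sub_sq_rpow hα h1 h2 h3).continuousOn_mul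
      hgc.continuousOn).mul_continuousOn hw.continuousOn
  rw [← intervalIntegral.integral_add_adjacent_intervals (hint 0 b le_rfl hb0 hb1.le)
    (hint b 1 hb0 hb1.le le_rfl)]
  have hpos : ∀ t ∈ Set.Icc 0 b, 0 < 1 - t ^ 2 := fun t ht => by nlinarith [ht.1, ht.2]
  have h1 : |∫ t in (0 : ℝ)..b, g t * (1 - t ^ 2) ^ α * w t| ≤ 2 * l ^ (-(α + 1)) := by
    have hd : ∀ t ∈ Set.Icc 0 b, HasDerivAt (fun t => g t * (1 - t ^ 2) ^ α)
        (g' t * (1 - t ^ 2) ^ α + g t * ((-(2 * t)) * α * (1 - t ^ 2) ^ (α - 1))) t := by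
      intro t ht
      have h1 : HasDerivAt (fun t : ℝ => 1 - t ^ 2) (-(2 * t)) t := by
        simpa using (hasDerivAt_pow 2 t).const_sub 1
      exact (hg t).mul (h1.rpow_const (Or.inl (hpos t ht).ne'))
    have h2 := abs_integral_mul_le_of_monotone hb0 hd ?_ ?_ ?_ hv hw hK
    · refine h2.trans ?_
      have h3 : g b * (1 - b ^ 2) ^ α ≤ 1 * (l⁻¹) ^ α := by
        refine mul_le_mul (hg1 b ⟨hb0, hb1.le⟩) ?_ (Real.rpow_nonneg (hpos b ⟨hb0, le_rfl⟩).le _)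
          zero_le_one
        have := one_sub_sq_rpow_le hα0 hb0 hb1
        rwa [show 1 - b = l⁻¹ by rw [hbdef]; ring] at this
      have h4 : l ^ (-(α + 1)) = l⁻¹ * (l⁻¹) ^ α := by
        rw [Real.inv_rpow hl0.le, ← Real.rpow_neg hl0.le, ← Real.rpow_neg_one l,
          ← Real.rpow_add hl0]
        congr 1
        ring
      rw [h4]
      have := mul_le_mul_of_nonneg_left h3 (by positivity : (0 : ℝ) ≤ 2 * l⁻¹)
      linarith
    · refine (hg'c.continuousOn.mul ?_).add (hgc.continuousOn.mul
        (ContinuousOn.mul (by fun_prop) ?_))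
      · exact ContinuousOn.rpow_const (by fun_prop) fun t ht => Or.inl (hpos t ht).ne'
      · exact ContinuousOn.rpow_const (by fun_prop) fun t ht => Or.inl (hpos t ht).ne'
    · simpa using hg0 0 (by simp)
    · intro t ht
      have hp := hpos t ht
      have hgt := hg0 t ⟨ht.1, ht.2.trans hb1.le⟩
      have h5 : 0 ≤ -(2 * t) * α := by nlinarith [ht.1]
      have := hg' t
      positivity
  have h2 : |∫ t in b..1, g t * (1 - t ^ 2) ^ α * w t| ≤ (α + 1)⁻¹ * l ^ (-(α + 1)) := by
    have h3 : ∫ t in b..1, (1 - t) ^ α = (α + 1)⁻¹ * l ^ (-(α + 1)) := by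
      rw [intervalIntegral.integral_comp_sub_left (fun t => t ^ α) 1, integral_rpow (Or.inl hα),
        sub_self, Real.zero_rpow (by linarith), show 1 - b = l⁻¹ by rw [hbdef]; ring,
        Real.inv_rpow hl0.le, ← Real.rpow_neg hl0.le]
      ring
    rw [← h3]
    refine intervalIntegral.norm_integral_le_of_norm_le hb1.le
      (f := fun t => g t * (1 - t ^ 2) ^ α * w t) ?_ (intervalIntegrable_one_sub_rpow hα b 1)
    have hne : ∀ᵐ t : ℝ, t ≠ 1 := by simp [ae_iff]
    filter_upwards [hne] with t ht1 ht
    have ht2 : t < 1 := lt_of_le_of_ne ht.2 ht1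
    have ht0 : 0 ≤ t := hb0.trans ht.1.le
    have hp : 0 ≤ (1 - t ^ 2) ^ α := Real.rpow_nonneg (by nlinarith) _
    rw [Real.norm_eq_abs, abs_mul, abs_mul, abs_of_nonneg hp, abs_of_nonneg (hg0 t ⟨ht0, ht.2⟩)]
    have h6 := one_sub_sq_rpow_le hα0 ht0 ht2
    calc g t * (1 - t ^ 2) ^ α * |w t| ≤ 1 * (1 - t ^ 2) ^ α * 1 := by
          gcongr
          · exact hg1 t ⟨ht0, ht.2⟩
          · exact hw1 t
      _ ≤ (1 - t) ^ α := by simpa using h6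
  exact (abs_add_le _ _).trans (by linarith)

/-- The cosine transform of `(1 - t ^ 2) ^ α` on `[0, 1]`. -/
noncomputable def cosTransform (α l : ℝ) : ℝ :=
  ∫ t in (0 : ℝ)..1, (1 - t ^ 2) ^ α * Real.cos (l * t)

/-- The sine transform of `t * (1 - t ^ 2) ^ α` on `[0, 1]`. -/
noncomputable def sinTransform (α l : ℝ) : ℝ :=
  ∫ t in (0 : ℝ)..1, t * (1 - t ^ 2) ^ α * Real.sin (l * t)

theorem hasDerivAt_sin_mul_div {l : ℝ} (hl : l ≠ 0) (t : ℝ) :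
    HasDerivAt (fun t => Real.sin (l * t) / l) (Real.cos (l * t)) t := by
  have h := ((Real.hasDerivAt_sin (l * t)).comp t ((hasDerivAt_id t).const_mul l)).div_const l
  simpa [hl, Function.comp_def] using h

theorem hasDerivAt_neg_cos_mul_div {l : ℝ} (hl : l ≠ 0) (t : ℝ) :
    HasDerivAt (fun t => -Real.cos (l * t) / l) (Real.sin (l * t)) t := by
  have h := (((Real.hasDerivAt_cos (l * t)).comp t
    ((hasDerivAt_id t).const_mul l)).neg).div_const l
  simpa [hl, Function.comp_def] using h

theorem abs_div_le_inv {x l : ℝ} (hl : 0 < l) (hx : |x| ≤ 1) : |x / l| ≤ l⁻¹ := by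
  rw [abs_div, abs_of_pos hl, div_eq_mul_inv]
  exact mul_le_of_le_one_left (by positivity) hx

theorem cosTransform_base {α : ℝ} (hα : -1 < α) (hα0 : α ≤ 0) {l : ℝ} (hl : 1 ≤ l) :
    |cosTransform α l| ≤ (2 + (α + 1)⁻¹) * l ^ (-(α + 1)) := by
  have hl0 : 0 < l := by linarith
  have := abs_integral_oscillatory_le hα hα0 hl (g := fun _ => 1) (g' := fun _ => 0)
    (fun t => hasDerivAt_const _ _) continuous_const (fun _ => le_rfl) (by simp) (by simp)
    (fun t => hasDerivAt_sin_mul_div hl0.ne' t) (by fun_prop) (fun t => Real.abs_cos_le_one _)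
    (fun t => abs_div_le_inv hl0 (Real.abs_sin_le_one _))
  simpa [cosTransform] using this

theorem sinTransform_base {α : ℝ} (hα : -1 < α) (hα0 : α ≤ 0) {l : ℝ} (hl : 1 ≤ l) :
    |sinTransform α l| ≤ (2 + (α + 1)⁻¹) * l ^ (-(α + 1)) := by
  have hl0 : 0 < l := by linarith
  exact abs_integral_oscillatory_le hα hα0 hl (g := fun t => t) (g' := fun _ => 1)
    (fun t => hasDerivAt_id _) continuous_const (fun _ => zero_le_one) (fun t ht => ht.1)
    (fun t ht => ht.2)
    (fun t => hasDerivAt_neg_cos_mul_div hl0.ne' t) (by fun_prop)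
    (fun t => Real.abs_sin_le_one _)
    (fun t => abs_div_le_inv hl0 (by simpa using Real.abs_cos_le_one _))

theorem hasDerivAt_one_sub_sq_rpow {α t : ℝ} (ht : t ∈ Set.Ioo (0 : ℝ) 1) :
    HasDerivAt (fun t : ℝ => (1 - t ^ 2) ^ (α + 1))
      (-(2 * (α + 1)) * (t * (1 - t ^ 2) ^ α)) t := by
  have h1 : HasDerivAt (fun t : ℝ => 1 - t ^ 2) (-(2 * t)) t := by
    simpa using (hasDerivAt_pow 2 t).const_sub 1
  have h2 := h1.rpow_const (p := α + 1) (Or.inl (by nlinarith [ht.1, ht.2] : (1 - t ^ 2 : ℝ) ≠ 0))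
  convert h2 using 1
  rw [add_sub_cancel_right]
  ring

theorem intervalIntegrable_mul_one_sub_sq_rpow {α : ℝ} (hα : -1 < α) :
    IntervalIntegrable (fun t : ℝ => t * (1 - t ^ 2) ^ α) volume 0 1 :=
  (intervalIntegrable_one_sub_sq_rpow hα le_rfl zero_le_one le_rfl).continuousOn_mul
    continuousOn_id

/-- One integration by parts: the boundary terms vanish because `sin` is zero at 0 and `(1 - t ^ 2)
^ (α + 1)` is zero at 1. -/
theorem cosTransform_succ {α : ℝ} (hα : -1 < α) {l : ℝ} (hl : 0 < l) :
    cosTransform (α + 1) l = 2 * (α + 1) / l * sinTransform α l := by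
  unfold cosTransform sinTransform
  rw [intervalIntegral.integral_mul_deriv_eq_deriv_mul_of_hasDerivAt
    (u' := fun t => -(2 * (α + 1)) * (t * (1 - t ^ 2) ^ α)) (v := fun t => Real.sin (l * t) / l)]
  · rw [← intervalIntegral.integral_const_mul]
    simp only [one_pow, sub_self, mul_zero, Real.sin_zero, zero_div, sub_zero]
    rw [Real.zero_rpow (by linarith), zero_mul, zero_sub, ← intervalIntegral.integral_neg]
    congr 1
    ext t
    field_simp
  · exact (Continuous.rpow_const (by fun_prop) fun _ => Or.inr (by linarith)).continuousOn
  · fun_prop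
  · intro t ht
    simp only [zero_le_one, inf_of_le_left, sup_of_le_right] at ht
    exact hasDerivAt_one_sub_sq_rpow ht
  · intro t _
    exact hasDerivAt_sin_mul_div hl.ne' t
  · exact (intervalIntegrable_mul_one_sub_sq_rpow hα).const_mul _
  · exact Continuous.intervalIntegrable (by fun_prop) _ _

/-- Again by parts. Writing `t ^ 2 = 1 - (1 - t ^ 2)` in the derivative of `t * (1 - t ^ 2) ^ (α +
1)` leaves only cosine transforms. -/
theorem sinTransform_succ {α : ℝ} (hα : -1 < α) {l : ℝ} (hl : 0 < l) :
    sinTransform (α + 1) l =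
      l⁻¹ * ((2 * α + 3) * cosTransform (α + 1) l - 2 * (α + 1) * cosTransform α l) := by
  have hi0 := intervalIntegrable_one_sub_sq_rpow hα le_rfl zero_le_one le_rfl
  have hi1 := intervalIntegrable_one_sub_sq_rpow (α := α + 1) (by linarith) le_rfl zero_le_one
    le_rfl
  have hc : ContinuousOn (fun t => Real.cos (l * t)) (Set.uIcc 0 1) := by fun_prop
  unfold cosTransform sinTransform
  rw [intervalIntegral.integral_mul_deriv_eq_deriv_mul_of_hasDerivAt
    (u' := fun t => (2 * α + 3) * (1 - t ^ 2) ^ (α + 1) - 2 * (α + 1) * (1 - t ^ 2) ^ α)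
    (v := fun t => -Real.cos (l * t) / l)]
  · rw [← intervalIntegral.integral_const_mul, ← intervalIntegral.integral_const_mul,
      ← intervalIntegral.integral_sub, ← intervalIntegral.integral_const_mul]
    · simp only [one_pow, sub_self, zero_mul, mul_zero, sub_zero]
      rw [Real.zero_rpow (by linarith), mul_zero, zero_mul, zero_sub,
        ← intervalIntegral.integral_neg]
      congr 1
      ext t
      ring
    · exact (hi1.mul_continuousOn hc).const_mul _
    · exact (hi0.mul_continuousOn hc).const_mul _
  · exact (continuous_id.mul (Continuous.rpow_const (by fun_prop)
      fun _ => Or.inr (by linarith))).continuousOn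
  · fun_prop
  · intro t ht
    simp only [zero_le_one, inf_of_le_left, sup_of_le_right] at ht
    have h1 := (hasDerivAt_id t).mul (hasDerivAt_one_sub_sq_rpow (α := α) ht)
    refine h1.congr_deriv ?_
    have h2 : (1 - t ^ 2) ^ (α + 1) = (1 - t ^ 2) ^ α * (1 - t ^ 2) := by
      rw [Real.rpow_add (by nlinarith [ht.1, ht.2]), Real.rpow_one]
    simp only [id, h2]
    ring
  · intro t _
    exact hasDerivAt_neg_cos_mul_div hl.ne' t
  · exact (hi1.const_mul _).sub (hi0.const_mul _)
  · exact Continuous.intervalIntegrable (by fun_prop) _ _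

/-- Raising `α` by one gains a factor `1 / l`. The cosine and sine transforms are carried together
because each recursion calls on the other. -/
theorem transform_decay_succ {α C : ℝ} (hα : -1 < α)
    (h : ∀ l, 1 ≤ l → |cosTransform α l| ≤ C * l ^ (-(α + 1)) ∧
      |sinTransform α l| ≤ C * l ^ (-(α + 1))) :
    ∃ C', ∀ l, 1 ≤ l → |cosTransform (α + 1) l| ≤ C' * l ^ (-(α + 1 + 1)) ∧
      |sinTransform (α + 1) l| ≤ C' * l ^ (-(α + 1 + 1)) := by
  have hC : 0 ≤ C := by
    have := (abs_nonneg _).trans (h 1 le_rfl).1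
    simpa using this
  set K := 2 * (α + 1) * C with hK
  have hK0 : 0 ≤ K := by have : 0 < α + 1 := by linarith
                         positivity
  refine ⟨K + ((2 * α + 3) * K + K), fun l hl => ?_⟩
  have hl0 : 0 < l := by linarith
  have hs : l ^ (-(α + 1 + 1)) = l⁻¹ * l ^ (-(α + 1)) := by
    rw [← Real.rpow_neg_one l, ← Real.rpow_add hl0]
    congr 1
    ring
  have hp : 0 ≤ l ^ (-(α + 1)) := by positivity
  have hli : l⁻¹ ≤ 1 := inv_le_one_of_one_le₀ hl
  have hli0 : 0 ≤ l⁻¹ := by positivity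
  obtain ⟨h1, h2⟩ := h l hl
  have hA : |cosTransform (α + 1) l| ≤ K * (l⁻¹ * l ^ (-(α + 1))) := by
    rw [cosTransform_succ hα hl0, abs_mul, abs_of_nonneg (by have : 0 < α + 1 := by linarith
                                                             positivity)]
    calc 2 * (α + 1) / l * |sinTransform α l| ≤ 2 * (α + 1) / l * (C * l ^ (-(α + 1))) := by
          gcongr
          have : 0 < α + 1 := by linarith
          positivity
      _ = _ := by rw [hK]; ring
  have h23 : 0 ≤ 2 * α + 3 := by linarith
  rw [hs]
  refine ⟨hA.trans ?_, ?_⟩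
  · have : 0 ≤ ((2 * α + 3) * K + K) * (l⁻¹ * l ^ (-(α + 1))) := by positivity
    linarith
  · rw [sinTransform_succ hα hl0, abs_mul, abs_of_nonneg hli0]
    have h3 : |(2 * α + 3) * cosTransform (α + 1) l - 2 * (α + 1) * cosTransform α l| ≤
        (2 * α + 3) * K * l ^ (-(α + 1)) + K * l ^ (-(α + 1)) := by
      refine (abs_sub _ _).trans ?_
      rw [abs_mul, abs_mul, abs_of_nonneg h23, abs_of_nonneg (by linarith : 0 ≤ 2 * (α + 1))]
      have h4 : |cosTransform (α + 1) l| ≤ K * l ^ (-(α + 1)) :=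
        hA.trans (mul_le_mul_of_nonneg_left (mul_le_of_le_one_left hp hli) hK0)
      have h5 := mul_le_mul_of_nonneg_left h4 h23
      have h6 := mul_le_mul_of_nonneg_left h1 (by linarith : 0 ≤ 2 * (α + 1))
      rw [hK] at h5 ⊢
      linarith
    have h7 := mul_le_mul_of_nonneg_left h3 hli0
    have h8 : 0 ≤ K * (l⁻¹ * l ^ (-(α + 1))) := by positivity
    linarith

theorem exists_transform_decay (n : ℕ) :
    ∃ C, ∀ l, 1 ≤ l → |cosTransform (n / 2) l| ≤ C * l ^ (-((n : ℝ) / 2 + 1)) ∧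
      |sinTransform (n / 2) l| ≤ C * l ^ (-((n : ℝ) / 2 + 1)) := by
  induction n using Nat.strong_induction_on with
  | _ n ih =>
    match n with
    | 0 =>
      refine ⟨2 + (0 + 1)⁻¹, fun l hl => ?_⟩
      simpa using And.intro (cosTransform_base (α := 0) (by norm_num) le_rfl hl)
        (sinTransform_base (α := 0) (by norm_num) le_rfl hl)
    | 1 =>
      -- The odd exponents start from `α = -1 / 2`, where the amplitude is singular but integrable;
      -- `α = 1 / 2` itself lies outside the range of the base bounds.
      have h := transform_decay_succ (α := -1 / 2) (by norm_num) fun l hl =>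
        ⟨cosTransform_base (by norm_num) (by norm_num) hl,
          sinTransform_base (by norm_num) (by norm_num) hl⟩
      convert h using 9 <;> norm_num
    | n + 2 =>
      obtain ⟨C, hC⟩ := ih n (by omega)
      have h := transform_decay_succ (α := (n : ℝ) / 2)
        (by have : (0 : ℝ) ≤ n / 2 := by positivity
            linarith) hC
      have e : ((n + 2 : ℕ) : ℝ) / 2 = n / 2 + 1 := by push_cast; ring
      rw [e]
      exact h

/-- The Fourier transform of `(1 - t ^ 2) ^ (n / 2)` on `[-1, 1]` decays as
`l ^ (-(n / 2 + 1))`. -/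
theorem exists_cosTransform_le (n : ℕ) :
    ∃ C, 0 ≤ C ∧ ∀ l, 0 < l → |cosTransform (n / 2) l| ≤ C * l ^ (-((n : ℝ) / 2 + 1)) := by
  obtain ⟨C, hC⟩ := exists_transform_decay n
  have hC0 : 0 ≤ C := by
    have := (abs_nonneg _).trans (hC 1 le_rfl).1
    simpa using this
  -- The extra 1 covers `l ≤ 1`, where the transform is at most 1 and the power of `l` at least 1.
  refine ⟨C + 1, by linarith, fun l hl => ?_⟩
  have hp : 0 ≤ l ^ (-((n : ℝ) / 2 + 1)) := by positivity
  rcases le_total 1 l with h | h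
  · exact (hC l h).1.trans (by linarith)
  · have h1 : 1 ≤ l ^ (-((n : ℝ) / 2 + 1)) :=
      Real.one_le_rpow_of_pos_of_le_one_of_nonpos hl h (by
        have : (0 : ℝ) ≤ n / 2 := by positivity
        linarith)
    have h2 : |cosTransform (n / 2) l| ≤ 1 := by
      have := intervalIntegral.norm_integral_le_of_norm_le_const (a := 0) (b := 1) (C := 1)
        (f := fun t : ℝ => (1 - t ^ 2) ^ ((n : ℝ) / 2) * Real.cos (l * t)) (fun t ht => by
          rw [Set.uIoc_of_le zero_le_one] at ht
          have h0 : 0 ≤ 1 - t ^ 2 := by nlinarith [ht.1, ht.2]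
          rw [norm_mul, Real.norm_eq_abs, Real.norm_eq_abs,
            abs_of_nonneg (Real.rpow_nonneg h0 _)]
          exact mul_le_one₀ (Real.rpow_le_one h0 (by nlinarith) (by positivity)) (abs_nonneg _)
            (Real.abs_cos_le_one _))
      simpa [cosTransform] using this
    nlinarith

/-! ### Ellipsoids -/

/-- The positive quadratic form `y ↦ |y W|²` on row vectors. -/
def qf {n : ℕ} (W : Matrix (Fin n) (Fin n) ℝ) (y : Fin n → ℝ) : ℝ :=
  ∑ j, (Matrix.vecMul y W j) ^ 2

/-- The open ellipsoid `|y W|² < s`. -/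
def ell {n : ℕ} (W : Matrix (Fin n) (Fin n) ℝ) (s : ℝ) : Set (Fin n → ℝ) := {y | qf W y < s}

theorem qf_nonneg {n : ℕ} (W : Matrix (Fin n) (Fin n) ℝ) (y : Fin n → ℝ) : 0 ≤ qf W y :=
  Finset.sum_nonneg fun _ _ => sq_nonneg _

theorem qf_eq_norm_sq {n : ℕ} (W : Matrix (Fin n) (Fin n) ℝ) (y : Fin n → ℝ) :
    qf W y = ‖(WithLp.toLp 2 (Matrix.vecMul y W) : EuclideanSpace ℝ (Fin n))‖ ^ 2 := by
  rw [EuclideanSpace.real_norm_sq_eq]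
  rfl

theorem qf_vecMul {n : ℕ} (U W : Matrix (Fin n) (Fin n) ℝ) (y : Fin n → ℝ) :
    qf W (Matrix.vecMul y U) = qf (U * W) y := by
  simp [qf, Matrix.vecMul_vecMul]

theorem qf_smul {n : ℕ} (W : Matrix (Fin n) (Fin n) ℝ) (c : ℝ) (y : Fin n → ℝ) :
    qf W (c • y) = c ^ 2 * qf W y := by
  simp [qf, Matrix.smul_vecMul, mul_pow, Finset.mul_sum]

@[fun_prop]
theorem continuous_qf {n : ℕ} (W : Matrix (Fin n) (Fin n) ℝ) : Continuous (qf W) := by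
  unfold qf Matrix.vecMul dotProduct
  fun_prop

theorem measurableSet_ell {n : ℕ} (W : Matrix (Fin n) (Fin n) ℝ) (s : ℝ) :
    MeasurableSet (ell W s) :=
  (isOpen_lt (continuous_qf W) continuous_const).measurableSet

theorem ell_eq_empty {n : ℕ} (W : Matrix (Fin n) (Fin n) ℝ) {s : ℝ} (hs : s ≤ 0) :
    ell W s = ∅ :=
  Set.eq_empty_of_forall_notMem fun y hy => (hs.trans (qf_nonneg W y)).not_gt hy

theorem ell_eq_preimage {n : ℕ} (W : Matrix (Fin n) (Fin n) ℝ) (s : ℝ) :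
    ell W s = (fun y => Matrix.vecMul y W) ⁻¹' ell 1 s := by
  ext y
  simp [ell, qf]

theorem abs_lt_of_mem_ell_one {n : ℕ} {s : ℝ} {y : Fin n → ℝ} (hy : y ∈ ell 1 (s ^ 2))
    (hs : 0 ≤ s) (i : Fin n) : |y i| < s := by
  have h1 : ∑ j, (y j) ^ 2 < s ^ 2 := by simpa [ell, qf] using hy
  exact abs_lt_of_sq_lt_sq ((Finset.single_le_sum (f := fun j => (y j) ^ 2)
    (fun _ _ => sq_nonneg _) (Finset.mem_univ i)).trans_lt h1) hs

theorem measurableEmbedding_vecMul {n : ℕ} {W : Matrix (Fin n) (Fin n) ℝ} (hW : W.det ≠ 0) :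
    MeasurableEmbedding fun y : Fin n → ℝ => Matrix.vecMul y W := by
  have hu : IsUnit W.det := isUnit_iff_ne_zero.2 hW
  let e : (Fin n → ℝ) ≃ₜ (Fin n → ℝ) :=
    { toFun := fun y => Matrix.vecMul y W
      invFun := fun y => Matrix.vecMul y W⁻¹
      left_inv := fun y => by simp [Matrix.vecMul_vecMul, Matrix.mul_nonsing_inv _ hu]
      right_inv := fun y => by simp [Matrix.vecMul_vecMul, Matrix.nonsing_inv_mul _ hu]
      continuous_toFun := by fun_prop
      continuous_invFun := by fun_prop }
  exact e.measurableEmbedding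

theorem map_vecMul_volume {n : ℕ} {W : Matrix (Fin n) (Fin n) ℝ} (hW : W.det ≠ 0) :
    Measure.map (fun y : Fin n → ℝ => Matrix.vecMul y W) volume =
      ENNReal.ofReal |W.det|⁻¹ • volume := by
  have h := Real.map_matrix_volume_pi_eq_smul_volume_pi (M := W.transpose) (by simpa using hW)
  rw [Matrix.det_transpose, abs_inv] at h
  rw [← h]
  congr 1
  ext y
  simp [Matrix.mulVec_transpose]

theorem integral_comp_vecMul {n : ℕ} {W : Matrix (Fin n) (Fin n) ℝ} (hW : W.det ≠ 0)
    (f : (Fin n → ℝ) → ℂ) : ∫ y, f (Matrix.vecMul y W) = (|W.det|⁻¹ : ℝ) • ∫ y, f y := by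
  rw [← (measurableEmbedding_vecMul hW).integral_map f, map_vecMul_volume hW,
    integral_smul_measure, ENNReal.toReal_ofReal (by positivity)]

theorem lintegral_comp_vecMul {n : ℕ} {W : Matrix (Fin n) (Fin n) ℝ} (hW : W.det ≠ 0)
    (f : (Fin n → ℝ) → ENNReal) :
    ∫⁻ y, f (Matrix.vecMul y W) = ENNReal.ofReal |W.det|⁻¹ * ∫⁻ y, f y := by
  rw [← (measurableEmbedding_vecMul hW).lintegral_map f, map_vecMul_volume hW,
    lintegral_smul_measure, smul_eq_mul]

theorem volume_ell_one_lt_top (n : ℕ) (s : ℝ) :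
    volume (ell (1 : Matrix (Fin n) (Fin n) ℝ) s) < ⊤ := by
  rcases le_or_gt s 0 with hs | hs
  · simp [ell_eq_empty _ hs]
  · refine lt_of_le_of_lt (measure_mono (t := Set.Icc (fun _ => -√s) fun _ => √s) fun y hy => ?_)
      (isCompact_Icc.measure_lt_top)
    rw [← Real.sq_sqrt hs.le] at hy
    have := abs_lt_of_mem_ell_one hy (Real.sqrt_nonneg _)
    exact ⟨fun i => (abs_lt.1 (this i)).1.le, fun i => (abs_lt.1 (this i)).2.le⟩

theorem volume_ell {n : ℕ} {W : Matrix (Fin n) (Fin n) ℝ} (hW : W.det ≠ 0) (s : ℝ) :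
    volume (ell W s) =
      ENNReal.ofReal |W.det|⁻¹ * volume (ell (1 : Matrix (Fin n) (Fin n) ℝ) s) := by
  rw [ell_eq_preimage, ← (measurableEmbedding_vecMul hW).map_apply, map_vecMul_volume hW]
  rfl

theorem volume_ell_lt_top {n : ℕ} {W : Matrix (Fin n) (Fin n) ℝ} (hW : W.det ≠ 0) (s : ℝ) :
    volume (ell W s) < ⊤ := by
  rw [volume_ell hW]
  exact ENNReal.mul_lt_top ENNReal.ofReal_lt_top (volume_ell_one_lt_top n s)

/-- The volume of the ellipsoid `|y W|² < 1`. -/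
noncomputable def ellVol {n : ℕ} (W : Matrix (Fin n) (Fin n) ℝ) : ℝ := volume.real (ell W 1)

open scoped Pointwise in
theorem volume_real_ell {n : ℕ} (W : Matrix (Fin n) (Fin n) ℝ) {s : ℝ} (hs : 0 < s) :
    volume.real (ell W s) = s ^ ((n : ℝ) / 2) * ellVol W := by
  have hr : 0 < √s := Real.sqrt_pos.2 hs
  have h : ell W s = √s • ell W 1 := by
    ext y
    rw [Set.mem_smul_set_iff_inv_smul_mem₀ hr.ne']
    simp only [ell, Set.mem_ofPred_eq, qf_smul, inv_pow, Real.sq_sqrt hs.le]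
    rw [inv_mul_lt_iff₀ hs, mul_one]
  rw [h, ellVol, Measure.real, Measure.addHaar_smul, ENNReal.toReal_mul,
    ENNReal.toReal_ofReal (abs_nonneg _), abs_of_nonneg (by positivity), Module.finrank_fin_fun,
    Real.sqrt_eq_rpow, ← Real.rpow_mul_natCast hs.le]
  congr 2
  ring

theorem volume_real_ell_of_nonpos {n : ℕ} (W : Matrix (Fin n) (Fin n) ℝ) {s : ℝ} (hs : s ≤ 0) :
    volume.real (ell W s) = 0 := by
  simp [ell_eq_empty W hs]

theorem volume_real_ell_mul {n : ℕ} (U W : Matrix (Fin n) (Fin n) ℝ) (hU : U.det = 1)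
    (hW : W.det ≠ 0) (s : ℝ) : volume.real (ell (U * W) s) = volume.real (ell W s) := by
  rw [Measure.real, Measure.real, volume_ell hW, volume_ell (by simpa [hU] using hW),
    Matrix.det_mul, hU, one_mul]

/-! ### Slicing -/

/-- Fubini in the first coordinate: the term `v 0 * c` only translates each slice, so it does not
affect the slice's volume. It serves with `φ = 1` for volumes and with `φ` an exponential for
Fourier transforms. -/
theorem setIntegral_slice {n : ℕ} {a : ℝ} {c : Fin n → ℝ} {W : Matrix (Fin n) (Fin n) ℝ} {s : ℝ}
    {E : Set (Fin (n + 1) → ℝ)}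
    (hE : ∀ v, v ∈ E ↔ a * v 0 ^ 2 + qf W (fun i => v i.succ + v 0 * c i) < s)
    (hvol : volume E ≠ ⊤) {φ : ℝ → ℂ} (hφ : Continuous φ) (hφ1 : ∀ t, ‖φ t‖ ≤ 1) :
    ∫ v in E, φ (v 0) = ∫ t, φ t * (volume.real (ell W (s - a * t ^ 2)) : ℂ) := by
  have hEm : MeasurableSet E := by
    have : E = {v | a * v 0 ^ 2 + qf W (fun i => v i.succ + v 0 * c i) < s} := by
      ext v
      exact hE v
    rw [this]
    refine (isOpen_lt ?_ continuous_const).measurableSet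
    refine Continuous.add (by fun_prop) ((continuous_qf W).comp ?_)
    fun_prop
  have hint : IntegrableOn (fun v : Fin (n + 1) → ℝ => φ (v 0)) E := by
    refine ⟨(hφ.comp (continuous_apply 0)).aestronglyMeasurable, ?_⟩
    exact HasFiniteIntegral.restrict_of_bounded (C := 1) hvol.lt_top
      (Filter.Eventually.of_forall fun v => hφ1 _)
  have hint2 : Integrable (E.indicator fun v : Fin (n + 1) → ℝ => φ (v 0)) :=
    (integrable_indicator_iff hEm).2 hint
  let e := (MeasurableEquiv.piFinSuccAbove (fun _ : Fin (n + 1) => ℝ) 0).symm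
  have he : MeasurePreserving e (volume.prod volume) volume :=
    (volume_preserving_piFinSuccAbove (fun _ : Fin (n + 1) => ℝ) 0).symm _
  have he0 : ∀ p : ℝ × (Fin n → ℝ), e p 0 = p.1 := fun p => rfl
  have hes : ∀ (p : ℝ × (Fin n → ℝ)) (i : Fin n), e p i.succ = p.2 i := fun p i => by
    simp [e, MeasurableEquiv.piFinSuccAbove]
  rw [← integral_indicator hEm, ← he.integral_comp e.measurableEmbedding,
    integral_prod (fun p => E.indicator (fun v : Fin (n + 1) → ℝ => φ (v 0)) (e p))
      ((he.integrable_comp_emb e.measurableEmbedding).2 hint2)]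
  congr 1
  ext t
  have hset : ∀ y, E.indicator (fun v : Fin (n + 1) → ℝ => φ (v 0)) (e (t, y)) =
      ((fun y => y + t • c) ⁻¹' ell W (s - a * t ^ 2)).indicator (fun _ => φ t) y := by
    intro y
    have hiff : e (t, y) ∈ E ↔ y ∈ (fun y => y + t • c) ⁻¹' ell W (s - a * t ^ 2) := by
      rw [hE]
      simp only [he0, hes, ell, Set.mem_preimage, Set.mem_ofPred_eq]
      rw [lt_sub_iff_add_lt']
      rfl
    by_cases h : e (t, y) ∈ E
    · rw [Set.indicator_of_mem h, Set.indicator_of_mem (hiff.1 h), he0]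
    · rw [Set.indicator_of_notMem h, Set.indicator_of_notMem (hiff.not.1 h)]
  simp_rw [hset]
  rw [integral_indicator_const _ ((measurable_add_const _) (measurableSet_ell _ _)), Measure.real,
    measure_preimage_add_right, Complex.real_smul, mul_comm]
  rfl

/-- The function `(ρ² - t²)_+ ^ (n / 2)`. -/
noncomputable def profile (n : ℕ) (ρ t : ℝ) : ℝ :=
  if t ^ 2 < ρ ^ 2 then (ρ ^ 2 - t ^ 2) ^ ((n : ℝ) / 2) else 0

/-- The profile is even, so the sine part cancels between `t` and `-t`; scaling by `ρ` brings the
half line to `[0, 1]`. -/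
theorem integral_exp_mul_profile (n : ℕ) {ρ : ℝ} (hρ : 0 < ρ) (l : ℝ) :
    ∫ t : ℝ, Complex.exp (-(l * t : ℝ) * Complex.I) * (profile n ρ t : ℂ) =
      (2 * ρ ^ (n + 1) * cosTransform (n / 2) (l * ρ) : ℝ) := by
  set f : ℝ → ℂ := fun t => Complex.exp (-(l * t : ℝ) * Complex.I) *
    (((ρ ^ 2 - t ^ 2) ^ ((n : ℝ) / 2) : ℝ) : ℂ) with hf
  have hfc : Continuous f := by
    have h1 : Continuous fun t : ℝ => (ρ ^ 2 - t ^ 2) ^ ((n : ℝ) / 2) :=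
      Continuous.rpow_const (by fun_prop) fun _ => Or.inr (by positivity)
    have h2 := Complex.continuous_ofReal.comp h1
    refine Continuous.mul ?_ h2
    fun_prop
  have h1 : ∀ t : ℝ, Complex.exp (-(l * t : ℝ) * Complex.I) * (profile n ρ t : ℂ) =
      (Set.Ioo (-ρ) ρ).indicator f t := by
    intro t
    have : t ^ 2 < ρ ^ 2 ↔ t ∈ Set.Ioo (-ρ) ρ := by
      rw [sq_lt_sq, abs_of_pos hρ, abs_lt]
      rfl
    by_cases h : t ∈ Set.Ioo (-ρ) ρ
    · rw [Set.indicator_of_mem h, profile, if_pos (this.2 h)]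
    · rw [Set.indicator_of_notMem h, profile, if_neg (this.not.2 h)]
      simp
  simp_rw [h1]
  rw [integral_indicator measurableSet_Ioo, ← integral_Ioc_eq_integral_Ioo,
    ← intervalIntegral.integral_of_le (by linarith),
    ← intervalIntegral.integral_add_adjacent_intervals (b := 0) (hfc.intervalIntegrable _ _)
      (hfc.intervalIntegrable _ _)]
  have h2 : ∫ t in (-ρ)..0, f t = ∫ t in (0 : ℝ)..ρ, f (-t) := by
    rw [intervalIntegral.integral_comp_neg, neg_zero]
  have hfn : Continuous fun t => f (-t) := hfc.comp continuous_neg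
  rw [h2, ← intervalIntegral.integral_add (hfn.intervalIntegrable _ _)
    (hfc.intervalIntegrable _ _)]
  have h3 : ∀ t, f (-t) + f t =
      ((2 * ((ρ ^ 2 - t ^ 2) ^ ((n : ℝ) / 2) * Real.cos (l * t)) : ℝ) : ℂ) := by
    intro t
    simp only [hf, neg_sq]
    rw [← add_mul]
    have : Complex.exp (-(l * -t : ℝ) * Complex.I) + Complex.exp (-(l * t : ℝ) * Complex.I) =
        2 * ((Real.cos (l * t) : ℝ) : ℂ) := by
      rw [Complex.ofReal_cos, Complex.cos]
      push_cast
      ring_nf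
    rw [this]
    push_cast
    ring
  simp_rw [h3]
  rw [intervalIntegral.integral_ofReal, intervalIntegral.integral_const_mul]
  congr 1
  have h4 := intervalIntegral.smul_integral_comp_mul_left (E := ℝ) (a := 0) (b := 1)
    (fun t => (ρ ^ 2 - t ^ 2) ^ ((n : ℝ) / 2) * Real.cos (l * t)) ρ
  rw [mul_zero, mul_one] at h4
  rw [← h4, smul_eq_mul, cosTransform, mul_assoc]
  congr 1
  rw [← intervalIntegral.integral_const_mul, ← intervalIntegral.integral_const_mul]
  refine intervalIntegral.integral_congr fun t ht => ?_
  rw [Set.uIcc_of_le zero_le_one] at ht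
  have h5 : (ρ ^ 2 - (ρ * t) ^ 2) ^ ((n : ℝ) / 2) = ρ ^ n * (1 - t ^ 2) ^ ((n : ℝ) / 2) := by
    rw [show ρ ^ 2 - (ρ * t) ^ 2 = ρ ^ 2 * (1 - t ^ 2) by ring,
      Real.mul_rpow (by positivity) (by nlinarith [ht.1, ht.2]), ← Real.rpow_natCast ρ 2,
      ← Real.rpow_mul hρ.le, ← Real.rpow_natCast ρ n]
    congr 2
    push_cast
    ring
  simp only [h5]
  rw [pow_succ, show l * (ρ * t) = l * ρ * t by ring]
  ring

theorem volume_real_ell_sub {n : ℕ} (W : Matrix (Fin n) (Fin n) ℝ) {a ρ : ℝ} (ha : 0 < a)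
    (t : ℝ) :
    volume.real (ell W (a * ρ ^ 2 - a * t ^ 2)) =
      a ^ ((n : ℝ) / 2) * ellVol W * profile n ρ t := by
  rw [← mul_sub]
  by_cases h : t ^ 2 < ρ ^ 2
  · rw [volume_real_ell W (mul_pos ha (sub_pos.2 h)), profile, if_pos h,
      Real.mul_rpow ha.le (sub_pos.2 h).le]
    ring
  · rw [volume_real_ell_of_nonpos W (mul_nonpos_of_nonneg_of_nonpos ha.le (by linarith)), profile,
      if_neg h, mul_zero]

/-! ### Rotations -/

/-- Two vectors of equal length are exchanged by the reflection in the hyperplane orthogonal to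
their difference. -/
theorem exists_isometry_map_eq_single {n : ℕ} (z : EuclideanSpace ℝ (Fin (n + 1))) :
    ∃ R : EuclideanSpace ℝ (Fin (n + 1)) ≃ₗᵢ[ℝ] EuclideanSpace ℝ (Fin (n + 1)),
      R z = EuclideanSpace.single 0 ‖z‖ := by
  refine ⟨Submodule.reflection (ℝ ∙ (z - EuclideanSpace.single 0 ‖z‖))ᗮ,
    Submodule.reflection_sub ?_⟩
  simp

/-- Completing the square: splitting off the first coordinate of the quadratic form `qf W`. -/
theorem exists_qf_split {n : ℕ} (W : Matrix (Fin (n + 1)) (Fin (n + 1)) ℝ) (hW : W.det ≠ 0) :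
    ∃ (a : ℝ) (c : Fin n → ℝ) (W' : Matrix (Fin n) (Fin n) ℝ), 0 < a ∧ W'.det ≠ 0 ∧
      ∀ v, qf W v = a * v 0 ^ 2 + qf W' (fun i => v i.succ + v 0 * c i) := by
  have hu : IsUnit W.det := isUnit_iff_ne_zero.2 hW
  let row : Fin (n + 1) → EuclideanSpace ℝ (Fin (n + 1)) := fun i => WithLp.toLp 2 (W i)
  -- The first column of `W⁻¹` is orthogonal to every row of `W` but the first. An isometry taking
  -- it to the first axis therefore clears the first entry of all the other rows, which makes the
  -- matrix `V` of transformed rows block triangular.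
  let z : EuclideanSpace ℝ (Fin (n + 1)) := WithLp.toLp 2 (fun j => W⁻¹ j 0)
  have hz : ∀ i, inner ℝ (row i) z = (1 : Matrix (Fin (n + 1)) (Fin (n + 1)) ℝ) i 0 := by
    intro i
    rw [← Matrix.mul_nonsing_inv W hu, Matrix.mul_apply, PiLp.inner_apply]
    exact Finset.sum_congr rfl fun j _ => by simp [row, z, mul_comm]
  obtain ⟨R, hR⟩ := exists_isometry_map_eq_single z
  have hz0 : ‖z‖ ≠ 0 := by
    intro h
    have h0 := hz 0
    rw [norm_eq_zero.1 h] at h0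
    simp at h0
  have hR0 : ∀ i : Fin n, R (row i.succ) 0 = 0 := by
    intro i
    have h1 : inner ℝ (R (row i.succ)) (R z) = 0 := by
      rw [R.inner_map_map, hz]
      simp
    rw [hR, EuclideanSpace.inner_single_right] at h1
    simpa [hz0] using h1
  let V : Matrix (Fin (n + 1)) (Fin (n + 1)) ℝ := Matrix.of fun i j => R (row i) j
  have hV : ∀ v, (WithLp.toLp 2 (Matrix.vecMul v V) : EuclideanSpace ℝ (Fin (n + 1))) =
      R (WithLp.toLp 2 (Matrix.vecMul v W)) := by
    intro v
    have h1 : (WithLp.toLp 2 (Matrix.vecMul v W) : EuclideanSpace ℝ (Fin (n + 1))) =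
        ∑ i, v i • row i := by
      ext j
      simp [row, Matrix.vecMul, dotProduct]
    rw [h1, map_sum]
    ext j
    simp [V, Matrix.vecMul, dotProduct]
  have hVdet : V.det ≠ 0 := by
    intro h
    obtain ⟨v, hv, hv0⟩ := Matrix.exists_vecMul_eq_zero_iff.2 h
    have h1 := hV v
    rw [hv0, WithLp.toLp_zero, eq_comm, map_eq_zero_iff R R.injective] at h1
    have h2 : Matrix.vecMul v W = 0 := by
      simpa using congrArg (WithLp.ofLp) h1
    exact hW (Matrix.exists_vecMul_eq_zero_iff.1 ⟨v, hv, h2⟩)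
  let W' : Matrix (Fin n) (Fin n) ℝ := V.submatrix Fin.succ Fin.succ
  have hdet : V.det = V 0 0 * W'.det := by
    rw [Matrix.det_succ_column_zero, Fin.sum_univ_succ]
    have : ∀ i : Fin n, V i.succ 0 = 0 := hR0
    simp [this, W', Fin.succAbove_zero]
  rw [hdet] at hVdet
  have hp : V 0 0 ≠ 0 := left_ne_zero_of_mul hVdet
  have hW' : W'.det ≠ 0 := right_ne_zero_of_mul hVdet
  have hu' : IsUnit W'.det := isUnit_iff_ne_zero.2 hW'
  -- The corner of `V` gives `a`, and `c` solves `c W' = ` the rest of the first row of `V`.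
  refine ⟨V 0 0 ^ 2, Matrix.vecMul (fun j => V 0 j.succ) W'⁻¹, W', by positivity, hW', fun v => ?_⟩
  have h1 : qf W v = qf V v := by
    rw [qf_eq_norm_sq, qf_eq_norm_sq, hV, R.norm_map]
  have h2 : Matrix.vecMul (fun i : Fin n => v i.succ + v 0 *
      Matrix.vecMul (fun j => V 0 j.succ) W'⁻¹ i) W' =
      fun j => Matrix.vecMul v V j.succ := by
    have h3 : (fun i : Fin n => v i.succ + v 0 * Matrix.vecMul (fun j => V 0 j.succ) W'⁻¹ i) =
        (fun i : Fin n => v i.succ) + v 0 • Matrix.vecMul (fun j => V 0 j.succ) W'⁻¹ := rfl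
    rw [h3, Matrix.add_vecMul, Matrix.smul_vecMul, Matrix.vecMul_vecMul,
      Matrix.nonsing_inv_mul _ hu', Matrix.vecMul_one]
    ext j
    simp only [Pi.add_apply, Pi.smul_apply, smul_eq_mul, Matrix.vecMul, dotProduct,
      Fin.sum_univ_succ (n := n)]
    simp [W', add_comm]
  have h4 : Matrix.vecMul v V 0 = V 0 0 * v 0 := by
    have : ∀ i : Fin n, V i.succ 0 = 0 := hR0
    simp [Matrix.vecMul, dotProduct, Fin.sum_univ_succ, this, mul_comm]
  rw [h1, qf, qf, h2, Fin.sum_univ_succ, h4, mul_pow]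

/-! ### Fourier transforms of balls and ellipsoids -/

/-- The additive character `y ↦ exp (-2 π i ⟨ξ, y⟩)`. -/
noncomputable def echar {n : ℕ} (ξ y : Fin n → ℝ) : ℂ :=
  Complex.exp (-(2 * Real.pi * dotProduct ξ y : ℝ) * Complex.I)

theorem norm_echar {n : ℕ} (ξ y : Fin n → ℝ) : ‖echar ξ y‖ = 1 := by
  rw [echar, ← Complex.ofReal_neg, Complex.norm_exp_ofReal_mul_I]

@[fun_prop]
theorem continuous_echar {n : ℕ} (ξ : Fin n → ℝ) : Continuous (echar ξ) := by
  unfold echar dotProduct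
  fun_prop

/-- After rotating `ξ` onto the first axis the character depends on the first coordinate alone, and
the slices of the ball are balls whose volumes are multiples of `profile n ρ`. -/
theorem integral_echar_ball {n : ℕ} (ξ : Fin (n + 1) → ℝ) {ρ : ℝ} (hρ : 0 < ρ) :
    ∫ y in ell 1 (ρ ^ 2), echar ξ y =
      (ellVol (1 : Matrix (Fin n) (Fin n) ℝ) * (2 * ρ ^ (n + 1) * cosTransform (n / 2)
        (2 * Real.pi * ‖(WithLp.toLp 2 ξ : EuclideanSpace ℝ (Fin (n + 1)))‖ * ρ)) : ℝ) := by
  set z : EuclideanSpace ℝ (Fin (n + 1)) := WithLp.toLp 2 ξ with hz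
  obtain ⟨R, hR⟩ := exists_isometry_map_eq_single z
  set l : ℝ := 2 * Real.pi * ‖z‖ with hl
  have hball : ∀ y : Fin (n + 1) → ℝ, y ∈ ell 1 (ρ ^ 2) ↔
      ‖(WithLp.toLp 2 y : EuclideanSpace ℝ (Fin (n + 1)))‖ ^ 2 < ρ ^ 2 := by
    intro y
    simp [ell, qf_eq_norm_sq]
  let T := fun y : Fin (n + 1) → ℝ =>
    (WithLp.ofLp (R.symm (WithLp.toLp 2 y : EuclideanSpace ℝ (Fin (n + 1)))) : Fin (n + 1) → ℝ)
  have hTm : MeasurePreserving T :=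
    (PiLp.volume_preserving_ofLp (Fin (n + 1))).comp
      (R.symm.measurePreserving.comp (PiLp.volume_preserving_toLp (Fin (n + 1))))
  have hTe : MeasurableEmbedding T :=
    ((MeasurableEquiv.toLp 2 (Fin (n + 1) → ℝ)).symm.measurableEmbedding).comp
      (R.symm.toHomeomorph.measurableEmbedding.comp
        (MeasurableEquiv.toLp 2 (Fin (n + 1) → ℝ)).measurableEmbedding)
  have hpre : T ⁻¹' ell 1 (ρ ^ 2) = ell 1 (ρ ^ 2) := by
    ext y
    rw [Set.mem_preimage, hball, hball]
    simp [T]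
  have hint : ∀ y, echar ξ (T y) = Complex.exp (-(l * y 0 : ℝ) * Complex.I) := by
    intro y
    have h1 : dotProduct ξ (T y) = ‖z‖ * y 0 := by
      have h2 : inner ℝ z (R.symm (WithLp.toLp 2 y)) = dotProduct ξ (T y) := by
        rw [PiLp.inner_apply]
        exact Finset.sum_congr rfl fun j _ => by simp [hz, T, mul_comm]
      rw [← h2, ← R.inner_map_map, R.apply_symm_apply, hR, EuclideanSpace.inner_single_left]
      simp
    rw [echar, h1, hl]
    congr 4
    ring
  rw [← hTm.setIntegral_preimage_emb hTe, hpre]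
  simp_rw [hint]
  rw [setIntegral_slice (a := 1) (c := 0) (W := (1 : Matrix (Fin n) (Fin n) ℝ)) (s := ρ ^ 2)
    (φ := fun t => Complex.exp (-(l * t : ℝ) * Complex.I))]
  · have h3 : ∀ t : ℝ, volume.real (ell (1 : Matrix (Fin n) (Fin n) ℝ) (ρ ^ 2 - 1 * t ^ 2)) =
        ellVol (1 : Matrix (Fin n) (Fin n) ℝ) * profile n ρ t := by
      intro t
      have := volume_real_ell_sub (1 : Matrix (Fin n) (Fin n) ℝ) (ρ := ρ) one_pos t
      simpa using this
    simp_rw [h3]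
    have h4 : ∀ t : ℝ, Complex.exp (-(l * t : ℝ) * Complex.I) *
        ((ellVol (1 : Matrix (Fin n) (Fin n) ℝ) * profile n ρ t : ℝ) : ℂ) =
        (ellVol (1 : Matrix (Fin n) (Fin n) ℝ) : ℂ) *
          (Complex.exp (-(l * t : ℝ) * Complex.I) * (profile n ρ t : ℂ)) := by
      intro t
      push_cast
      ring
    simp_rw [h4]
    rw [integral_const_mul, integral_exp_mul_profile n hρ, ← Complex.ofReal_mul]
  · intro v
    simp [ell, qf, Fin.sum_univ_succ]
  · exact (volume_ell_one_lt_top _ _).ne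
  · fun_prop
  · intro t
    rw [← Complex.ofReal_neg, Complex.norm_exp_ofReal_mul_I]

theorem ellVol_nonneg {n : ℕ} (W : Matrix (Fin n) (Fin n) ℝ) : 0 ≤ ellVol W :=
  ENNReal.toReal_nonneg

/-- The factor `ρ ^ (n + 1)` against the decay `(‖ξ‖ ρ) ^ (-(n / 2 + 1))` leaves `ρ ^ (n / 2)`. -/
theorem exists_norm_integral_echar_ball_le (n : ℕ) :
    ∃ C, 0 ≤ C ∧ ∀ (ξ : Fin (n + 1) → ℝ) (ρ : ℝ), ξ ≠ 0 → 0 < ρ →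
      ‖∫ y in ell 1 (ρ ^ 2), echar ξ y‖ ≤ C * ρ ^ ((n : ℝ) / 2) *
        ‖(WithLp.toLp 2 ξ : EuclideanSpace ℝ (Fin (n + 1)))‖ ^ (-((n : ℝ) / 2 + 1)) := by
  obtain ⟨C, hC0, hC⟩ := exists_cosTransform_le n
  have hv := ellVol_nonneg (1 : Matrix (Fin n) (Fin n) ℝ)
  refine ⟨ellVol (1 : Matrix (Fin n) (Fin n) ℝ) * 2 * C * (2 * Real.pi) ^ (-((n : ℝ) / 2 + 1)),
    by positivity, fun ξ ρ hξ hρ => ?_⟩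
  have hn : 0 < ‖(WithLp.toLp 2 ξ : EuclideanSpace ℝ (Fin (n + 1)))‖ := by
    rw [norm_pos_iff]
    simpa using hξ
  set N := ‖(WithLp.toLp 2 ξ : EuclideanSpace ℝ (Fin (n + 1)))‖
  rw [integral_echar_ball ξ hρ, Complex.norm_real, Real.norm_eq_abs, abs_mul, abs_mul, abs_mul,
    abs_of_nonneg hv, abs_of_pos (by positivity : 0 < ρ ^ (n + 1)), abs_two]
  have h1 := hC (2 * Real.pi * N * ρ) (by positivity)
  have h2 : (2 * Real.pi * N * ρ) ^ (-((n : ℝ) / 2 + 1)) =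
      (2 * Real.pi) ^ (-((n : ℝ) / 2 + 1)) * N ^ (-((n : ℝ) / 2 + 1)) *
        ρ ^ (-((n : ℝ) / 2 + 1)) := by
    rw [Real.mul_rpow (by positivity) hρ.le, Real.mul_rpow (by positivity) hn.le]
  have h3 : ρ ^ (n + 1) * ρ ^ (-((n : ℝ) / 2 + 1)) = ρ ^ ((n : ℝ) / 2) := by
    rw [← Real.rpow_natCast, ← Real.rpow_add hρ]
    congr 1
    push_cast
    ring
  rw [h2] at h1
  calc _ ≤ ellVol (1 : Matrix (Fin n) (Fin n) ℝ) * (2 * ρ ^ (n + 1) *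
        (C * ((2 * Real.pi) ^ (-((n : ℝ) / 2 + 1)) * N ^ (-((n : ℝ) / 2 + 1)) *
        ρ ^ (-((n : ℝ) / 2 + 1))))) := by gcongr
    _ = _ := by
      rw [← h3]
      ring

/-- Decay of the Fourier transform of an ellipsoid, uniform over matrices with bounded entries and
determinant bounded below. -/
theorem exists_norm_integral_echar_ell_le (n : ℕ) {B : ℝ} (hB : 0 < B) :
    ∃ C, 0 ≤ C ∧ ∀ (W : Matrix (Fin (n + 1)) (Fin (n + 1)) ℝ), W.det ≠ 0 → |W.det|⁻¹ ≤ B →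
      (∀ i j, |W i j| ≤ B) → ∀ (ξ : Fin (n + 1) → ℝ) (T s : ℝ), ξ ≠ 0 → 0 ≤ T → s ≤ T ^ 2 →
      ‖∫ y in ell W s, echar ξ y‖ ≤ C * T ^ ((n : ℝ) / 2) * ‖ξ‖ ^ (-((n : ℝ) / 2 + 1)) := by
  obtain ⟨C, hC0, hC⟩ := exists_norm_integral_echar_ball_le n
  -- Each entry of `W ζ` is a sum of `n + 1` terms of size at most `B * N`, where `N` is the
  -- Euclidean norm of `ζ`.
  set K : ℝ := (n + 1) * B with hK
  have hK0 : 0 < K := by positivity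
  refine ⟨B * C * K ^ ((n : ℝ) / 2 + 1), by positivity, fun W hW hd hWB ξ T s hξ hT hs => ?_⟩
  have hu : IsUnit W.det := isUnit_iff_ne_zero.2 hW
  rcases le_or_gt s 0 with h0 | h0
  · rw [ell_eq_empty W h0]
    simp only [Measure.restrict_empty, integral_zero_measure, norm_zero]
    positivity
  -- The substitution `y W` turns the ellipsoid into a ball and the frequency `ξ` into `W⁻¹ ξ`,
  -- which the bound on the entries of `W` keeps away from zero.
  set ζ : Fin (n + 1) → ℝ := Matrix.mulVec W⁻¹ ξ with hζ
  have hξζ : ξ = Matrix.mulVec W ζ := by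
    rw [hζ, Matrix.mulVec_mulVec, Matrix.mul_nonsing_inv _ hu, Matrix.one_mulVec]
  have hζ0 : ζ ≠ 0 := by
    intro h
    rw [h, Matrix.mulVec_zero] at hξζ
    exact hξ hξζ
  set N := ‖(WithLp.toLp 2 ζ : EuclideanSpace ℝ (Fin (n + 1)))‖ with hN
  have hnorm : ‖ξ‖ ≤ K * N := by
    refine (pi_norm_le_iff_of_nonneg (by positivity)).2 fun i => ?_
    rw [hξζ, Matrix.mulVec, dotProduct]
    refine (norm_sum_le _ _).trans ?_
    have : ∀ j ∈ Finset.univ, ‖W i j * ζ j‖ ≤ B * N := by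
      intro j _
      rw [norm_mul]
      exact mul_le_mul (hWB i j) (PiLp.norm_apply_le (WithLp.toLp 2 ζ : EuclideanSpace ℝ _) j)
        (norm_nonneg _) hB.le
    refine (Finset.sum_le_sum this).trans ?_
    simp [hK, mul_assoc]
  have hξ0 : 0 < ‖ξ‖ := norm_pos_iff.2 hξ
  have hint : ∫ y in ell W s, echar ξ y = (|W.det|⁻¹ : ℝ) • ∫ y in ell 1 s, echar ζ y := by
    rw [← integral_indicator (measurableSet_ell _ _), ← integral_indicator (measurableSet_ell _ _),
      ← integral_comp_vecMul hW]
    congr 1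
    ext y
    have h1 : echar ζ (Matrix.vecMul y W) = echar ξ y := by
      have : dotProduct ζ (Matrix.vecMul y W) = dotProduct ξ y := by
        rw [dotProduct_comm, ← Matrix.dotProduct_mulVec, ← hξζ, dotProduct_comm]
      rw [echar, this, echar]
    rw [ell_eq_preimage W]
    by_cases h : Matrix.vecMul y W ∈ ell 1 s
    · rw [Set.indicator_of_mem h,
        Set.indicator_of_mem (show y ∈ (fun y => Matrix.vecMul y W) ⁻¹' ell 1 s from h), h1]
    · rw [Set.indicator_of_notMem h,
        Set.indicator_of_notMem (show y ∉ (fun y => Matrix.vecMul y W) ⁻¹' ell 1 s from h)]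
  have hr : 0 < √s := Real.sqrt_pos.2 h0
  have hrT : √s ≤ T := Real.sqrt_le_iff.2 ⟨hT, hs⟩
  have h2 := hC ζ (√s) hζ0 hr
  rw [Real.sq_sqrt h0.le] at h2
  have h3 : N ^ (-((n : ℝ) / 2 + 1)) ≤ K ^ ((n : ℝ) / 2 + 1) * ‖ξ‖ ^ (-((n : ℝ) / 2 + 1)) := by
    have h4 : ‖ξ‖ / K ≤ N := by
      rw [div_le_iff₀ hK0, mul_comm]
      exact hnorm
    refine (Real.rpow_le_rpow_of_nonpos (by positivity) h4 ?_).trans (le_of_eq ?_)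
    · have : (0 : ℝ) ≤ n / 2 := by positivity
      linarith
    · rw [Real.div_rpow hξ0.le hK0.le, Real.rpow_neg hK0.le, div_inv_eq_mul, mul_comm]
  rw [hint, norm_smul, Real.norm_eq_abs, abs_of_nonneg (by positivity)]
  calc |W.det|⁻¹ * ‖∫ y in ell 1 s, echar ζ y‖ ≤
      B * (C * T ^ ((n : ℝ) / 2) * (K ^ ((n : ℝ) / 2 + 1) * ‖ξ‖ ^ (-((n : ℝ) / 2 + 1)))) := by
        refine mul_le_mul hd (h2.trans ?_) (norm_nonneg _) hB.le
        gcongr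
    _ = _ := by ring

/-! ### Sums of volumes of slices -/

theorem profile_eq_zero {n : ℕ} {ρ t : ℝ} (hρ : 0 ≤ ρ) (h : ρ ≤ |t|) : profile n ρ t = 0 := by
  rw [profile, if_neg]
  rw [not_lt, sq_le_sq, abs_of_nonneg hρ]
  exact h

theorem continuous_profile {n : ℕ} (hn : n ≠ 0) (ρ : ℝ) : Continuous (profile n ρ) := by
  have hpos : (0 : ℝ) < (n : ℝ) / 2 := by positivity
  have h : profile n ρ = fun t => (max (ρ ^ 2 - t ^ 2) 0) ^ ((n : ℝ) / 2) := by
    ext t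
    rw [profile]
    split_ifs with h
    · rw [max_eq_left (by linarith)]
    · rw [max_eq_right (by linarith), Real.zero_rpow hpos.ne']
  rw [h]
  exact Continuous.rpow_const (by fun_prop) fun _ => Or.inr hpos.le

theorem cosTransform_abs (α l : ℝ) : cosTransform α |l| = cosTransform α l := by
  rcases abs_cases l with h | h
  · rw [h.1]
  · rw [h.1]
    simp [cosTransform]

open scoped FourierTransform in
theorem exists_norm_fourier_profile_le (n : ℕ) :
    ∃ C, 0 ≤ C ∧ ∀ ρ : ℝ, 0 < ρ → ∀ w : ℝ, w ≠ 0 → ‖𝓕 (fun t => (profile n ρ t : ℂ)) w‖ ≤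
      C * ρ ^ ((n : ℝ) / 2) * |w| ^ (-((n : ℝ) / 2 + 1)) := by
  obtain ⟨C, hC0, hC⟩ := exists_cosTransform_le n
  refine ⟨2 * C * (2 * Real.pi) ^ (-((n : ℝ) / 2 + 1)), by positivity, fun ρ hρ w hw => ?_⟩
  have hw' : 0 < |w| := abs_pos.2 hw
  have h1 : 𝓕 (fun t => (profile n ρ t : ℂ)) w =
      (2 * ρ ^ (n + 1) * cosTransform (n / 2) (2 * Real.pi * w * ρ) : ℝ) := by
    rw [Real.fourier_real_eq_integral_exp_smul, ← integral_exp_mul_profile n hρ]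
    congr 1
    ext t
    rw [smul_eq_mul]
    congr 2
    push_cast
    ring
  have h2 : |cosTransform (n / 2) (2 * Real.pi * w * ρ)| ≤
      C * (2 * Real.pi * |w| * ρ) ^ (-((n : ℝ) / 2 + 1)) := by
    rw [← cosTransform_abs, abs_mul, abs_mul, abs_of_pos hρ, abs_of_pos Real.two_pi_pos]
    exact hC _ (by positivity)
  rw [h1, Complex.norm_real, Real.norm_eq_abs, abs_mul, abs_mul, abs_two,
    abs_of_pos (by positivity : 0 < ρ ^ (n + 1))]
  rw [Real.mul_rpow (by positivity) hρ.le, Real.mul_rpow (by positivity) hw'.le] at h2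
  have h3 : ρ ^ (n + 1) * ρ ^ (-((n : ℝ) / 2 + 1)) = ρ ^ ((n : ℝ) / 2) := by
    rw [← Real.rpow_natCast, ← Real.rpow_add hρ]
    congr 1
    push_cast
    ring
  calc _ ≤ 2 * ρ ^ (n + 1) * (C * ((2 * Real.pi) ^ (-((n : ℝ) / 2 + 1)) *
        |w| ^ (-((n : ℝ) / 2 + 1)) * ρ ^ (-((n : ℝ) / 2 + 1)))) := by gcongr
    _ = _ := by
      rw [← h3]
      ring

-- Poisson summation: the zero frequency is the integral, and the others are bounded by a multiple
-- of `ρ ^ (n / 2) * |k| ^ (-(n / 2 + 1))`, summable since `n ≥ 1`. The finite sum is complete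
-- because the profile vanishes for `|t| ≥ ρ`.
open scoped FourierTransform in
theorem exists_abs_sum_profile_sub_le_of_ne_zero {n : ℕ} (hn : n ≠ 0) :
    ∃ C, 0 ≤ C ∧ ∀ ρ : ℝ, 0 < ρ → ∀ X : ℕ, ρ ≤ X →
      |∑ m ∈ Finset.Icc (-X : ℤ) X, profile n ρ m - ∫ t, profile n ρ t| ≤
        C * ρ ^ ((n : ℝ) / 2) := by
  obtain ⟨C, hC0, hC⟩ := exists_norm_fourier_profile_le n
  have hb : (1 : ℝ) < (n : ℝ) / 2 + 1 := by
    have : (0 : ℝ) < (n : ℝ) / 2 := by positivity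
    linarith
  have hsum : Summable fun k : ℤ => |(k : ℝ)| ^ (-((n : ℝ) / 2 + 1)) :=
    Real.summable_abs_int_rpow hb
  refine ⟨C * ∑' k : ℤ, |(k : ℝ)| ^ (-((n : ℝ) / 2 + 1)),
    mul_nonneg hC0 (tsum_nonneg fun k => by positivity), fun ρ hρ X hX => ?_⟩
  set f : ℝ → ℂ := fun t => (profile n ρ t : ℂ) with hf
  have hfc : Continuous f := Complex.continuous_ofReal.comp (continuous_profile hn ρ)
  have hF : ∀ k : ℤ, k ≠ 0 → ‖𝓕 f k‖ ≤ C * ρ ^ ((n : ℝ) / 2) *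
      |(k : ℝ)| ^ (-((n : ℝ) / 2 + 1)) := fun k hk => hC ρ hρ k (by exact_mod_cast hk)
  have hbig : (𝓕 f) =O[Filter.cocompact ℝ] (|·| ^ (-((n : ℝ) / 2 + 1))) := by
    refine Asymptotics.IsBigO.of_bound (C * ρ ^ ((n : ℝ) / 2)) ?_
    have h0 : ({0} : Set ℝ)ᶜ ∈ Filter.cocompact ℝ := isCompact_singleton.compl_mem_cocompact
    filter_upwards [h0] with w hw
    rw [Real.norm_eq_abs, abs_of_nonneg (Real.rpow_nonneg (abs_nonneg w) _)]
    exact hC ρ hρ w hw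
  have hfO : f =O[Filter.cocompact ℝ] (|·| ^ (-((n : ℝ) / 2 + 1))) := by
    refine Asymptotics.IsBigO.of_bound 1 ?_
    have h0 : (Set.Icc (-ρ) ρ)ᶜ ∈ Filter.cocompact ℝ := isCompact_Icc.compl_mem_cocompact
    filter_upwards [h0] with w hw
    have : ρ ≤ |w| := by
      by_contra h
      exact hw ⟨by linarith [neg_abs_le w], by linarith [le_abs_self w]⟩
    simp [hf, profile_eq_zero hρ.le this]
  have hP := Real.tsum_eq_tsum_fourier_of_rpow_decay hfc hb hfO hbig 0
  simp only [zero_add, QuotientAddGroup.mk_zero, fourier_eval_zero, mul_one] at hP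
  have hL : ∑' k : ℤ, f k = ((∑ m ∈ Finset.Icc (-X : ℤ) X, profile n ρ m : ℝ) : ℂ) := by
    rw [tsum_eq_sum (s := Finset.Icc (-X : ℤ) X), Complex.ofReal_sum]
    intro k hk
    simp only [hf]
    rw [profile_eq_zero hρ.le, Complex.ofReal_zero]
    refine hX.trans ?_
    have : (X : ℤ) ≤ |k| := by
      by_contra h
      rw [not_le, abs_lt] at h
      exact hk (Finset.mem_Icc.2 ⟨by omega, by omega⟩)
    exact_mod_cast this
  have h0 : 𝓕 f 0 = ((∫ t, profile n ρ t : ℝ) : ℂ) := by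
    rw [Real.fourier_real_eq_integral_exp_smul, ← integral_complex_ofReal]
    simp [hf]
  have hS : Summable fun k : ℤ => 𝓕 f k :=
    summable_of_isBigO (Real.summable_abs_int_rpow hb)
      (hbig.comp_tendsto Int.tendsto_coe_cofinite)
  have hd : HasSum (fun k : ℤ => 𝓕 f k - if k = 0 then 𝓕 f 0 else 0)
      (∑' k : ℤ, 𝓕 f k - 𝓕 f 0) := hS.hasSum.sub (hasSum_ite_eq 0 _)
  have hbound := hd.norm_le_of_bounded ((hsum.mul_left (C * ρ ^ ((n : ℝ) / 2))).hasSum) (by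
    intro k
    by_cases hk : k = 0
    · subst hk
      simp
      positivity
    · rw [if_neg hk, sub_zero]
      exact hF k hk)
  rw [← hP, hL, h0, ← Complex.ofReal_sub, Complex.norm_real, Real.norm_eq_abs, tsum_mul_left]
    at hbound
  linarith

/-- For `n = 0` the profile is a discontinuous indicator and its transform decays only like `1 /
|k|`, so the integers are counted directly: `2 ⌈ρ⌉ - 1` of them in an interval of length `2 ρ`. -/
theorem abs_sum_profile_zero_sub_le {ρ : ℝ} (hρ : 0 < ρ) {X : ℕ} (hX : ρ ≤ X) :
    |∑ m ∈ Finset.Icc (-X : ℤ) X, profile 0 ρ m - ∫ t, profile 0 ρ t| ≤ 1 := by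
  have hp : profile 0 ρ = (Set.Ioo (-ρ) ρ).indicator fun _ => (1 : ℝ) := by
    ext t
    have : t ^ 2 < ρ ^ 2 ↔ t ∈ Set.Ioo (-ρ) ρ := by
      rw [sq_lt_sq, abs_of_pos hρ, abs_lt]
      rfl
    simp [profile, Set.indicator_apply, this]
  have hI : ∫ t, profile 0 ρ t = 2 * ρ := by
    rw [hp, integral_indicator measurableSet_Ioo]
    simp [hρ.le]
    ring
  have hS : ∑ m ∈ Finset.Icc (-X : ℤ) X, profile 0 ρ m = 2 * (⌈ρ⌉ : ℝ) - 1 := by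
    have h1 : ∀ m : ℤ, profile 0 ρ m = if m ∈ Finset.Icc (-(⌈ρ⌉ - 1)) (⌈ρ⌉ - 1) then 1 else 0 := by
      intro m
      have : (m : ℝ) ∈ Set.Ioo (-ρ) ρ ↔ m ∈ Finset.Icc (-(⌈ρ⌉ - 1)) (⌈ρ⌉ - 1) := by
        rw [Finset.mem_Icc, Set.mem_Ioo, Int.le_sub_one_iff, Int.lt_ceil, neg_le,
          Int.le_sub_one_iff, Int.lt_ceil, neg_lt]
        push_cast
        rfl
      rw [hp, Set.indicator_apply]
      simp only [this]
    simp_rw [h1]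
    have hc : ⌈ρ⌉ ≤ X := Int.ceil_le.2 (by exact_mod_cast hX)
    have hc0 : 0 < ⌈ρ⌉ := Int.ceil_pos.2 hρ
    rw [Finset.sum_ite_mem, Finset.inter_eq_right.2 (Finset.Icc_subset_Icc (by omega) (by omega)),
      Finset.sum_const, Int.card_Icc, nsmul_one]
    have : (((⌈ρ⌉ - 1 + 1 - -(⌈ρ⌉ - 1)).toNat : ℤ) : ℝ) = 2 * (⌈ρ⌉ : ℝ) - 1 := by
      rw [Int.toNat_of_nonneg (by omega)]
      push_cast
      ring
    exact_mod_cast this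
  rw [hI, hS, abs_le]
  have h1 := Int.le_ceil ρ
  have h2 := Int.ceil_lt_add_one ρ
  constructor <;> linarith

theorem exists_abs_sum_profile_sub_le (n : ℕ) :
    ∃ C, 0 ≤ C ∧ ∀ ρ : ℝ, 0 < ρ → ∀ X : ℕ, ρ ≤ X →
      |∑ m ∈ Finset.Icc (-X : ℤ) X, profile n ρ m - ∫ t, profile n ρ t| ≤
        C * ρ ^ ((n : ℝ) / 2) := by
  rcases eq_or_ne n 0 with rfl | hn
  · refine ⟨1, zero_le_one, fun ρ hρ X hX => ?_⟩
    simpa using abs_sum_profile_zero_sub_le hρ hX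
  · exact exists_abs_sum_profile_sub_le_of_ne_zero hn

/-- The volume of an ellipsoid in dimension `n + 1` is well approximated by the sum of the volumes
of its integral slices. -/
theorem exists_abs_sum_volume_slices_sub_le {n : ℕ} (W : Matrix (Fin n) (Fin n) ℝ) {a : ℝ}
    (ha : 0 < a) :
    ∃ C, 0 ≤ C ∧ ∀ T : ℝ, 0 < T → ∀ X : ℕ, T ^ 2 ≤ a * X ^ 2 →
      |∑ m ∈ Finset.Icc (-X : ℤ) X, volume.real (ell W (T ^ 2 - a * (m : ℝ) ^ 2)) -
        ∫ t : ℝ, volume.real (ell W (T ^ 2 - a * t ^ 2))| ≤ C * T ^ ((n : ℝ) / 2) := by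
  obtain ⟨C, hC0, hC⟩ := exists_abs_sum_profile_sub_le n
  have hv := ellVol_nonneg W
  have hs : 0 < √a := Real.sqrt_pos.2 ha
  refine ⟨a ^ ((n : ℝ) / 2) * ellVol W * (C * (√a)⁻¹ ^ ((n : ℝ) / 2)), by positivity,
    fun T hT X hX => ?_⟩
  set ρ : ℝ := (√a)⁻¹ * T with hρ
  have hρ0 : 0 < ρ := by positivity
  have hρ2 : a * ρ ^ 2 = T ^ 2 := by
    rw [hρ, mul_pow, inv_pow, Real.sq_sqrt ha.le, mul_inv_cancel_left₀ ha.ne']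
  have hρX : ρ ≤ X := by
    rw [← hρ2] at hX
    exact le_of_sq_le_sq (le_of_mul_le_mul_left hX ha) (by positivity)
  have h1 : ∀ t : ℝ, volume.real (ell W (T ^ 2 - a * t ^ 2)) =
      a ^ ((n : ℝ) / 2) * ellVol W * profile n ρ t := fun t => by
    rw [← hρ2, volume_real_ell_sub W ha]
  simp_rw [h1]
  rw [← Finset.mul_sum, integral_const_mul, ← mul_sub, abs_mul, abs_of_nonneg (by positivity)]
  refine (mul_le_mul_of_nonneg_left (hC ρ hρ0 X hρX) (by positivity)).trans (le_of_eq ?_)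
  rw [hρ, Real.mul_rpow (by positivity) hT.le]
  ring

theorem volume_real_ell_eq_integral {n : ℕ} {a : ℝ} {c : Fin n → ℝ}
    {W' : Matrix (Fin n) (Fin n) ℝ} {W : Matrix (Fin (n + 1)) (Fin (n + 1)) ℝ} (hW : W.det ≠ 0)
    (h : ∀ v, qf W v = a * v 0 ^ 2 + qf W' (fun i => v i.succ + v 0 * c i)) (s : ℝ) :
    volume.real (ell W s) = ∫ t : ℝ, volume.real (ell W' (s - a * t ^ 2)) := by
  have h1 := setIntegral_slice (a := a) (c := c) (W := W') (s := s) (E := ell W s)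
    (fun v => by rw [← h]; rfl) (volume_ell_lt_top hW s).ne (φ := fun _ => 1) continuous_const
    (by simp)
  simp only [one_mul, integral_const, Complex.real_smul, mul_one] at h1
  rw [integral_complex_ofReal] at h1
  have h2 := Complex.ofReal_injective h1
  simpa [Measure.real] using h2

/-! ### Periodic functions and Fourier series on the unit cube -/

/-- The half-open unit cube. -/
def cube (n : ℕ) : Set (Fin n → ℝ) := {x | ∀ i, x i ∈ Set.Ioc (0 : ℝ) 1}

/-- The real vector with the given integral coordinates. -/
def intVec {n : ℕ} (k : Fin n → ℤ) : Fin n → ℝ := fun i => k i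

/-- Periodicity with respect to the integral lattice. -/
def IntPeriodic {n : ℕ} {E : Type*} (f : (Fin n → ℝ) → E) : Prop :=
  ∀ x k, f (x + intVec k) = f x

theorem measurableSet_cube (n : ℕ) : MeasurableSet (cube n) :=
  MeasurableSet.univ_pi' fun _ => measurableSet_Ioc

theorem volume_cube (n : ℕ) : volume (cube n) = 1 := by
  have : cube n = Set.pi Set.univ fun _ => Set.Ioc (0 : ℝ) 1 := by
    ext x
    simp [cube]
  rw [this, volume_pi_pi]
  simp

instance (n : ℕ) : IsFiniteMeasure (volume.restrict (cube n)) :=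
  ⟨by simp [volume_cube]⟩

section Torus

/-- The unit circle carries the Haar probability measure. -/
noncomputable local instance : MeasureSpace UnitAddCircle := ⟨AddCircle.haarAddCircle⟩

local instance : Measure.IsAddHaarMeasure (volume : Measure UnitAddCircle) :=
  inferInstanceAs (Measure.IsAddHaarMeasure AddCircle.haarAddCircle)

local instance : IsProbabilityMeasure (volume : Measure UnitAddCircle) :=
  inferInstanceAs (IsProbabilityMeasure AddCircle.haarAddCircle)

/-- Passing to the torus makes available the invariance of its Haar measure and its Parseval
identity; `g` evaluates `f` at the representative in the half-open cube. -/
theorem IntPeriodic.exists_lift {n : ℕ} {E : Type*} [MeasurableSpace E] {f : (Fin n → ℝ) → E}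
    (hf : IntPeriodic f) (hm : Measurable f) :
    ∃ g : UnitAddTorus (Fin n) → E, Measurable g ∧ ∀ x : Fin n → ℝ, g (fun i => x i) = f x := by
  refine ⟨fun t => f (UnitAddTorus.measurableEquivPiIoc 0 t).1,
    hm.comp (measurable_subtype_coe.comp (UnitAddTorus.measurableEquivPiIoc 0).measurable),
    fun x => ?_⟩
  change f (UnitAddTorus.measurableEquivPiIoc 0 fun i => (x i : UnitAddCircle)).1 = f x
  set y : Fin n → ℝ := (UnitAddTorus.measurableEquivPiIoc 0 fun i => (x i : UnitAddCircle)).1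
    with hy
  have h : ∀ i : Fin n, ∃ k : ℤ, y i = x i + k := by
    intro i
    have h1 : (y i : UnitAddCircle) = (x i : UnitAddCircle) := by
      rw [hy, UnitAddTorus.coe_measurableEquivPiIoc_apply]
      exact (AddCircle.equivIoc (1 : ℝ) ((0 : Fin n → ℝ) i)).left_inv (x i : UnitAddCircle)
    have h2 : ((y i - x i : ℝ) : UnitAddCircle) = 0 := by
      rw [AddCircle.coe_sub, h1, sub_self]
    obtain ⟨k, hk⟩ := (AddCircle.coe_eq_zero_iff 1).1 h2
    refine ⟨k, ?_⟩
    rw [zsmul_one] at hk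
    linarith
  choose k hk using h
  have : y = x + intVec k := by
    ext i
    exact hk i
  rw [this, hf]

theorem setIntegral_cube_eq {n : ℕ} (g : UnitAddTorus (Fin n) → ℂ) :
    ∫ x in cube n, g (fun i => (x i : UnitAddCircle)) = ∫ t, g t := by
  rw [UnitAddTorus.integral_preimage g 0]
  simp [cube]

theorem IntPeriodic.setIntegral_comp_add {n : ℕ} {f : (Fin n → ℝ) → ℂ}
    (hf : IntPeriodic f) (hm : Measurable f) (s : Fin n → ℝ) :
    ∫ x in cube n, f (x + s) = ∫ x in cube n, f x := by
  obtain ⟨g, -, hg⟩ := hf.exists_lift hm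
  simp_rw [← hg]
  rw [setIntegral_cube_eq g]
  have h := setIntegral_cube_eq fun t => g (t + fun i => (s i : UnitAddCircle))
  rw [integral_add_right_eq_self g] at h
  rw [← h]
  rfl

/-- Multiplication by a nonzero integer preserves the Haar measure of the torus. -/
theorem IntPeriodic.setIntegral_comp_smul {n : ℕ} {f : (Fin n → ℝ) → ℂ}
    (hf : IntPeriodic f) (hm : Measurable f) {m : ℤ} (hm0 : m ≠ 0) :
    ∫ x in cube n, f ((m : ℝ) • x) = ∫ x in cube n, f x := by
  obtain ⟨g, hgm, hg⟩ := hf.exists_lift hm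
  simp_rw [← hg]
  rw [setIntegral_cube_eq g]
  have h := setIntegral_cube_eq fun t => g (m • t)
  have hp : MeasurePreserving (fun t : UnitAddTorus (Fin n) => m • t) volume volume :=
    Measure.measurePreserving_zsmul volume hm0
  have h2 := integral_map (μ := volume) hp.measurable.aemeasurable
    (f := g) hgm.aestronglyMeasurable
  rw [hp.map_eq] at h2
  rw [h2, ← h]
  congr 1
  ext x
  congr 1
  ext i
  simp

theorem mFourier_neg_coe {n : ℕ} (ξ : Fin n → ℤ) (x : Fin n → ℝ) :
    UnitAddTorus.mFourier (-ξ) (fun i => (x i : UnitAddCircle)) = echar (intVec ξ) x := by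
  simp only [UnitAddTorus.mFourier, ContinuousMap.coe_mk, fourier_coe_apply, echar]
  rw [← Complex.exp_sum]
  congr 1
  simp only [dotProduct, intVec, Pi.neg_apply]
  push_cast
  rw [Finset.mul_sum, ← Finset.sum_neg_distrib, Finset.sum_mul]
  refine Finset.sum_congr rfl fun i _ => ?_
  ring

/-- Parseval's identity on the unit cube. -/
theorem hasSum_sq_setIntegral_echar {n : ℕ} {f : (Fin n → ℝ) → ℂ} (hf : IntPeriodic f)
    (hm : Measurable f) {C : ℝ} (hC : ∀ x, ‖f x‖ ≤ C) :
    HasSum (fun ξ : Fin n → ℤ => ‖∫ x in cube n, echar (intVec ξ) x * f x‖ ^ 2)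
      (∫ x in cube n, ‖f x‖ ^ 2) := by
  obtain ⟨g, hgm, hg⟩ := hf.exists_lift hm
  have hgC : ∀ t, ‖g t‖ ≤ C := by
    intro t
    choose x hx using fun i => QuotientAddGroup.mk_surjective (t i)
    have : t = fun i => (x i : UnitAddCircle) := by
      ext i
      exact (hx i).symm
    rw [this, hg]
    exact hC x
  have hL : MemLp g 2 volume := MemLp.of_bound hgm.aestronglyMeasurable C (ae_of_all _ hgC)
  have hP := UnitAddTorus.hasSum_sq_mFourierCoeff (hL.toLp g)
  have h1 : ∀ ξ, UnitAddTorus.mFourierCoeff (hL.toLp g) ξ =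
      ∫ x in cube n, echar (intVec ξ) x * f x := by
    intro ξ
    have h2 : UnitAddTorus.mFourierCoeff (hL.toLp g) ξ = UnitAddTorus.mFourierCoeff g ξ := by
      refine integral_congr_ae ?_
      filter_upwards [hL.coeFn_toLp] with t ht
      rw [ht]
    rw [h2, UnitAddTorus.mFourierCoeff_eq_integral g ξ 0]
    simp_rw [mFourier_neg_coe, hg, smul_eq_mul]
    simp [cube]
  have h3 : ∫ t, ‖(hL.toLp g) t‖ ^ 2 = ∫ x in cube n, ‖f x‖ ^ 2 := by
    have h4 : ∫ t, ‖(hL.toLp g) t‖ ^ 2 = ∫ t, ‖g t‖ ^ 2 := by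
      refine integral_congr_ae ?_
      filter_upwards [hL.coeFn_toLp] with t ht
      rw [ht]
    rw [h4, UnitAddTorus.integral_preimage (fun t => ‖g t‖ ^ 2) 0]
    simp_rw [hg]
    simp [cube]
  simp_rw [h1] at hP
  rwa [h3] at hP

end Torus

/-! ### Counting lattice points in translates -/

/-- The number of points of `E` in the translate `z + ℤⁿ` of the integral lattice. -/
noncomputable def latticeCount {n : ℕ} (E : Set (Fin n → ℝ)) (z : Fin n → ℝ) : ℝ :=
  Set.ncard {k : Fin n → ℤ | z + intVec k ∈ E}

theorem intVec_add {n : ℕ} (k l : Fin n → ℤ) : intVec (k + l) = intVec k + intVec l := by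
  ext i
  simp [intVec]

/-- A countable sum of indicators makes measurability of counts automatic. For infinite sets both
sides take the default value 0. -/
theorem ncard_eq_toReal_tsum {ι : Type*} (s : Set ι) :
    (s.ncard : ℝ) = (∑' i, s.indicator (fun _ => (1 : ENNReal)) i).toReal := by
  rw [← tsum_subtype, ENNReal.tsum_set_one, Set.ncard]
  rcases eq_or_ne s.encard ⊤ with h | h
  · simp [h]
  · obtain ⟨m, hm⟩ := ENat.ne_top_iff_exists.1 h
    simp [← hm]

theorem measurable_ncard {α ι : Type*} [MeasurableSpace α] [Countable ι] {p : ι → α → Prop}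
    (hp : ∀ i, MeasurableSet {x | p i x}) :
    Measurable fun x => (Set.ncard {i | p i x} : ℝ) := by
  simp_rw [ncard_eq_toReal_tsum]
  refine (Measurable.tsum fun i => ?_).ennreal_toReal
  have : (fun x => Set.indicator {i | p i x} (fun _ => (1 : ENNReal)) i) =
      Set.indicator {x | p i x} fun _ => 1 := by
    funext x
    by_cases h : p i x
    · rw [Set.indicator_of_mem (show i ∈ {i | p i x} from h),
        Set.indicator_of_mem (show x ∈ {x | p i x} from h)]
    · rw [Set.indicator_of_notMem (show i ∉ {i | p i x} from h),
        Set.indicator_of_notMem (show x ∉ {x | p i x} from h)]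
  rw [this]
  exact measurable_const.indicator (hp i)

theorem measurable_latticeCount {n : ℕ} {E : Set (Fin n → ℝ)} (hE : MeasurableSet E) :
    Measurable (latticeCount E) :=
  measurable_ncard fun k => (measurable_add_const (intVec k)) hE

theorem latticeCount_nonneg {n : ℕ} (E : Set (Fin n → ℝ)) (z : Fin n → ℝ) :
    0 ≤ latticeCount E z := Nat.cast_nonneg _

theorem intPeriodic_latticeCount {n : ℕ} (E : Set (Fin n → ℝ)) :
    IntPeriodic (latticeCount E) := by
  intro z l
  unfold latticeCount
  congr 1
  refine Set.ncard_congr (fun k _ => l + k) ?_ ?_ ?_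
  · intro k hk
    simpa [intVec_add, add_assoc] using hk
  · intro k k' _ _ h
    simpa using h
  · intro k hk
    refine ⟨k - l, ?_, by simp⟩
    have : z + intVec l + intVec (k - l) = z + intVec k := by
      rw [add_assoc, ← intVec_add, add_sub_cancel]
    simpa [this] using hk

/-- The integral vectors with coordinates bounded by `N`. -/
noncomputable def intBox (n N : ℕ) : Finset (Fin n → ℤ) :=
  Fintype.piFinset fun _ => Finset.Icc (-N : ℤ) N

/-- The integral translates of the unit cube. -/
def cell {n : ℕ} (k : Fin n → ℤ) : Set (Fin n → ℝ) := {y | ∀ i, ⌈y i⌉ - 1 = k i}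

theorem measurableSet_cell {n : ℕ} (k : Fin n → ℤ) : MeasurableSet (cell k) := by
  have : cell k = ⋂ i, {y : Fin n → ℝ | ⌈y i⌉ = k i + 1} := by
    ext y
    simp [cell, sub_eq_iff_eq_add]
  rw [this]
  exact MeasurableSet.iInter fun i =>
    ((measurable_pi_apply i).ceil) (measurableSet_singleton (k i + 1))

theorem add_intVec_mem_cell {n : ℕ} (z : Fin n → ℝ) (k : Fin n → ℤ) :
    z + intVec k ∈ cell k ↔ z ∈ cube n := by
  have h : ∀ i, ⌈(z + intVec k) i⌉ - 1 = k i ↔ z i ∈ Set.Ioc (0 : ℝ) 1 := by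
    intro i
    have h1 : (z + intVec k) i = z i + (k i : ℝ) := rfl
    rw [h1, Int.ceil_add_intCast, Set.mem_Ioc]
    have h2 : ⌈z i⌉ + k i - 1 = k i ↔ ⌈z i⌉ = 1 := by omega
    rw [h2, Int.ceil_eq_iff]
    simp
  exact forall_congr' h

theorem mem_intBox_of_mem {n N : ℕ} {k : Fin n → ℤ} {y : Fin n → ℝ} (hk : y ∈ cell k)
    (hy : ∀ i, |y i| < N) : k ∈ intBox n N := by
  rw [intBox, Fintype.mem_piFinset]
  intro i
  have h1 := hk i
  have h2 := abs_lt.1 (hy i)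
  have h3 : ⌈y i⌉ ≤ N := Int.ceil_le.2 (by exact_mod_cast h2.2.le)
  have h4 : (-N : ℤ) < ⌈y i⌉ := Int.lt_ceil.2 (by push_cast; exact h2.1)
  rw [Finset.mem_Icc]
  omega

theorem setOf_add_intVec_mem_subset {n N : ℕ} {E : Set (Fin n → ℝ)}
    (hE : ∀ y ∈ E, ∀ i, |y i| < N) {z : Fin n → ℝ} (hz : z ∈ cube n) :
    {k : Fin n → ℤ | z + intVec k ∈ E} ⊆ intBox n N := fun k hk =>
  mem_intBox_of_mem ((add_intVec_mem_cell z k).2 hz) (hE _ hk)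

theorem latticeCount_eq_sum {n N : ℕ} {E : Set (Fin n → ℝ)}
    (hE : ∀ y ∈ E, ∀ i, |y i| < N) {z : Fin n → ℝ} (hz : z ∈ cube n) :
    latticeCount E z = ∑ k ∈ intBox n N, E.indicator (fun _ => (1 : ℝ)) (z + intVec k) := by
  classical
  have h : {k : Fin n → ℤ | z + intVec k ∈ E} =
      ((intBox n N).filter fun k => z + intVec k ∈ E : Finset (Fin n → ℤ)) := by
    ext k
    simp only [Set.mem_ofPred_eq, Finset.coe_filter]
    exact ⟨fun h => ⟨setOf_add_intVec_mem_subset hE hz h, h⟩, fun h => h.2⟩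
  rw [latticeCount, h, Set.ncard_coe_finset, Finset.card_filter]
  push_cast
  exact Finset.sum_congr rfl fun k _ => by simp [Set.indicator_apply]

theorem IntPeriodic.exists_mem_cube {n : ℕ} {E : Type*} {f : (Fin n → ℝ) → E}
    (hf : IntPeriodic f) (x : Fin n → ℝ) : ∃ z ∈ cube n, f z = f x := by
  refine ⟨x + intVec (fun i => 1 - ⌈x i⌉), fun i => ?_, hf _ _⟩
  have h1 : (x + intVec (fun i => 1 - ⌈x i⌉)) i = x i + (1 - (⌈x i⌉ : ℝ)) := by
    simp [intVec]
  rw [h1, Set.mem_Ioc]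
  have h2 := Int.le_ceil (x i)
  have h3 := Int.ceil_lt_add_one (x i)
  constructor <;> linarith

theorem latticeCount_le {n N : ℕ} {E : Set (Fin n → ℝ)}
    (hE : ∀ y ∈ E, ∀ i, |y i| < N) (z : Fin n → ℝ) :
    latticeCount E z ≤ (intBox n N).card := by
  obtain ⟨w, hw, h⟩ := (intPeriodic_latticeCount E).exists_mem_cube z
  rw [← h, latticeCount_eq_sum hE hw, Finset.card_eq_sum_ones]
  push_cast
  refine Finset.sum_le_sum fun k _ => ?_
  exact Set.indicator_le_self' (fun _ _ => zero_le_one) _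

theorem echar_add {n : ℕ} (ξ x y : Fin n → ℝ) : echar ξ (x + y) = echar ξ x * echar ξ y := by
  rw [echar, echar, echar, ← Complex.exp_add]
  congr 1
  rw [dotProduct_add]
  push_cast
  ring

theorem echar_intVec {n : ℕ} (ξ k : Fin n → ℤ) : echar (intVec ξ) (intVec k) = 1 := by
  rw [echar, Complex.exp_eq_one_iff]
  refine ⟨-dotProduct ξ k, ?_⟩
  simp only [dotProduct, intVec]
  push_cast
  ring

theorem echar_zero {n : ℕ} (x : Fin n → ℝ) : echar 0 x = 1 := by
  simp [echar]

theorem intPeriodic_echar {n : ℕ} (ξ : Fin n → ℤ) : IntPeriodic (echar (intVec ξ)) := by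
  intro x k
  rw [echar_add, echar_intVec, mul_one]

theorem IntPeriodic.mul {n : ℕ} {f g : (Fin n → ℝ) → ℂ} (hf : IntPeriodic f)
    (hg : IntPeriodic g) : IntPeriodic fun x => f x * g x := fun x k => by
  simp only
  rw [hf, hg]

theorem IntPeriodic.comp {n : ℕ} {E F : Type*} {f : (Fin n → ℝ) → E} (hf : IntPeriodic f)
    (g : E → F) : IntPeriodic fun x => g (f x) := fun x k => by
  simp only
  rw [hf]

theorem IntPeriodic.comp_smul {n : ℕ} {E : Type*} {f : (Fin n → ℝ) → E} (hf : IntPeriodic f)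
    (m : ℤ) : IntPeriodic fun x => f ((m : ℝ) • x) := fun x k => by
  have : (m : ℝ) • (x + intVec k) = (m : ℝ) • x + intVec (m • k) := by
    ext i
    simp [intVec, mul_add]
  simp only [this, hf _ _]

/-- Unfolding: the Fourier coefficients of the counting function of `E` are the values of the
Fourier transform of `E`. -/
theorem setIntegral_echar_mul_latticeCount {n N : ℕ} {E : Set (Fin n → ℝ)} (hEm : MeasurableSet E)
    (hE : ∀ y ∈ E, ∀ i, |y i| < N) (ξ : Fin n → ℤ) :
    ∫ z in cube n, echar (intVec ξ) z * (latticeCount E z : ℂ) =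
      ∫ y in E, echar (intVec ξ) y := by
  have hvol : volume E < ⊤ := by
    refine lt_of_le_of_lt (measure_mono (t := Set.Icc (fun _ => -(N : ℝ)) fun _ => (N : ℝ))
      fun y hy => ?_) isCompact_Icc.measure_lt_top
    exact ⟨fun i => (abs_lt.1 (hE y hy i)).1.le, fun i => (abs_lt.1 (hE y hy i)).2.le⟩
  have hi : IntegrableOn (echar (intVec ξ)) E :=
    ⟨(continuous_echar _).aestronglyMeasurable, HasFiniteIntegral.restrict_of_bounded (C := 1) hvol
      (ae_of_all _ fun y => (norm_echar _ _).le)⟩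
  have hEU : E = ⋃ k ∈ intBox n N, E ∩ cell k := by
    ext y
    simp only [Set.mem_iUnion, Set.mem_inter_iff, exists_prop]
    constructor
    · intro hy
      have h1 : y ∈ cell fun i => ⌈y i⌉ - 1 := fun i => rfl
      exact ⟨_, mem_intBox_of_mem h1 (hE y hy), hy, h1⟩
    · rintro ⟨k, -, hy, -⟩
      exact hy
  have hmeas : ∀ k : Fin n → ℤ, MeasurableSet (E ∩ cell k) := fun k =>
    hEm.inter (measurableSet_cell k)
  -- Translating the cell of `k` back to the cube leaves the character unchanged, since `ξ` and `k`
  -- are integral.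
  have hterm : ∀ k : Fin n → ℤ, ∫ y in E ∩ cell k, echar (intVec ξ) y =
      ∫ z in cube n,
        echar (intVec ξ) z * ((E.indicator (fun _ => (1 : ℝ)) (z + intVec k) : ℝ) : ℂ) := by
    intro k
    rw [← integral_indicator (hmeas k), ← integral_add_right_eq_self _ (intVec k),
      ← integral_indicator (measurableSet_cube n)]
    congr 1
    ext z
    by_cases hz : z ∈ cube n
    · rw [Set.indicator_of_mem hz]
      by_cases h : z + intVec k ∈ E
      · rw [Set.indicator_of_mem (s := E ∩ cell k) ⟨h, (add_intVec_mem_cell z k).2 hz⟩,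
          Set.indicator_of_mem h,
          echar_add, echar_intVec]
        simp
      · rw [Set.indicator_of_notMem fun hh => h hh.1, Set.indicator_of_notMem h]
        simp
    · rw [Set.indicator_of_notMem hz,
        Set.indicator_of_notMem fun hh => hz ((add_intVec_mem_cell z k).1 hh.2)]
  have hint : ∀ k ∈ intBox n N, Integrable (fun z => echar (intVec ξ) z *
      ((E.indicator (fun _ => (1 : ℝ)) (z + intVec k) : ℝ) : ℂ)) (volume.restrict (cube n)) := by
    intro k _
    refine Integrable.of_bound (C := 1) ?_ (ae_of_all _ fun z => ?_)
    · refine ((continuous_echar _).measurable.mul ?_).aestronglyMeasurable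
      exact Complex.measurable_ofReal.comp
        ((measurable_const.indicator hEm).comp (measurable_add_const _))
    · rw [norm_mul, norm_echar, one_mul, Complex.norm_real]
      by_cases h : z + intVec k ∈ E <;> simp [h]
  calc ∫ z in cube n, echar (intVec ξ) z * (latticeCount E z : ℂ)
      = ∫ z in cube n, ∑ k ∈ intBox n N, echar (intVec ξ) z *
        ((E.indicator (fun _ => (1 : ℝ)) (z + intVec k) : ℝ) : ℂ) := by
        refine setIntegral_congr_fun (measurableSet_cube n) fun z hz => ?_
        simp only [latticeCount_eq_sum hE hz, Complex.ofReal_sum, Finset.mul_sum]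
    _ = ∑ k ∈ intBox n N, ∫ y in E ∩ cell k, echar (intVec ξ) y := by
        rw [integral_finsetSum _ hint]
        exact Finset.sum_congr rfl fun k _ => (hterm k).symm
    _ = ∫ y in E, echar (intVec ξ) y := by
        conv_rhs => rw [hEU]
        rw [integral_biUnion_finset _ fun k _ => hmeas k]
        · intro k _ l _ hkl
          refine Set.disjoint_left.2 fun y hy hy' => hkl ?_
          ext i
          rw [← hy.2 i, ← hy'.2 i]
        · intro k _
          exact hi.mono_set Set.inter_subset_left

/-- Translation by `s` preserves the integral but multiplies it by `ω`. -/
theorem setIntegral_cube_eq_zero {n : ℕ} {f : (Fin n → ℝ) → ℂ} (hf : IntPeriodic f)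
    (hm : Measurable f) {s : Fin n → ℝ} {ω : ℂ} (hω : ω ≠ 1) (h : ∀ x, f (x + s) = ω * f x) :
    ∫ x in cube n, f x = 0 := by
  have h1 := hf.setIntegral_comp_add hm s
  simp_rw [h] at h1
  rw [integral_const_mul] at h1
  have h2 : (ω - 1) * ∫ x in cube n, f x = 0 := by linear_combination h1
  exact (mul_eq_zero.1 h2).resolve_left (sub_ne_zero.2 hω)

/-- The value is `exp (-2 π i ξ j / m)`, which is 1 only if `m` divides `ξ j`. -/
theorem echar_single_ne_one {n : ℕ} {ξ : Fin n → ℤ} {m : ℤ} (hm : m ≠ 0) {j : Fin n}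
    (hj : ¬ m ∣ ξ j) : echar (intVec ξ) (Pi.single j (m : ℝ)⁻¹) ≠ 1 := by
  rw [echar, Ne, Complex.exp_eq_one_iff]
  rintro ⟨q, hq⟩
  rw [dotProduct_single] at hq
  have h1 : ((-(2 * Real.pi * (intVec ξ j * (m : ℝ)⁻¹)) : ℝ) : ℂ) * Complex.I =
      ((q * (2 * Real.pi) : ℝ) : ℂ) * Complex.I := by
    push_cast at hq ⊢
    rw [hq]
    ring
  have h2 := Complex.ofReal_injective (mul_right_cancel₀ Complex.I_ne_zero h1)
  have hm' : (m : ℝ) ≠ 0 := by exact_mod_cast hm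
  have h3 : (ξ j : ℝ) = m * (-q) := by
    have hpi := Real.pi_pos.ne'
    simp only [intVec] at h2
    field_simp at h2
    linarith
  exact hj ⟨-q, by exact_mod_cast h3⟩

theorem setIntegral_echar_cube {n : ℕ} {ξ : Fin n → ℤ} (hξ : ξ ≠ 0) :
    ∫ x in cube n, echar (intVec ξ) x = 0 := by
  obtain ⟨j, hj⟩ := Function.ne_iff.1 hξ
  have hj' : ξ j ≠ 0 := hj
  -- The translation by `1 / (2 ξ j)` multiplies the character by `-1`; it is obtained from the
  -- general criterion with modulus `2 ξ j`.
  have h2 : ¬ (2 * ξ j) ∣ ξ j := by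
    rintro ⟨q, hq⟩
    have : ξ j * (2 * q - 1) = 0 := by linear_combination -hq
    rcases mul_eq_zero.1 this with h | h
    · exact hj' h
    · omega
  refine setIntegral_cube_eq_zero (s := Pi.single j ((2 * ξ j : ℤ) : ℝ)⁻¹)
    (intPeriodic_echar ξ) (continuous_echar _).measurable
    (echar_single_ne_one (mul_ne_zero two_ne_zero hj') h2) fun x => ?_
  rw [echar_add, mul_comm]

/-- A periodic function of `m z` does not change when `z` moves by `1 / m` along an axis, so only
frequencies divisible by `m` survive. -/
theorem setIntegral_echar_mul_latticeCount_smul_eq_zero {n : ℕ} {E : Set (Fin n → ℝ)}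
    (hEm : MeasurableSet E) {ξ : Fin n → ℤ} {m : ℤ} (hm : m ≠ 0) {j : Fin n} (hj : ¬ m ∣ ξ j) :
    ∫ z in cube n, echar (intVec ξ) z * (latticeCount E ((m : ℝ) • z) : ℂ) = 0 := by
  have hper : IntPeriodic fun z => (latticeCount E ((m : ℝ) • z) : ℂ) :=
    ((intPeriodic_latticeCount E).comp_smul m).comp Complex.ofReal
  refine setIntegral_cube_eq_zero (s := Pi.single j (m : ℝ)⁻¹) ((intPeriodic_echar ξ).mul hper) ?_
    (echar_single_ne_one hm hj) fun x => ?_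
  · refine (continuous_echar _).measurable.mul (Complex.measurable_ofReal.comp ?_)
    exact (measurable_latticeCount hEm).comp (measurable_const_smul _)
  · have h1 : (m : ℝ) • (x + Pi.single j (m : ℝ)⁻¹) =
        (m : ℝ) • x + intVec (Pi.single j 1) := by
      have hm' : (m : ℝ) ≠ 0 := by exact_mod_cast hm
      ext i
      rcases eq_or_ne i j with rfl | hij
      · simp [intVec, mul_add, hm']
      · simp [intVec, hij]
    rw [h1, intPeriodic_latticeCount E, echar_add]
    ring

/-- At a surviving frequency `m • η` the whole integrand is a periodic function of `m z`; replacing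
`m z` by `z` leaves the coefficient at `η`, which unfolds. -/
theorem setIntegral_echar_mul_latticeCount_smul {n N : ℕ} {E : Set (Fin n → ℝ)}
    (hEm : MeasurableSet E) (hE : ∀ y ∈ E, ∀ i, |y i| < N) (η : Fin n → ℤ) {m : ℤ} (hm : m ≠ 0) :
    ∫ z in cube n, echar (intVec (m • η)) z * (latticeCount E ((m : ℝ) • z) : ℂ) =
      ∫ y in E, echar (intVec η) y := by
  rw [← setIntegral_echar_mul_latticeCount hEm hE]
  have hper : IntPeriodic fun z => echar (intVec η) z * (latticeCount E z : ℂ) :=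
    (intPeriodic_echar η).mul ((intPeriodic_latticeCount E).comp Complex.ofReal)
  rw [← hper.setIntegral_comp_smul ?_ hm]
  · congr 1
    ext z
    congr 1
    simp only [echar]
    congr 4
    simp [dotProduct, intVec]
    exact Finset.sum_congr rfl fun i _ => by ring
  · exact (continuous_echar _).measurable.mul
      (Complex.measurable_ofReal.comp (measurable_latticeCount hEm))

/-! ### Sums over divisors -/

theorem sum_inv_Icc_le (X : ℕ) :
    ∑ a ∈ Finset.Icc 1 X, ((a : ℝ))⁻¹ ≤ 1 + Real.log X := by
  have h := harmonic_le_one_add_log X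
  rw [harmonic_eq_sum_Icc] at h
  push_cast at h
  exact h

/-- With `a = g a'`, `b = g b'` and `g` the gcd, the term is `1 / (a' b')`. Letting `g, a', b'`
range freely up to `X` gives `X` times the square of a harmonic sum, the source of the squared
logarithm. -/
theorem sum_gcd_div_lcm_le (X : ℕ) :
    ∑ p ∈ Finset.Icc 1 X ×ˢ Finset.Icc 1 X, (Nat.gcd p.1 p.2 : ℝ) / (Nat.lcm p.1 p.2 : ℝ) ≤
      X * (1 + Real.log X) ^ 2 := by
  set P := Finset.Icc 1 X ×ˢ Finset.Icc 1 X with hP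
  let i : ℕ × ℕ → ℕ × ℕ × ℕ := fun p =>
    (Nat.gcd p.1 p.2, p.1 / Nat.gcd p.1 p.2, p.2 / Nat.gcd p.1 p.2)
  have hinj : Set.InjOn i P := by
    rintro ⟨a, b⟩ _ ⟨a', b'⟩ _ h
    simp only [i, Prod.mk.injEq] at h
    obtain ⟨h1, h2, h3⟩ := h
    have e1 := Nat.div_mul_cancel (Nat.gcd_dvd_left a b)
    have e2 := Nat.div_mul_cancel (Nat.gcd_dvd_right a b)
    rw [h2, h1, Nat.div_mul_cancel (Nat.gcd_dvd_left a' b')] at e1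
    rw [h3, h1, Nat.div_mul_cancel (Nat.gcd_dvd_right a' b')] at e2
    rw [e1, e2]
  have hterm : ∀ p ∈ P, (Nat.gcd p.1 p.2 : ℝ) / (Nat.lcm p.1 p.2 : ℝ) =
      ((i p).2.1 : ℝ)⁻¹ * ((i p).2.2 : ℝ)⁻¹ := by
    rintro ⟨a, b⟩ hp
    simp only [hP, Finset.mem_product, Finset.mem_Icc] at hp
    obtain ⟨⟨ha, -⟩, hb, -⟩ := hp
    have hg : 0 < Nat.gcd a b := Nat.gcd_pos_of_pos_left _ ha
    have e1 : ((a / Nat.gcd a b : ℕ) : ℝ) * Nat.gcd a b = a := by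
      exact_mod_cast Nat.div_mul_cancel (Nat.gcd_dvd_left a b)
    have e2 : ((b / Nat.gcd a b : ℕ) : ℝ) * Nat.gcd a b = b := by
      exact_mod_cast Nat.div_mul_cancel (Nat.gcd_dvd_right a b)
    have e3 : (Nat.gcd a b : ℝ) * Nat.lcm a b = a * b := by exact_mod_cast Nat.gcd_mul_lcm a b
    have hg' : (0 : ℝ) < Nat.gcd a b := by exact_mod_cast hg
    have ha' : (0 : ℝ) < a := by exact_mod_cast ha
    have hb' : (0 : ℝ) < b := by exact_mod_cast hb
    have hl' : (0 : ℝ) < Nat.lcm a b := by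
      exact_mod_cast Nat.lcm_pos ha hb
    simp only [i]
    rw [eq_div_of_mul_eq hg'.ne' e1, eq_div_of_mul_eq hg'.ne' e2]
    field_simp
    nlinarith
  rw [Finset.sum_congr rfl hterm,
    ← Finset.sum_image (f := fun q : ℕ × ℕ × ℕ => ((q.2.1 : ℝ))⁻¹ * ((q.2.2 : ℝ))⁻¹) hinj]
  have hsub : P.image i ⊆ Finset.Icc 1 X ×ˢ Finset.Icc 1 X ×ˢ Finset.Icc 1 X := by
    intro q hq
    obtain ⟨⟨a, b⟩, hp, rfl⟩ := Finset.mem_image.1 hq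
    simp only [hP, Finset.mem_product, Finset.mem_Icc] at hp
    obtain ⟨⟨ha, ha'⟩, hb, hb'⟩ := hp
    have hg : 0 < Nat.gcd a b := Nat.gcd_pos_of_pos_left _ ha
    simp only [i, Finset.mem_product, Finset.mem_Icc]
    refine ⟨⟨hg, (Nat.le_of_dvd ha (Nat.gcd_dvd_left a b)).trans ha'⟩,
      ⟨Nat.div_pos (Nat.le_of_dvd ha (Nat.gcd_dvd_left a b)) hg, (Nat.div_le_self _ _).trans ha'⟩,
      ⟨Nat.div_pos (Nat.le_of_dvd hb (Nat.gcd_dvd_right a b)) hg,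
        (Nat.div_le_self _ _).trans hb'⟩⟩
  refine (Finset.sum_le_sum_of_subset_of_nonneg hsub fun q _ _ => by positivity).trans ?_
  rw [Finset.sum_product]
  simp only
  rw [Finset.sum_const, Finset.sum_product, nsmul_eq_mul, Nat.card_Icc, Nat.add_sub_cancel]
  simp only
  rw [← Finset.sum_mul_sum, ← sq]
  have h0 : 0 ≤ ∑ a ∈ Finset.Icc 1 X, ((a : ℝ))⁻¹ := Finset.sum_nonneg fun _ _ => by positivity
  have := sum_inv_Icc_le X
  gcongr

/-- The nonzero integers of absolute value at most `X`. -/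
noncomputable def nonzeroIcc (X : ℕ) : Finset ℤ := (Finset.Icc (-X : ℤ) X).erase 0

theorem sum_nonzeroIcc_natAbs (X : ℕ) (h : ℕ → ℝ) :
    ∑ m ∈ nonzeroIcc X, h m.natAbs = 2 * ∑ k ∈ Finset.Icc 1 X, h k := by
  have hU : nonzeroIcc X = Finset.Icc (1 : ℤ) X ∪ Finset.Icc (-X : ℤ) (-1) := by
    ext m
    simp only [nonzeroIcc, Finset.mem_erase, Finset.mem_union, Finset.mem_Icc]
    omega
  have hd : Disjoint (Finset.Icc (1 : ℤ) X) (Finset.Icc (-X : ℤ) (-1)) := by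
    rw [Finset.disjoint_left]
    intro m
    simp only [Finset.mem_Icc]
    omega
  have h1 : ∑ m ∈ Finset.Icc (1 : ℤ) X, h m.natAbs = ∑ k ∈ Finset.Icc 1 X, h k := by
    refine Finset.sum_nbij' Int.natAbs (fun k => (k : ℤ)) ?_ ?_ ?_ ?_ ?_
    · intro m hm
      simp only [Finset.mem_Icc] at hm ⊢
      omega
    · intro m hm
      simp only [Finset.mem_Icc] at hm ⊢
      omega
    · intro m hm
      simp only [Finset.mem_Icc] at hm
      omega
    · intro m hm
      simp
    · intro m hm
      rfl
  have h2 : ∑ m ∈ Finset.Icc (-X : ℤ) (-1), h m.natAbs = ∑ k ∈ Finset.Icc 1 X, h k := by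
    refine Finset.sum_nbij' Int.natAbs (fun k => -(k : ℤ)) ?_ ?_ ?_ ?_ ?_
    · intro m hm
      simp only [Finset.mem_Icc] at hm ⊢
      omega
    · intro m hm
      simp only [Finset.mem_Icc] at hm ⊢
      omega
    · intro m hm
      simp only [Finset.mem_Icc] at hm
      omega
    · intro m hm
      simp
    · intro m hm
      rfl
  rw [hU, Finset.sum_union hd, h1, h2]
  ring

theorem sum_nonzeroIcc_gcd_div_lcm_le (X : ℕ) :
    ∑ m ∈ nonzeroIcc X, ∑ m' ∈ nonzeroIcc X, (Int.gcd m m' : ℝ) / (Int.lcm m m' : ℝ) ≤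
      4 * (X * (1 + Real.log X) ^ 2) := by
  have h1 : ∀ m : ℤ, ∑ m' ∈ nonzeroIcc X, (Int.gcd m m' : ℝ) / (Int.lcm m m' : ℝ) =
      2 * ∑ b ∈ Finset.Icc 1 X, (Nat.gcd m.natAbs b : ℝ) / (Nat.lcm m.natAbs b : ℝ) := fun m =>
    sum_nonzeroIcc_natAbs X fun b => (Nat.gcd m.natAbs b : ℝ) / (Nat.lcm m.natAbs b : ℝ)
  simp_rw [h1]
  rw [sum_nonzeroIcc_natAbs X fun a => 2 * ∑ b ∈ Finset.Icc 1 X,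
    (Nat.gcd a b : ℝ) / (Nat.lcm a b : ℝ), ← Finset.mul_sum]
  have h2 := sum_gcd_div_lcm_le X
  rw [Finset.sum_product] at h2
  linarith

/-! ### Sums over integral vectors with prescribed divisors -/

theorem norm_intVec_smul {n : ℕ} (l : ℤ) (ξ : Fin n → ℤ) :
    ‖intVec (l • ξ)‖ = |(l : ℝ)| * ‖intVec ξ‖ := by
  have : intVec (l • ξ) = (l : ℝ) • intVec ξ := by
    ext i
    simp [intVec]
  rw [this, norm_smul, Real.norm_eq_abs]

theorem intVec_injective (n : ℕ) : Function.Injective (intVec : (Fin n → ℤ) → Fin n → ℝ) := by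
  intro k l h
  ext i
  have := congrFun h i
  simpa [intVec] using this

/-- The exponent `n + 2` exceeds the rank `n + 1` of the lattice. The zero vector contributes `0⁻¹ =
0`. -/
theorem summable_norm_intVec_pow_inv (n : ℕ) :
    Summable fun ξ : Fin (n + 1) → ℤ => (‖intVec ξ‖ ^ (n + 2))⁻¹ := by
  let b := Pi.basisFun ℝ (Fin (n + 1))
  let L : Submodule ℤ (Fin (n + 1) → ℝ) := Submodule.span ℤ (Set.range b)
  have hr : Module.finrank ℤ L = n + 1 := by
    rw [ZLattice.rank ℝ L]
    simp
  have hs := ZLattice.summable_norm_pow_inv L (n + 2) (by omega)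
  have hmem : ∀ ξ : Fin (n + 1) → ℤ, intVec ξ ∈ L := by
    intro ξ
    rw [b.mem_span_iff_repr_mem ℤ]
    intro i
    exact ⟨ξ i, by simp [b, intVec]⟩
  have hinj : Function.Injective fun ξ : Fin (n + 1) → ℤ => (⟨intVec ξ, hmem ξ⟩ : L) := by
    intro k l h
    exact intVec_injective _ (congrArg Subtype.val h)
  simpa [Function.comp_def] using hs.comp_injective hinj

/-- The sum of `‖ξ‖ ^ (-(n + 2))` over the nonzero integral vectors. -/
noncomputable def latticeZeta (n : ℕ) : ℝ :=
  ∑' ξ : Fin (n + 1) → ℤ, (‖intVec ξ‖ ^ (n + 2))⁻¹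

theorem latticeZeta_nonneg (n : ℕ) : 0 ≤ latticeZeta n := tsum_nonneg fun _ => by positivity

-- Vectors divisible by both `m` and `m'` are the multiples of their lcm, and the summand is
-- homogeneous of degree `-(n + 2)`.
open scoped Classical in
theorem hasSum_norm_intVec_of_dvd (n : ℕ) {m m' : ℤ} (hm : m ≠ 0) (hm' : m' ≠ 0) :
    HasSum (fun ξ : Fin (n + 1) → ℤ => if (∀ i, m ∣ ξ i) ∧ (∀ i, m' ∣ ξ i) then
      (‖intVec ξ‖ ^ (n + 2))⁻¹ else 0) (((Int.lcm m m' : ℝ) ^ (n + 2))⁻¹ * latticeZeta n) := by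
  have hl : Int.lcm m m' ≠ 0 := Int.lcm_ne_zero hm hm'
  have hiff : ∀ ξ : Fin (n + 1) → ℤ, ((∀ i, m ∣ ξ i) ∧ (∀ i, m' ∣ ξ i)) ↔
      ξ ∈ Set.range fun η : Fin (n + 1) → ℤ => (Int.lcm m m' : ℤ) • η := by
    intro ξ
    constructor
    · rintro ⟨h1, h2⟩
      choose q hq using fun i => Int.coe_lcm_dvd (h1 i) (h2 i)
      exact ⟨q, funext fun i => (hq i).symm⟩
    · rintro ⟨η, rfl⟩
      exact ⟨fun i => (Int.dvd_lcm_left m m').mul_right _,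
        fun i => (Int.dvd_lcm_right m m').mul_right _⟩
  have hinj : Function.Injective fun η : Fin (n + 1) → ℤ => (Int.lcm m m' : ℤ) • η := by
    intro η η' h
    ext i
    have := congrFun h i
    simpa [hl] using this
  rw [← hinj.hasSum_iff]
  · have h := (summable_norm_intVec_pow_inv n).hasSum.mul_left (((Int.lcm m m' : ℝ) ^ (n + 2))⁻¹)
    refine h.congr_fun fun η => ?_
    simp only [Function.comp]
    rw [if_pos ((hiff _).2 ⟨η, rfl⟩), norm_intVec_smul, mul_pow, mul_inv]
    simp
  · intro ξ hξ
    rw [if_neg ((hiff ξ).not.2 hξ)]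

/-- Since `|m m'| = gcd * lcm`, the left side is `(gcd / lcm) ^ (n / 2 + 1)`, with base at most 1
and exponent at least 1. -/
theorem rpow_mul_lcm_inv_le (n : ℕ) {m m' : ℤ} (hm : m ≠ 0) (hm' : m' ≠ 0) :
    |(m : ℝ)| ^ ((n : ℝ) / 2 + 1) * |(m' : ℝ)| ^ ((n : ℝ) / 2 + 1) *
      ((Int.lcm m m' : ℝ) ^ (n + 2))⁻¹ ≤ (Int.gcd m m' : ℝ) / (Int.lcm m m' : ℝ) := by
  have hl : 0 < Int.lcm m m' := Nat.pos_of_ne_zero (Int.lcm_ne_zero hm hm')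
  have hg : 0 < Int.gcd m m' := Int.gcd_pos_of_ne_zero_left _ hm
  have hl' : (0 : ℝ) < Int.lcm m m' := by exact_mod_cast hl
  have hg' : (0 : ℝ) < Int.gcd m m' := by exact_mod_cast hg
  have h1 : |(m : ℝ)| * |(m' : ℝ)| = Int.gcd m m' * Int.lcm m m' := by
    have := Int.gcd_mul_lcm m m'
    have h2 : ((Int.gcd m m' * Int.lcm m m' : ℕ) : ℝ) = ((m * m').natAbs : ℝ) := by
      rw [this, Int.natAbs_mul]
    rw [Nat.cast_mul] at h2
    rw [h2, Nat.cast_natAbs, ← abs_mul]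
    push_cast
    rfl
  have hle : (Int.gcd m m' : ℝ) ≤ Int.lcm m m' := by
    exact_mod_cast Nat.le_of_dvd hl (Nat.dvd_trans (Nat.gcd_dvd_left _ _) (Nat.dvd_lcm_left _ _))
  have h3 : ((Int.lcm m m' : ℝ) ^ (n + 2))⁻¹ =
      (((Int.lcm m m' : ℝ) ^ 2)⁻¹) ^ ((n : ℝ) / 2 + 1) := by
    rw [Real.inv_rpow (by positivity), ← Real.rpow_natCast _ 2, ← Real.rpow_mul hl'.le,
      ← Real.rpow_natCast]
    congr 2
    push_cast
    ring
  rw [← Real.mul_rpow (abs_nonneg _) (abs_nonneg _), h1, h3,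
    ← Real.mul_rpow (by positivity) (by positivity)]
  have h4 : (Int.gcd m m' : ℝ) * Int.lcm m m' * ((Int.lcm m m' : ℝ) ^ 2)⁻¹ =
      Int.gcd m m' / Int.lcm m m' := by
    field_simp
  rw [h4]
  refine Real.rpow_le_self_of_le_one (by positivity) ((div_le_one hl').2 hle) ?_
  have : (0 : ℝ) ≤ n / 2 := by positivity
  linarith

/-! ### The variance bound -/

theorem exists_forall_mem_ell_abs_lt {n : ℕ} {W : Matrix (Fin n) (Fin n) ℝ} (hW : W.det ≠ 0)
    (s : ℝ) : ∃ N : ℕ, ∀ y ∈ ell W s, ∀ i, |y i| < N := by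
  have hu : IsUnit W.det := isUnit_iff_ne_zero.2 hW
  set K : ℝ := ∑ i, ∑ j, |W⁻¹ i j| with hK
  obtain ⟨N, hN⟩ := exists_nat_gt (√s * K)
  refine ⟨N, fun y hy i => lt_of_le_of_lt ?_ hN⟩
  have hs : 0 < s := (qf_nonneg W y).trans_lt hy
  have hz : ∀ j, |Matrix.vecMul y W j| ≤ √s := by
    intro j
    rw [← Real.sqrt_sq_eq_abs]
    refine Real.sqrt_le_sqrt ((Finset.single_le_sum (f := fun j => (Matrix.vecMul y W j) ^ 2)
      (fun _ _ => sq_nonneg _) (Finset.mem_univ j)).trans (le_of_lt hy))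
  have hy' : y = Matrix.vecMul (Matrix.vecMul y W) W⁻¹ := by
    rw [Matrix.vecMul_vecMul, Matrix.mul_nonsing_inv _ hu, Matrix.vecMul_one]
  rw [hy', Matrix.vecMul, dotProduct, hK, Finset.mul_sum]
  refine (Finset.abs_sum_le_sum_abs _ _).trans (Finset.sum_le_sum fun j _ => ?_)
  rw [abs_mul]
  refine mul_le_mul (hz j) ?_ (abs_nonneg _) (Real.sqrt_nonneg _)
  exact Finset.single_le_sum (f := fun i => |W⁻¹ j i|) (fun _ _ => abs_nonneg _)
    (Finset.mem_univ i)

/-- The sum over nonzero `m` of the discrepancies of the ellipsoids `ell W (s m)` with respect to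
the lattice translated by `m • w`. -/
noncomputable def sliceDiscrepancy {n : ℕ} (W : Matrix (Fin n) (Fin n) ℝ) (s : ℤ → ℝ) (X : ℕ)
    (w : Fin n → ℝ) : ℝ :=
  ∑ m ∈ nonzeroIcc X, (latticeCount (ell W (s m)) ((m : ℝ) • w) - volume.real (ell W (s m)))

theorem intPeriodic_sliceDiscrepancy {n : ℕ} (W : Matrix (Fin n) (Fin n) ℝ) (s : ℤ → ℝ) (X : ℕ) :
    IntPeriodic (sliceDiscrepancy W s X) := by
  intro x k
  unfold sliceDiscrepancy
  refine Finset.sum_congr rfl fun m _ => ?_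
  exact congrArg (· - volume.real (ell W (s m)))
    ((intPeriodic_latticeCount (ell W (s m))).comp_smul m x k)

theorem measurable_sliceDiscrepancy {n : ℕ} (W : Matrix (Fin n) (Fin n) ℝ) (s : ℤ → ℝ) (X : ℕ) :
    Measurable (sliceDiscrepancy W s X) := by
  unfold sliceDiscrepancy
  refine Finset.measurable_fun_sum _ fun m _ => Measurable.sub_const ?_ _
  exact (measurable_latticeCount (measurableSet_ell W _)).comp (measurable_const_smul _)

theorem exists_abs_sliceDiscrepancy_le {n : ℕ} {W : Matrix (Fin n) (Fin n) ℝ} (hW : W.det ≠ 0)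
    (s : ℤ → ℝ) (X : ℕ) : ∃ C, ∀ w, |sliceDiscrepancy W s X w| ≤ C := by
  choose N hN using fun m => exists_forall_mem_ell_abs_lt hW (s m)
  refine ⟨∑ m ∈ nonzeroIcc X, (((intBox n (N m)).card : ℝ) + volume.real (ell W (s m))),
    fun w => (Finset.abs_sum_le_sum_abs _ _).trans (Finset.sum_le_sum fun m _ => ?_)⟩
  refine (abs_sub _ _).trans (add_le_add ?_ ?_)
  · rw [abs_of_nonneg (latticeCount_nonneg _ _)]
    exact latticeCount_le (hN m) _
  · rw [abs_of_nonneg measureReal_nonneg]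

-- Subtracting the volume cancels the frequency zero, and frequencies not divisible by `m` vanish.
-- At `ξ = m • η` the decay `‖η‖ ^ (-(n / 2 + 1))` becomes that of `ξ` times `|m| ^ (n / 2 + 1)`.
open scoped Classical in
theorem norm_setIntegral_echar_mul_sub_le {n : ℕ} {W : Matrix (Fin (n + 1)) (Fin (n + 1)) ℝ}
    (hW : W.det ≠ 0) {s K : ℝ} (hK0 : 0 ≤ K)
    (hK : ∀ ξ : Fin (n + 1) → ℝ, ξ ≠ 0 →
      ‖∫ y in ell W s, echar ξ y‖ ≤ K * ‖ξ‖ ^ (-((n : ℝ) / 2 + 1)))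
    {m : ℤ} (hm : m ≠ 0) (ξ : Fin (n + 1) → ℤ) :
    ‖∫ w in cube (n + 1), echar (intVec ξ) w *
      (((latticeCount (ell W s) ((m : ℝ) • w) : ℝ) : ℂ) - (volume.real (ell W s) : ℂ))‖ ≤
      K * ‖intVec ξ‖ ^ (-((n : ℝ) / 2 + 1)) *
        (if ∀ i, m ∣ ξ i then |(m : ℝ)| ^ ((n : ℝ) / 2 + 1) else 0) := by
  obtain ⟨N, hN⟩ := exists_forall_mem_ell_abs_lt hW s
  have hEm := measurableSet_ell W s
  have hi1 : Integrable (fun w => echar (intVec ξ) w *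
      ((latticeCount (ell W s) ((m : ℝ) • w) : ℝ) : ℂ)) (volume.restrict (cube (n + 1))) := by
    refine Integrable.of_bound (C := (intBox (n + 1) N).card) ?_ (ae_of_all _ fun w => ?_)
    · refine ((continuous_echar _).measurable.mul
        (Complex.measurable_ofReal.comp ?_)).aestronglyMeasurable
      exact (measurable_latticeCount hEm).comp (measurable_const_smul _)
    · rw [norm_mul, norm_echar, one_mul, Complex.norm_real, Real.norm_eq_abs,
        abs_of_nonneg (latticeCount_nonneg _ _)]
      exact latticeCount_le hN _
  have hi2 : Integrable (fun w => echar (intVec ξ) w * (volume.real (ell W s) : ℂ))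
      (volume.restrict (cube (n + 1))) := by
    refine Integrable.mul_const ?_ _
    exact Integrable.of_bound (C := 1) (continuous_echar _).aestronglyMeasurable
      (ae_of_all _ fun w => (norm_echar _ _).le)
  have hsplit : ∫ w in cube (n + 1), echar (intVec ξ) w *
      (((latticeCount (ell W s) ((m : ℝ) • w) : ℝ) : ℂ) - (volume.real (ell W s) : ℂ)) =
      (∫ w in cube (n + 1), echar (intVec ξ) w *
        ((latticeCount (ell W s) ((m : ℝ) • w) : ℝ) : ℂ)) -
      (∫ w in cube (n + 1), echar (intVec ξ) w) * (volume.real (ell W s) : ℂ) := by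
    simp_rw [mul_sub]
    rw [integral_sub hi1 hi2, integral_mul_const]
  rw [hsplit]
  have hnn : 0 ≤ K * ‖intVec ξ‖ ^ (-((n : ℝ) / 2 + 1)) *
        (if ∀ i, m ∣ ξ i then |(m : ℝ)| ^ ((n : ℝ) / 2 + 1) else 0) := by
    split_ifs <;> positivity
  by_cases hξ : ξ = 0
  · subst hξ
    have h1 := setIntegral_echar_mul_latticeCount_smul hEm hN 0 hm
    have h0 : intVec (0 : Fin (n + 1) → ℤ) = 0 := by
      ext i
      simp [intVec]
    rw [smul_zero] at h1
    rw [h1]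
    refine le_trans (le_of_eq ?_) hnn
    simp [h0, echar_zero, Measure.real, volume_cube]
  · rw [setIntegral_echar_cube hξ, zero_mul, sub_zero]
    by_cases hd : ∀ i, m ∣ ξ i
    · choose η hη using hd
      have hmη : ξ = m • η := by
        ext i
        simpa using hη i
      have hη0 : intVec η ≠ 0 := by
        intro h
        refine hξ ?_
        rw [hmη]
        ext i
        have := congrFun h i
        have : η i = 0 := by simpa [intVec] using this
        simp [this]
      have hm0 : 0 < |(m : ℝ)| := abs_pos.2 (by exact_mod_cast hm)
      rw [if_pos fun i => ⟨_, hη i⟩, hmη, setIntegral_echar_mul_latticeCount_smul hEm hN η hm,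
        norm_intVec_smul, Real.mul_rpow hm0.le (norm_nonneg _)]
      refine (hK _ hη0).trans (le_of_eq ?_)
      have : |(m : ℝ)| ^ (-((n : ℝ) / 2 + 1)) * |(m : ℝ)| ^ ((n : ℝ) / 2 + 1) = 1 := by
        rw [← Real.rpow_add hm0]
        simp
      linear_combination (-K * ‖intVec η‖ ^ (-((n : ℝ) / 2 + 1))) * this
    · obtain ⟨j, hj⟩ := not_forall.1 hd
      rw [setIntegral_echar_mul_latticeCount_smul_eq_zero hEm hm hj, norm_zero]
      exact hnn

-- Parseval, then expansion of the squared sum over `m`: the pair `m, m'` meets at the multiples of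
-- its lcm, and summing over these leaves the gcd-to-lcm ratio.
open scoped Classical in
theorem setIntegral_sliceDiscrepancy_sq_le {n : ℕ} {W : Matrix (Fin (n + 1)) (Fin (n + 1)) ℝ}
    (hW : W.det ≠ 0) {s : ℤ → ℝ} {K : ℝ} (hK0 : 0 ≤ K)
    (hK : ∀ m, ∀ ξ : Fin (n + 1) → ℝ, ξ ≠ 0 →
      ‖∫ y in ell W (s m), echar ξ y‖ ≤ K * ‖ξ‖ ^ (-((n : ℝ) / 2 + 1))) (X : ℕ) :
    ∫ w in cube (n + 1), (sliceDiscrepancy W s X w) ^ 2 ≤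
      K ^ 2 * latticeZeta n * (4 * (X * (1 + Real.log X) ^ 2)) := by
  set β : ℝ := (n : ℝ) / 2 + 1 with hβ
  obtain ⟨C, hC⟩ := exists_abs_sliceDiscrepancy_le hW s X
  have hm0 : ∀ m ∈ nonzeroIcc X, m ≠ 0 := fun m hm => (Finset.mem_erase.1 hm).1
  have hP := hasSum_sq_setIntegral_echar
    ((intPeriodic_sliceDiscrepancy W s X).comp Complex.ofReal)
    (Complex.measurable_ofReal.comp (measurable_sliceDiscrepancy W s X))
    (C := C) (fun w => by simpa using hC w)
  have hcoef : ∀ ξ : Fin (n + 1) → ℤ,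
      ‖∫ w in cube (n + 1), echar (intVec ξ) w * (sliceDiscrepancy W s X w : ℂ)‖ ≤
      K * ‖intVec ξ‖ ^ (-β) * ∑ m ∈ nonzeroIcc X,
        (if ∀ i, m ∣ ξ i then |(m : ℝ)| ^ β else 0) := by
    intro ξ
    have h1 : ∫ w in cube (n + 1), echar (intVec ξ) w * (sliceDiscrepancy W s X w : ℂ) =
        ∑ m ∈ nonzeroIcc X, ∫ w in cube (n + 1), echar (intVec ξ) w *
          (((latticeCount (ell W (s m)) ((m : ℝ) • w) : ℝ) : ℂ) -
            (volume.real (ell W (s m)) : ℂ)) := by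
      rw [← integral_finsetSum]
      · congr 1
        ext w
        rw [sliceDiscrepancy, Complex.ofReal_sum, Finset.mul_sum]
        simp
      · intro m _
        obtain ⟨N, hN⟩ := exists_forall_mem_ell_abs_lt hW (s m)
        refine Integrable.of_bound (C := (intBox (n + 1) N).card + volume.real (ell W (s m)))
          ?_ (ae_of_all _ fun w => ?_)
        · refine ((continuous_echar _).measurable.mul (Measurable.sub_const
            (Complex.measurable_ofReal.comp ?_) _)).aestronglyMeasurable
          exact (measurable_latticeCount (measurableSet_ell W _)).comp (measurable_const_smul _)
        · rw [norm_mul, norm_echar, one_mul]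
          refine (norm_sub_le _ _).trans (add_le_add ?_ ?_)
          · rw [Complex.norm_real, Real.norm_eq_abs, abs_of_nonneg (latticeCount_nonneg _ _)]
            exact latticeCount_le hN _
          · rw [Complex.norm_real, Real.norm_eq_abs, abs_of_nonneg measureReal_nonneg]
    rw [h1, Finset.mul_sum]
    exact (norm_sum_le _ _).trans (Finset.sum_le_sum fun m hm =>
      norm_setIntegral_echar_mul_sub_le hW hK0 (hK m) (hm0 m hm) ξ)
  have hsq : ∀ ξ : Fin (n + 1) → ℤ,
      ‖∫ w in cube (n + 1), echar (intVec ξ) w * (sliceDiscrepancy W s X w : ℂ)‖ ^ 2 ≤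
      ∑ m ∈ nonzeroIcc X, ∑ m' ∈ nonzeroIcc X, K ^ 2 * (|(m : ℝ)| ^ β * |(m' : ℝ)| ^ β) *
        (if (∀ i, m ∣ ξ i) ∧ (∀ i, m' ∣ ξ i) then (‖intVec ξ‖ ^ (n + 2))⁻¹ else 0) := by
    intro ξ
    refine (pow_le_pow_left₀ (norm_nonneg _) (hcoef ξ) 2).trans (le_of_eq ?_)
    -- Twice `β` is the integer `n + 2`, the exponent of `latticeZeta`. At `ξ = 0` both sides are 0.
    have h2 : (‖intVec ξ‖ ^ (-β)) ^ 2 = (‖intVec ξ‖ ^ (n + 2))⁻¹ := by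
      rw [← Real.rpow_natCast, ← Real.rpow_mul (norm_nonneg _), ← Real.rpow_natCast,
        ← Real.rpow_neg (norm_nonneg _)]
      congr 1
      rw [hβ]
      push_cast
      ring
    rw [mul_pow, mul_pow, h2, sq (Finset.sum _ _), Finset.sum_mul_sum, Finset.mul_sum]
    refine Finset.sum_congr rfl fun m _ => ?_
    rw [Finset.mul_sum]
    refine Finset.sum_congr rfl fun m' _ => ?_
    by_cases h : ∀ i, m ∣ ξ i
    · by_cases h' : ∀ i, m' ∣ ξ i
      · rw [if_pos h, if_pos h', if_pos ⟨h, h'⟩]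
        ring
      · rw [if_neg h', if_neg fun hh : _ ∧ _ => h' hh.2]
        ring
    · rw [if_neg h, if_neg fun hh : _ ∧ _ => h hh.1]
      ring
  have hsum : HasSum (fun ξ : Fin (n + 1) → ℤ =>
      ∑ m ∈ nonzeroIcc X, ∑ m' ∈ nonzeroIcc X, K ^ 2 * (|(m : ℝ)| ^ β * |(m' : ℝ)| ^ β) *
        (if (∀ i, m ∣ ξ i) ∧ (∀ i, m' ∣ ξ i) then (‖intVec ξ‖ ^ (n + 2))⁻¹ else 0))
      (∑ m ∈ nonzeroIcc X, ∑ m' ∈ nonzeroIcc X, K ^ 2 * (|(m : ℝ)| ^ β * |(m' : ℝ)| ^ β) *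
        (((Int.lcm m m' : ℝ) ^ (n + 2))⁻¹ * latticeZeta n)) :=
    hasSum_sum fun m hm => hasSum_sum fun m' hm' =>
      (hasSum_norm_intVec_of_dvd n (hm0 m hm) (hm0 m' hm')).mul_left _
  have hle := hasSum_le hsq hP hsum
  have hI : ∫ w in cube (n + 1), ‖(sliceDiscrepancy W s X w : ℂ)‖ ^ 2 =
      ∫ w in cube (n + 1), (sliceDiscrepancy W s X w) ^ 2 := by
    simp
  rw [hI] at hle
  refine hle.trans ?_
  have hZ := latticeZeta_nonneg n
  calc _ ≤ ∑ m ∈ nonzeroIcc X, ∑ m' ∈ nonzeroIcc X,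
        K ^ 2 * latticeZeta n * ((Int.gcd m m' : ℝ) / (Int.lcm m m' : ℝ)) := by
        refine Finset.sum_le_sum fun m hm => Finset.sum_le_sum fun m' hm' => ?_
        have h := mul_le_mul_of_nonneg_left (rpow_mul_lcm_inv_le n (hm0 m hm) (hm0 m' hm'))
          (by positivity : 0 ≤ K ^ 2 * latticeZeta n)
        refine le_trans (le_of_eq ?_) h
        ring
    _ = K ^ 2 * latticeZeta n * ∑ m ∈ nonzeroIcc X, ∑ m' ∈ nonzeroIcc X,
        ((Int.gcd m m' : ℝ) / (Int.lcm m m' : ℝ)) := by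
        simp_rw [Finset.mul_sum]
    _ ≤ _ := mul_le_mul_of_nonneg_left (sum_nonzeroIcc_gcd_div_lcm_le X) (by positivity)

/-- The variance bound, uniform over matrices with bounded entries and determinant bounded
below. -/
theorem exists_setIntegral_sliceDiscrepancy_sq_le (n : ℕ) {B : ℝ} (hB : 0 < B) :
    ∃ C, 0 ≤ C ∧ ∀ (W : Matrix (Fin (n + 1)) (Fin (n + 1)) ℝ), W.det ≠ 0 → |W.det|⁻¹ ≤ B →
      (∀ i j, |W i j| ≤ B) → ∀ (T : ℝ), 0 ≤ T → ∀ s : ℤ → ℝ, (∀ m, s m ≤ T ^ 2) → ∀ X : ℕ,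
      ∫ w in cube (n + 1), (sliceDiscrepancy W s X w) ^ 2 ≤
        C * T ^ n * (X * (1 + Real.log X) ^ 2) := by
  obtain ⟨C, hC0, hC⟩ := exists_norm_integral_echar_ell_le n hB
  have hZ := latticeZeta_nonneg n
  refine ⟨C ^ 2 * latticeZeta n * 4, by positivity, fun W hW hd hWB T hT s hs X => ?_⟩
  refine (setIntegral_sliceDiscrepancy_sq_le hW (K := C * T ^ ((n : ℝ) / 2)) (by positivity)
    (fun m ξ hξ => hC W hW hd hWB ξ T (s m) hξ hT (hs m)) X).trans (le_of_eq ?_)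
  have : (T ^ ((n : ℝ) / 2)) ^ 2 = T ^ n := by
    rw [← Real.rpow_natCast, ← Real.rpow_mul hT, ← Real.rpow_natCast]
    congr 1
    push_cast
    ring
  rw [mul_pow, this]
  ring

/-! ### Unipotent matrices -/

/-- The upper triangular unipotent matrix with entries `x` above the diagonal. -/
def unipMat {d : ℕ} (x : AboveDiag d → ℝ) : Matrix (Fin d) (Fin d) ℝ :=
  Matrix.of fun i j => if h : i < j then x ⟨(i, j), h⟩ else if i = j then 1 else 0

theorem det_unipMat {d : ℕ} (x : AboveDiag d → ℝ) : (unipMat x).det = 1 := by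
  have h : (unipMat x).IsUpperTriangular := fun i j (h : j < i) => by
    simp [unipMat, h.not_gt, h.ne']
  rw [Matrix.det_of_isUpperTriangular h]
  simp [unipMat]

theorem continuous_unipMat (d : ℕ) : Continuous (unipMat : (AboveDiag d → ℝ) → _) := by
  refine continuous_matrix fun i j => ?_
  unfold unipMat
  simp only [Matrix.of_apply]
  split_ifs <;> fun_prop

/-- With determinant one the inverse is the adjugate, polynomial in the entries. -/
theorem continuous_unipMat_inv (d : ℕ) :
    Continuous fun x : AboveDiag d → ℝ => (unipMat x)⁻¹ := by
  have h : (fun x : AboveDiag d → ℝ => (unipMat x)⁻¹) = fun x => (unipMat x).adjugate := by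
    ext1 x
    rw [Matrix.inv_def, det_unipMat]
    simp
  rw [h]
  exact (continuous_unipMat d).matrix_adjugate

/-- The unit cube of entries above the diagonal. -/
def entryCube (d : ℕ) : Set (AboveDiag d → ℝ) := {x | ∀ p, x p ∈ Set.Ico (0 : ℝ) 1}

/-- The cube has compact closure. This is what makes the constants for `unipMat x * W'` independent
of `x`. -/
theorem exists_entry_bound {d : ℕ} {f : (AboveDiag d → ℝ) → Matrix (Fin d) (Fin d) ℝ}
    (hf : Continuous f) : ∃ B, 0 < B ∧ ∀ x ∈ entryCube d, ∀ i j, |f x i j| ≤ B := by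
  have h : ∀ i j, ∃ C, ∀ x ∈ Set.Icc (0 : AboveDiag d → ℝ) 1, ‖f x i j‖ ≤ C := fun i j =>
    isCompact_Icc.exists_bound_of_continuousOn (hf.matrix_elem i j).continuousOn
  choose C hC using h
  refine ⟨1 + ∑ i, ∑ j, |C i j|, by positivity, fun x hx i j => ?_⟩
  have hx' : x ∈ Set.Icc (0 : AboveDiag d → ℝ) 1 :=
    ⟨fun p => (hx p).1, fun p => (hx p).2.le⟩
  have h1 := (hC i j x hx').trans (le_abs_self _)
  have h2 : |C i j| ≤ ∑ j, |C i j| :=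
    Finset.single_le_sum (f := fun j => |C i j|) (fun _ _ => abs_nonneg _) (Finset.mem_univ j)
  have h3 : ∑ j, |C i j| ≤ ∑ i, ∑ j, |C i j| :=
    Finset.single_le_sum (f := fun i => ∑ j, |C i j|)
      (fun _ _ => Finset.sum_nonneg fun _ _ => abs_nonneg _) (Finset.mem_univ i)
  rw [Real.norm_eq_abs] at h1
  linarith

theorem measurableSet_entryCube (d : ℕ) : MeasurableSet (entryCube d) :=
  MeasurableSet.univ_pi' fun _ => measurableSet_Ico

theorem volume_entryCube (d : ℕ) : volume (entryCube d) = 1 := by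
  have : entryCube d = Set.pi Set.univ fun _ => Set.Ico (0 : ℝ) 1 := by
    ext x
    simp [entryCube]
  rw [this, volume_pi_pi]
  simp

/-! ### Splitting off the first row -/

/-- The positions above the diagonal are those of the first row and the remaining ones. -/
noncomputable def aboveDiagSucc (d : ℕ) : Fin d ⊕ AboveDiag d ≃ AboveDiag (d + 1) :=
  Equiv.ofBijective
    (Sum.elim (fun j => ⟨(0, j.succ), Fin.succ_pos j⟩)
      fun p => ⟨(p.1.1.succ, p.1.2.succ), Fin.succ_lt_succ_iff.2 p.2⟩) (by
    constructor
    · rintro (j | ⟨⟨i, j⟩, h⟩) (j' | ⟨⟨i', j'⟩, h'⟩) heq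
      · simpa using heq
      · simp [Fin.ext_iff] at heq
      · simp [Fin.ext_iff] at heq
      · simpa using heq
    · rintro ⟨⟨i, j⟩, h⟩
      obtain ⟨j, rfl⟩ := Fin.exists_succ_eq.2 (Fin.pos_iff_ne_zero.1 ((Fin.zero_le i).trans_lt h))
      induction i using Fin.cases with
      | zero => exact ⟨Sum.inl j, rfl⟩
      | succ i => exact ⟨Sum.inr ⟨(i, j), Fin.succ_lt_succ_iff.1 h⟩, rfl⟩)

/-- The entries above the diagonal with given first row. -/
noncomputable def consRow (d : ℕ) : (Fin d → ℝ) × (AboveDiag d → ℝ) ≃ᵐ (AboveDiag (d + 1) → ℝ) :=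
  (MeasurableEquiv.sumPiEquivProdPi fun _ : Fin d ⊕ AboveDiag d => ℝ).symm.trans
    (MeasurableEquiv.piCongrLeft (fun _ => ℝ) (aboveDiagSucc d))

theorem consRow_zero {d : ℕ} (r : Fin d → ℝ) (x : AboveDiag d → ℝ) (j : Fin d) :
    consRow d (r, x) ⟨(0, j.succ), Fin.succ_pos j⟩ = r j :=
  Equiv.piCongrLeft_apply_apply (fun _ => ℝ) (aboveDiagSucc d) _ (Sum.inl j)

theorem consRow_succ {d : ℕ} (r : Fin d → ℝ) (x : AboveDiag d → ℝ) (p : AboveDiag d) :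
    consRow d (r, x) ⟨(p.1.1.succ, p.1.2.succ), Fin.succ_lt_succ_iff.2 p.2⟩ = x p :=
  Equiv.piCongrLeft_apply_apply (fun _ => ℝ) (aboveDiagSucc d) _ (Sum.inr p)

theorem measurePreserving_consRow (d : ℕ) : MeasurePreserving (consRow d) :=
  (volume_measurePreserving_piCongrLeft (fun _ => ℝ) (aboveDiagSucc d)).comp
    (volume_measurePreserving_sumPiEquivProdPi_symm fun _ : Fin d ⊕ AboveDiag d => ℝ)

/-- The half-open unit cube of first rows. -/
def rowCube (d : ℕ) : Set (Fin d → ℝ) := {r | ∀ i, r i ∈ Set.Ico (0 : ℝ) 1}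

theorem measurableSet_rowCube (d : ℕ) : MeasurableSet (rowCube d) :=
  MeasurableSet.univ_pi' fun _ => measurableSet_Ico

theorem volume_rowCube (d : ℕ) : volume (rowCube d) = 1 := by
  have : rowCube d = Set.pi Set.univ fun _ => Set.Ico (0 : ℝ) 1 := by
    ext x
    simp [rowCube]
  rw [this, volume_pi_pi]
  simp

theorem consRow_preimage_entryCube (d : ℕ) :
    consRow d ⁻¹' entryCube (d + 1) = rowCube d ×ˢ entryCube d := by
  ext ⟨r, x⟩
  constructor
  · intro h
    refine ⟨fun j => ?_, fun p => ?_⟩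
    · have h1 := h ⟨(0, j.succ), Fin.succ_pos j⟩
      rwa [consRow_zero] at h1
    · have h1 := h ⟨(p.1.1.succ, p.1.2.succ), Fin.succ_lt_succ_iff.2 p.2⟩
      rwa [consRow_succ] at h1
  · rintro ⟨h1, h2⟩ p
    obtain ⟨j | p, rfl⟩ := (aboveDiagSucc d).surjective p
    · exact (consRow_zero r x j).symm ▸ h1 j
    · exact (consRow_succ r x p).symm ▸ h2 p

theorem lintegral_entryCube_succ {d : ℕ} {f : (AboveDiag (d + 1) → ℝ) → ENNReal}
    (hf : Measurable f) :
    ∫⁻ x in entryCube (d + 1), f x =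
      ∫⁻ x in entryCube d, ∫⁻ r in rowCube d, f (consRow d (r, x)) := by
  rw [← (measurePreserving_consRow d).setLIntegral_comp_preimage_emb
    (consRow d).measurableEmbedding, consRow_preimage_entryCube, Measure.volume_eq_prod,
    ← Measure.prod_restrict, lintegral_prod_symm]
  exact (hf.comp (consRow d).measurable).aemeasurable

theorem unipMat_consRow_zero_zero {d : ℕ} (r : Fin d → ℝ) (x : AboveDiag d → ℝ) :
    unipMat (consRow d (r, x)) 0 0 = 1 := by
  simp [unipMat]

theorem unipMat_consRow_succ_zero {d : ℕ} (r : Fin d → ℝ) (x : AboveDiag d → ℝ) (i : Fin d) :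
    unipMat (consRow d (r, x)) i.succ 0 = 0 := by
  simp [unipMat]

theorem unipMat_consRow_zero_succ {d : ℕ} (r : Fin d → ℝ) (x : AboveDiag d → ℝ) (j : Fin d) :
    unipMat (consRow d (r, x)) 0 j.succ = r j := by
  simp only [unipMat, Matrix.of_apply]
  rw [dif_pos (Fin.succ_pos j)]
  exact consRow_zero r x j

theorem unipMat_consRow_succ_succ {d : ℕ} (r : Fin d → ℝ) (x : AboveDiag d → ℝ) (i j : Fin d) :
    unipMat (consRow d (r, x)) i.succ j.succ = unipMat x i j := by
  simp only [unipMat, Matrix.of_apply]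
  by_cases h : i < j
  · rw [dif_pos (Fin.succ_lt_succ_iff.2 h), dif_pos h]
    exact consRow_succ r x ⟨(i, j), h⟩
  · rw [dif_neg (fun h' => h (Fin.succ_lt_succ_iff.1 h')), dif_neg h]
    simp

theorem vecMul_unipMat_consRow_zero {d : ℕ} (r : Fin d → ℝ) (x : AboveDiag d → ℝ)
    (v : Fin (d + 1) → ℝ) : Matrix.vecMul v (unipMat (consRow d (r, x))) 0 = v 0 := by
  simp [Matrix.vecMul, dotProduct, Fin.sum_univ_succ, unipMat_consRow_zero_zero,
    unipMat_consRow_succ_zero]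

theorem vecMul_unipMat_consRow_succ {d : ℕ} (r : Fin d → ℝ) (x : AboveDiag d → ℝ)
    (v : Fin (d + 1) → ℝ) (j : Fin d) :
    Matrix.vecMul v (unipMat (consRow d (r, x))) j.succ =
      v 0 * r j + Matrix.vecMul (fun i : Fin d => v i.succ) (unipMat x) j := by
  simp [Matrix.vecMul, dotProduct, Fin.sum_univ_succ, unipMat_consRow_zero_succ,
    unipMat_consRow_succ_succ]

/-- Completing the square for a sheared vector. -/
theorem qf_unipMat_consRow {d : ℕ} {a : ℝ} {c : Fin d → ℝ} {W' : Matrix (Fin d) (Fin d) ℝ}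
    {W : Matrix (Fin (d + 1)) (Fin (d + 1)) ℝ}
    (h : ∀ v, qf W v = a * v 0 ^ 2 + qf W' (fun i => v i.succ + v 0 * c i))
    (r : Fin d → ℝ) (x : AboveDiag d → ℝ) (v : Fin (d + 1) → ℝ) :
    qf (unipMat (consRow d (r, x)) * W) v = a * v 0 ^ 2 + qf (unipMat x * W')
      (v 0 • Matrix.vecMul (r + c) (unipMat x)⁻¹ + fun i : Fin d => v i.succ) := by
  have hu : IsUnit (unipMat x).det := by rw [det_unipMat]; exact isUnit_one
  -- In row form, with `v'` the tail of `v` and `U = unipMat x`, the inner vector is `v 0 • (r + c)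
  -- + v' U`, and `U` is factored out on the right.
  rw [← qf_vecMul, h, ← qf_vecMul, vecMul_unipMat_consRow_zero]
  congr 2
  ext i
  rw [vecMul_unipMat_consRow_succ, Matrix.add_vecMul, Matrix.smul_vecMul, Matrix.vecMul_vecMul,
    Matrix.nonsing_inv_mul _ hu, Matrix.vecMul_one]
  simp
  ring

/-! ### The discrepancy of a sheared ellipsoid -/

/-- The discrepancy of the ellipsoid `|y W| < T` with respect to the lattice `ℤᵈ u`, where `u` has
the entries `x` above the diagonal. -/
noncomputable def disc {d : ℕ} (W : Matrix (Fin d) (Fin d) ℝ) (x : AboveDiag d → ℝ) (T : ℝ) : ℝ :=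
  latticeCount (ell (unipMat x * W) (T ^ 2)) 0 - volume.real (ell W (T ^ 2))

theorem measurable_disc {d : ℕ} (W : Matrix (Fin d) (Fin d) ℝ) (T : ℝ) :
    Measurable fun x => disc W x T := by
  refine Measurable.sub_const (measurable_ncard fun k => ?_) _
  have hu := continuous_unipMat d
  have hc : Continuous fun x : AboveDiag d → ℝ => qf (unipMat x * W) (0 + intVec k) := by
    unfold qf
    fun_prop
  exact (isOpen_lt hc continuous_const).measurableSet

theorem intVec_cons_zero {d : ℕ} (m : ℤ) (k : Fin d → ℤ) :
    intVec (Fin.cons m k : Fin (d + 1) → ℤ) 0 = m := rfl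

theorem intVec_cons_succ {d : ℕ} (m : ℤ) (k : Fin d → ℤ) :
    (fun i : Fin d => intVec (Fin.cons m k : Fin (d + 1) → ℤ) i.succ) = intVec k := rfl

theorem finite_setOf_intVec_mem_ell {d : ℕ} {W : Matrix (Fin d) (Fin d) ℝ} (hW : W.det ≠ 0)
    (s : ℝ) (z : Fin d → ℝ) : {k : Fin d → ℤ | z + intVec k ∈ ell W s}.Finite := by
  obtain ⟨N, hN⟩ := exists_forall_mem_ell_abs_lt hW s
  refine ((intBox d N).finite_toSet.preimage
    (f := fun k : Fin d → ℤ => fun i => ⌈(z + intVec k) i⌉ - 1) ?_).subset fun k hk =>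
      mem_intBox_of_mem (fun i => rfl) (hN _ hk)
  intro k _ k' _ h
  ext i
  have h1 := congrFun h i
  simp only [Pi.add_apply, intVec, Int.ceil_add_intCast] at h1
  omega

/-- Counting lattice points by their first coordinate. -/
theorem latticeCount_eq_sum_slices {d : ℕ} {E : Set (Fin (d + 1) → ℝ)}
    (hE : {k : Fin (d + 1) → ℤ | (0 : Fin (d + 1) → ℝ) + intVec k ∈ E}.Finite)
    {F : ℤ → Set (Fin d → ℝ)} {w : Fin d → ℝ} {X : ℕ}
    (h : ∀ (m : ℤ) (k : Fin d → ℤ), intVec (Fin.cons m k : Fin (d + 1) → ℤ) ∈ E ↔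
      (m : ℝ) • w + intVec k ∈ F m) (hF : ∀ m : ℤ, m ∉ Finset.Icc (-X : ℤ) X → F m = ∅) :
    latticeCount E 0 = ∑ m ∈ Finset.Icc (-X : ℤ) X, latticeCount (F m) ((m : ℝ) • w) := by
  classical
  have hmem : ∀ k : Fin (d + 1) → ℤ, k ∈ hE.toFinset ↔ intVec k ∈ E := by
    intro k
    rw [hE.mem_toFinset]
    simp
  have hmaps : Set.MapsTo (fun k : Fin (d + 1) → ℤ => k 0) hE.toFinset
      (Finset.Icc (-X : ℤ) X) := by
    intro k hk
    by_contra hk0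
    rw [Finset.mem_coe, hmem, ← Fin.cons_self_tail k, h, hF _ (by simpa using hk0)] at hk
    exact hk
  unfold latticeCount
  rw [Set.ncard_eq_toFinset_card _ hE, Finset.card_eq_sum_card_fiberwise hmaps, Nat.cast_sum]
  refine Finset.sum_congr rfl fun m _ => ?_
  rw [← Set.ncard_coe_finset, ← Set.ncard_image_of_injective
    {k : Fin d → ℤ | (m : ℝ) • w + intVec k ∈ F m}
    (Fin.cons_right_injective (α := fun _ => ℤ) m)]
  refine congrArg (fun s : Set (Fin (d + 1) → ℤ) => (s.ncard : ℝ)) ?_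
  ext n
  simp only [Finset.coe_filter, hmem, Set.mem_ofPred_eq, Set.mem_image]
  constructor
  · rintro ⟨h1, rfl⟩
    exact ⟨Fin.tail n, (h _ _).1 (by rwa [Fin.cons_self_tail]), Fin.cons_self_tail n⟩
  · rintro ⟨k, hk, rfl⟩
    exact ⟨(h m k).2 hk, rfl⟩

theorem sum_Icc_eq_add_sum_nonzeroIcc (X : ℕ) (f : ℤ → ℝ) :
    ∑ m ∈ Finset.Icc (-X : ℤ) X, f m = f 0 + ∑ m ∈ nonzeroIcc X, f m :=
  (Finset.add_sum_erase _ f (by simp)).symm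

/-- The decomposition of the discrepancy in dimension `d + 1`. -/
theorem disc_consRow {d : ℕ} {a : ℝ} {c : Fin d → ℝ} {W' : Matrix (Fin d) (Fin d) ℝ}
    {W : Matrix (Fin (d + 1)) (Fin (d + 1)) ℝ} (ha : 0 < a) (hW : W.det ≠ 0) (hW' : W'.det ≠ 0)
    (h : ∀ v, qf W v = a * v 0 ^ 2 + qf W' (fun i => v i.succ + v 0 * c i))
    {T : ℝ} {X : ℕ} (hX : T ^ 2 ≤ a * X ^ 2) (r : Fin d → ℝ) (x : AboveDiag d → ℝ) :
    disc W (consRow d (r, x)) T = disc W' x T +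
      sliceDiscrepancy (unipMat x * W') (fun m => T ^ 2 - a * (m : ℝ) ^ 2) X
        (Matrix.vecMul (r + c) (unipMat x)⁻¹) +
      (∑ m ∈ Finset.Icc (-X : ℤ) X, volume.real (ell W' (T ^ 2 - a * (m : ℝ) ^ 2)) -
        volume.real (ell W (T ^ 2))) := by
  have hUW : (unipMat (consRow d (r, x)) * W).det ≠ 0 := by
    rwa [Matrix.det_mul, det_unipMat, one_mul]
  have hcount := latticeCount_eq_sum_slices (E := ell (unipMat (consRow d (r, x)) * W) (T ^ 2))
    (finite_setOf_intVec_mem_ell hUW _ 0)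
    (F := fun m => ell (unipMat x * W') (T ^ 2 - a * (m : ℝ) ^ 2))
    (w := Matrix.vecMul (r + c) (unipMat x)⁻¹) (X := X)
    (fun m k => by
      simp only [ell, Set.mem_ofPred_eq]
      rw [qf_unipMat_consRow h, intVec_cons_zero, intVec_cons_succ, lt_sub_iff_add_lt'])
    (fun m hm => ell_eq_empty _ (by
      have hXm : (X : ℝ) ^ 2 ≤ (m : ℝ) ^ 2 := by
        rw [sq_le_sq, Nat.abs_cast]
        have : (X : ℤ) ≤ |m| := by
          by_contra hlt
          rw [not_le, abs_lt] at hlt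
          exact hm (Finset.mem_Icc.2 ⟨by omega, by omega⟩)
        exact_mod_cast this
      have := mul_le_mul_of_nonneg_left hXm ha.le
      linarith))
  have hvol : ∀ s, volume.real (ell (unipMat x * W') s) = volume.real (ell W' s) :=
    volume_real_ell_mul _ _ (det_unipMat x) hW'
  -- The count in the slice `m = 0` does not see `r` and gives `disc W' x T`. The slice volumes do
  -- not see `x`, so they can be added and subtracted as a deterministic term.
  rw [disc, hcount, sum_Icc_eq_add_sum_nonzeroIcc, sum_Icc_eq_add_sum_nonzeroIcc, disc,
    sliceDiscrepancy, Finset.sum_sub_distrib]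
  simp only [hvol]
  simp
  ring

/-! ### Averaging over the first row -/

theorem IntPeriodic.setLIntegral_cell {n : ℕ} {f : (Fin n → ℝ) → ENNReal} (hf : IntPeriodic f)
    (k : Fin n → ℤ) : ∫⁻ y in cell k, f y = ∫⁻ z in cube n, f z := by
  rw [← lintegral_indicator (measurableSet_cell k), ← lintegral_indicator (measurableSet_cube n),
    ← lintegral_add_right_eq_self _ (intVec k)]
  congr 1
  ext z
  by_cases hz : z ∈ cube n
  · rw [Set.indicator_of_mem hz, Set.indicator_of_mem ((add_intVec_mem_cell z k).2 hz), hf]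
  · rw [Set.indicator_of_notMem hz,
      Set.indicator_of_notMem fun hh => hz ((add_intVec_mem_cell z k).1 hh)]

/-- A bounded set is covered by finitely many integral cells, each carrying the integral over the
cube. -/
theorem IntPeriodic.setLIntegral_le {n N : ℕ} {f : (Fin n → ℝ) → ENNReal} (hf : IntPeriodic f)
    {A : Set (Fin n → ℝ)} (hA : ∀ y ∈ A, ∀ i, |y i| < N) :
    ∫⁻ y in A, f y ≤ (intBox n N).card * ∫⁻ z in cube n, f z := by
  have hsub : A ⊆ ⋃ k ∈ intBox n N, cell k := by
    intro y hy
    have h1 : y ∈ cell fun i => ⌈y i⌉ - 1 := fun i => rfl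
    simp only [Set.mem_iUnion, exists_prop]
    exact ⟨_, mem_intBox_of_mem h1 (hA y hy), h1⟩
  refine (lintegral_mono_set hsub).trans ?_
  rw [lintegral_biUnion_finset]
  · simp_rw [hf.setLIntegral_cell]
    rw [Finset.sum_const, nsmul_eq_mul]
  · intro k _ l _ hkl
    refine Set.disjoint_left.2 fun y hy hy' => hkl ?_
    ext i
    rw [← hy i, ← hy' i]
  · exact fun k _ => measurableSet_cell k

/-- Averaging a periodic function over an affine image of the cube with a bounded volume preserving
linear part. -/
theorem IntPeriodic.setLIntegral_rowCube_le {n : ℕ} {f : (Fin n → ℝ) → ENNReal}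
    (hf : IntPeriodic f) (c : Fin n → ℝ) {V : Matrix (Fin n) (Fin n) ℝ} (hV : V.det = 1)
    {B : ℝ} (hB : ∀ i j, |V i j| ≤ B) {N : ℕ} (hN : ∑ i, (1 + |c i|) * B < N) :
    ∫⁻ r in rowCube n, f (Matrix.vecMul (r + c) V) ≤
      (intBox n N).card * ∫⁻ z in cube n, f z := by
  have hV0 : V.det ≠ 0 := by rw [hV]; exact one_ne_zero
  have hu : IsUnit V.det := isUnit_iff_ne_zero.2 hV0
  set A : Set (Fin n → ℝ) := (fun r => Matrix.vecMul (r + c) V) '' rowCube n with hAdef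
  have hA : ∀ y ∈ A, ∀ i, |y i| < N := by
    rintro _ ⟨r, hr, rfl⟩ j
    change |∑ i, (r + c) i * V i j| < N
    refine lt_of_le_of_lt ((Finset.abs_sum_le_sum_abs _ _).trans
      (Finset.sum_le_sum fun i _ => ?_)) hN
    rw [abs_mul]
    refine mul_le_mul ((abs_add_le _ _).trans ?_) (hB i j) (abs_nonneg _) (by positivity)
    have := hr i
    rw [abs_of_nonneg this.1]
    linarith [this.2]
  have hemb : MeasurableEmbedding fun r => Matrix.vecMul (r + c) V :=
    (measurableEmbedding_vecMul hV0).comp (measurableEmbedding_addRight c)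
  have hAm : MeasurableSet A := hemb.measurableSet_image.2 (measurableSet_rowCube n)
  -- The affine map has Jacobian one, so the average over rows is exactly the integral over the
  -- image `A`.
  refine le_trans (le_of_eq ?_) (hf.setLIntegral_le hA)
  have h1 : ∀ r, (rowCube n).indicator (fun r => f (Matrix.vecMul (r + c) V)) r =
      A.indicator f (Matrix.vecMul (r + c) V) := by
    intro r
    by_cases hr : r ∈ rowCube n
    · rw [Set.indicator_of_mem hr, Set.indicator_of_mem (Set.mem_image_of_mem _ hr)]
    · rw [Set.indicator_of_notMem hr, Set.indicator_of_notMem]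
      exact fun h => hr ((hemb.injective.mem_set_image).1 h)
  rw [← lintegral_indicator (measurableSet_rowCube n), ← lintegral_indicator hAm]
  simp_rw [h1]
  rw [lintegral_add_right_eq_self (fun r => A.indicator f (Matrix.vecMul r V)) c,
    lintegral_comp_vecMul hV0, hV]
  simp

/-- Dimension zero is a single point of mass one: the induction starts there, and zero-dimensional
slices have no discrepancy. -/
theorem latticeCount_eq_volume_of_isEmpty (E : Set (Fin 0 → ℝ)) (z : Fin 0 → ℝ) :
    latticeCount E z = volume.real E := by
  by_cases h : z ∈ E
  · have hE : E = Set.univ := Set.eq_univ_of_forall fun y => Subsingleton.elim z y ▸ h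
    subst hE
    simp [latticeCount, Measure.real, Measure.volume_pi_eq_dirac 0]
  · have hE : E = ∅ := Set.eq_empty_of_forall_notMem fun y hy => h (Subsingleton.elim y z ▸ hy)
    subst hE
    simp [latticeCount]

theorem exists_setLIntegral_sliceDiscrepancy_le (d : ℕ) {B A : ℝ} (hB : 0 < B) (hA : 1 ≤ A) :
    ∃ C, 0 ≤ C ∧ ∀ (W : Matrix (Fin d) (Fin d) ℝ), W.det ≠ 0 → |W.det|⁻¹ ≤ B →
      (∀ i j, |W i j| ≤ B) → ∀ (T : ℝ), 2 ≤ T → ∀ s : ℤ → ℝ, (∀ m, s m ≤ T ^ 2) → ∀ X : ℕ,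
      (X : ℝ) ≤ A * T → ∫⁻ w in cube d, ENNReal.ofReal (sliceDiscrepancy W s X w ^ 2) ≤
        ENNReal.ofReal (C * T ^ d * Real.log T ^ 2) := by
  rcases d with _ | n
  · refine ⟨0, le_rfl, fun W _ _ _ T _ s _ X _ => ?_⟩
    simp [sliceDiscrepancy, latticeCount_eq_volume_of_isEmpty]
  · obtain ⟨C, hC0, hC⟩ := exists_setIntegral_sliceDiscrepancy_sq_le n hB
    have hl2 : 0 < Real.log 2 := Real.log_pos one_lt_two
    have hlA : 0 ≤ Real.log A := Real.log_nonneg hA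
    -- Chosen so that `1 + log A + log T ≤ L * log T`, using `log T ≥ log 2`.
    set L : ℝ := (1 + Real.log A) / Real.log 2 + 1 with hL
    refine ⟨C * A * L ^ 2, by positivity, fun W hW hd hWB T hT s hs X hX => ?_⟩
    obtain ⟨M, hM⟩ := exists_abs_sliceDiscrepancy_le hW s X
    have hT0 : 0 < T := by linarith
    have hint : Integrable (fun w => sliceDiscrepancy W s X w ^ 2)
        (volume.restrict (cube (n + 1))) := by
      refine Integrable.of_bound (C := M ^ 2)
        ((measurable_sliceDiscrepancy W s X).pow_const 2).aestronglyMeasurable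
        (ae_of_all _ fun w => ?_)
      rw [norm_pow, Real.norm_eq_abs]
      exact pow_le_pow_left₀ (abs_nonneg _) (hM w) 2
    rw [← ofReal_integral_eq_lintegral_ofReal hint (ae_of_all _ fun w => sq_nonneg _)]
    refine ENNReal.ofReal_le_ofReal ((hC W hW hd hWB T hT0.le s hs X).trans ?_)
    have hlT : Real.log 2 ≤ Real.log T := Real.log_le_log two_pos hT
    have hlog : 1 + Real.log X ≤ L * Real.log T := by
      have h1 : Real.log X ≤ Real.log A + Real.log T := by
        rcases Nat.eq_zero_or_pos X with h | h
        · rw [h]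
          simp
          linarith
        · rw [← Real.log_mul (by positivity) hT0.ne']
          exact Real.log_le_log (by exact_mod_cast h) hX
      have h2 : 1 + Real.log A ≤ (1 + Real.log A) / Real.log 2 * Real.log T := by
        rw [div_mul_eq_mul_div, le_div_iff₀ hl2]
        exact mul_le_mul_of_nonneg_left hlT (by positivity)
      rw [hL, add_mul, one_mul]
      linarith
    have hlog0 : 0 ≤ 1 + Real.log X := by
      have := Real.log_natCast_nonneg X
      linarith
    calc C * T ^ n * (X * (1 + Real.log X) ^ 2) ≤
        C * T ^ n * ((A * T) * (L * Real.log T) ^ 2) := by gcongr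
      _ = _ := by ring

theorem add_add_sq_le (a b c : ℝ) : (a + b + c) ^ 2 ≤ 3 * (a ^ 2 + b ^ 2 + c ^ 2) := by
  nlinarith [sq_nonneg (a - b), sq_nonneg (b - c), sq_nonneg (a - c)]

theorem ofReal_add_add_sq_le (a b c : ℝ) : ENNReal.ofReal ((a + b + c) ^ 2) ≤
    3 * (ENNReal.ofReal (a ^ 2) + ENNReal.ofReal (b ^ 2) + ENNReal.ofReal (c ^ 2)) := by
  rw [← ENNReal.ofReal_add (sq_nonneg a) (sq_nonneg b),
    ← ENNReal.ofReal_add (by positivity) (sq_nonneg c),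
    show (3 : ENNReal) = ENNReal.ofReal 3 by simp, ← ENNReal.ofReal_mul (by norm_num)]
  exact ENNReal.ofReal_le_ofReal (add_add_sq_le a b c)

theorem exists_slice_bound {a T : ℝ} (ha : 0 < a) (hT : 2 ≤ T) :
    ∃ X : ℕ, T ^ 2 ≤ a * X ^ 2 ∧ (X : ℝ) ≤ ((√a)⁻¹ + 1) * T := by
  have hs : 0 < √a := Real.sqrt_pos.2 ha
  have hT0 : 0 < T := by linarith
  -- Slices are empty from `|m| = T / √a` on; rounding up costs at most 1, hence at most `T`.
  refine ⟨⌈(√a)⁻¹ * T⌉₊, ?_, ?_⟩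
  · have h1 : (√a)⁻¹ * T ≤ (⌈(√a)⁻¹ * T⌉₊ : ℝ) := Nat.le_ceil _
    have h2 := pow_le_pow_left₀ (by positivity) h1 2
    rw [mul_pow, inv_pow, Real.sq_sqrt ha.le, inv_mul_le_iff₀ ha] at h2
    exact h2
  · have := (Nat.ceil_lt_add_one (by positivity : 0 ≤ (√a)⁻¹ * T)).le
    rw [add_mul, one_mul]
    linarith

/-- The cube of rows has volume one, so constants integrate to themselves: `k₁` and `k₃` stand for
the two terms free of the first row, `g` for the slices `m ≠ 0`. -/
theorem lintegral_rowCube_le {d : ℕ} {f g : (Fin d → ℝ) → ENNReal} {k₁ k₂ k₃ : ENNReal}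
    (h : ∀ r, f r ≤ 3 * (k₁ + g r + k₃)) (hg : ∫⁻ r in rowCube d, g r ≤ k₂) :
    ∫⁻ r in rowCube d, f r ≤ 3 * (k₁ + k₂ + k₃) := by
  refine (lintegral_mono h).trans ?_
  rw [lintegral_const_mul' _ _ (by norm_num), lintegral_add_right _ measurable_const,
    lintegral_add_left measurable_const, setLIntegral_const, setLIntegral_const, volume_rowCube,
    mul_one, mul_one]
  gcongr

theorem lintegral_entryCube_le {d : ℕ} {f g : (AboveDiag d → ℝ) → ENNReal} {k₁ k₂ k₃ : ENNReal}
    (h : ∀ x ∈ entryCube d, f x ≤ 3 * (g x + k₂ + k₃)) (hg : ∫⁻ x in entryCube d, g x ≤ k₁) :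
    ∫⁻ x in entryCube d, f x ≤ 3 * (k₁ + k₂ + k₃) := by
  refine (setLIntegral_mono' (measurableSet_entryCube d) h).trans ?_
  rw [lintegral_const_mul' _ _ (by norm_num), lintegral_add_right _ measurable_const,
    lintegral_add_right _ measurable_const, setLIntegral_const, setLIntegral_const,
    volume_entryCube, mul_one, mul_one]
  gcongr

/-- The mean square bound for the discrepancy of sheared ellipsoids. -/
theorem exists_lintegral_disc_sq_le (d : ℕ) (W : Matrix (Fin d) (Fin d) ℝ) (hW : W.det ≠ 0) :
    ∃ C, 0 ≤ C ∧ ∀ T : ℝ, 2 ≤ T → ∫⁻ x in entryCube d, ENNReal.ofReal (disc W x T ^ 2) ≤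
      ENNReal.ofReal (C * T ^ (d - 1) * Real.log T ^ 2) := by
  induction d with
  | zero =>
    refine ⟨0, le_rfl, fun T _ => ?_⟩
    have h0 : ∀ x : AboveDiag 0 → ℝ, disc W x T = 0 := fun x => by
      rw [disc, latticeCount_eq_volume_of_isEmpty, volume_real_ell_mul _ _ (det_unipMat x) hW,
        sub_self]
    simp [h0]
  | succ d ih =>
    obtain ⟨a, c, W', ha, hW', hsplit⟩ := exists_qf_split W hW
    obtain ⟨C₁, hC₁, h₁⟩ := ih W' hW'
    obtain ⟨B₁, hB₁, hB₁'⟩ := exists_entry_bound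
      ((continuous_unipMat d).mul (continuous_const (y := W')))
    obtain ⟨B₂, hB₂, hB₂'⟩ := exists_entry_bound (continuous_unipMat_inv d)
    have hdet : 0 < |W'.det|⁻¹ := by positivity
    have hA : 1 ≤ (√a)⁻¹ + 1 := by
      have : 0 ≤ (√a)⁻¹ := by positivity
      linarith
    -- The sum of the two bounds controls both the entries of `unipMat x * W'` and its inverse
    -- determinant, which is that of `W'`.
    obtain ⟨C₂, hC₂, h₂⟩ := exists_setLIntegral_sliceDiscrepancy_le d
      (add_pos hB₁ hdet) hA
    obtain ⟨C₃, hC₃, h₃⟩ := exists_abs_sum_volume_slices_sub_le W' ha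
    obtain ⟨N, hN⟩ := exists_nat_gt (∑ i, (1 + |c i|) * B₂)
    have hl2 : 0 < Real.log 2 := Real.log_pos one_lt_two
    set P : ℝ := ((intBox d N).card : ℝ) with hP
    refine ⟨3 * (C₁ + P * C₂ + C₃ ^ 2 / Real.log 2 ^ 2), by positivity, fun T hT => ?_⟩
    have hT0 : 0 < T := by linarith
    have hT1 : 1 ≤ T := by linarith
    obtain ⟨X, hX, hX'⟩ := exists_slice_bound ha hT
    set s : ℤ → ℝ := fun m => T ^ 2 - a * (m : ℝ) ^ 2 with hs
    have hsT : ∀ m, s m ≤ T ^ 2 := fun m => by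
      have : 0 ≤ a * (m : ℝ) ^ 2 := by positivity
      simp only [hs]
      linarith
    set e : ℝ := ∑ m ∈ Finset.Icc (-X : ℤ) X, volume.real (ell W' (T ^ 2 - a * (m : ℝ) ^ 2)) -
      volume.real (ell W (T ^ 2)) with he
    -- By slicing, the volume inside `e` is the integral of the slice volumes, so the Poisson bound
    -- applies and is squared.
    have he2 : e ^ 2 ≤ C₃ ^ 2 * T ^ d := by
      have h := h₃ T hT0 X hX
      rw [← volume_real_ell_eq_integral hW hsplit] at h
      have h2 := pow_le_pow_left₀ (abs_nonneg _) h 2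
      rw [sq_abs, mul_pow, ← Real.rpow_natCast (T ^ ((d : ℝ) / 2)), ← Real.rpow_mul hT0.le,
        show (d : ℝ) / 2 * (2 : ℕ) = d by push_cast; ring, Real.rpow_natCast] at h2
      exact h2
    rw [lintegral_entryCube_succ ((measurable_disc W T).pow_const 2).ennreal_ofReal]
    have hmain := lintegral_entryCube_le (d := d)
      (f := fun x => ∫⁻ r in rowCube d, ENNReal.ofReal (disc W (consRow d (r, x)) T ^ 2))
      (g := fun x => ENNReal.ofReal (disc W' x T ^ 2))
      (k₂ := (intBox d N).card * ENNReal.ofReal (C₂ * T ^ d * Real.log T ^ 2))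
      (k₃ := ENNReal.ofReal (e ^ 2)) (fun x hx => by
        refine lintegral_rowCube_le (g := fun r => ENNReal.ofReal
          (sliceDiscrepancy (unipMat x * W') s X
            (Matrix.vecMul (r + c) (unipMat x)⁻¹) ^ 2)) (fun r => ?_) ?_
        · rw [disc_consRow ha hW hW' hsplit hX]
          exact ofReal_add_add_sq_le _ _ _
        · have hper : IntPeriodic fun w => ENNReal.ofReal
              (sliceDiscrepancy (unipMat x * W') s X w ^ 2) :=
            (intPeriodic_sliceDiscrepancy (unipMat x * W') s X).comp
              fun t => ENNReal.ofReal (t ^ 2)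
          have hinv : ((unipMat x)⁻¹).det = 1 := by
            rw [Matrix.det_nonsing_inv, det_unipMat]
            simp
          refine (hper.setLIntegral_rowCube_le c hinv (hB₂' x hx) hN).trans ?_
          have hd : (unipMat x * W').det = W'.det := by
            rw [Matrix.det_mul, det_unipMat, one_mul]
          gcongr
          refine h₂ _ (by rwa [hd]) ?_ ?_ T hT s hsT X hX'
          · rw [hd]
            linarith
          · intro i j
            exact (hB₁' x hx i j).trans (by linarith))
      (h₁ T hT)
    refine hmain.trans ?_
    rw [← ENNReal.ofReal_natCast, ← ENNReal.ofReal_mul (by positivity),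
      ← ENNReal.ofReal_add (by positivity) (by positivity),
      ← ENNReal.ofReal_add (by positivity) (by positivity),
      show (3 : ENNReal) = ENNReal.ofReal 3 by simp, ← ENNReal.ofReal_mul (by norm_num)]
    refine ENNReal.ofReal_le_ofReal ?_
    rw [Nat.add_sub_cancel]
    have hlT : Real.log 2 ≤ Real.log T := Real.log_le_log two_pos hT
    have hL : Real.log 2 ^ 2 ≤ Real.log T ^ 2 := pow_le_pow_left₀ hl2.le hlT 2
    -- The induction hypothesis loses a power of `T`, or nothing when `d = 0`, where the truncated
    -- `d - 1` is 0.
    have e1 : C₁ * T ^ (d - 1) * Real.log T ^ 2 ≤ C₁ * T ^ d * Real.log T ^ 2 := by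
      have := pow_le_pow_right₀ hT1 (Nat.sub_le d 1)
      gcongr
    -- The deterministic term has no logarithm; `log T ≥ log 2` puts it in the common form.
    have e3 : C₃ ^ 2 * T ^ d ≤ C₃ ^ 2 / Real.log 2 ^ 2 * T ^ d * Real.log T ^ 2 := by
      rw [div_mul_eq_mul_div, div_mul_eq_mul_div, le_div_iff₀ (by positivity)]
      gcongr
    calc _ ≤ 3 * (C₁ * T ^ d * Real.log T ^ 2 + P * (C₂ * T ^ d * Real.log T ^ 2) +
          C₃ ^ 2 / Real.log 2 ^ 2 * T ^ d * Real.log T ^ 2) := by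
          gcongr
          exact he2.trans e3
      _ = _ := by ring

/-! ### The remainder of a sheared lattice -/

theorem ncard_latticeOf_inter_ball {d : ℕ} (h : GL (Fin d) ℝ) {T : ℝ} (hT : 0 < T) :
    (Set.ncard ((latticeOf h : Set (EuclideanSpace ℝ (Fin d))) ∩ Metric.ball 0 T) : ℝ) =
      latticeCount (ell h.1 (T ^ 2)) 0 := by
  have hdet : IsUnit h.1.det := (Matrix.isUnit_iff_isUnit_det _).1 h.isUnit
  let f : (Fin d → ℤ) → EuclideanSpace ℝ (Fin d) := fun n =>
    WithLp.toLp 2 (Matrix.vecMul (intVec n) h.1)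
  have hf : Function.Injective f := by
    intro n n' hn
    have h1 : Matrix.vecMul (intVec n) h.1 = Matrix.vecMul (intVec n') h.1 :=
      congrArg WithLp.ofLp hn
    exact intVec_injective d
      ((measurableEmbedding_vecMul (isUnit_iff_ne_zero.1 hdet)).injective h1)
  rw [latticeCount, ← Set.ncard_image_of_injective _ hf]
  refine congrArg (fun s : Set (EuclideanSpace ℝ (Fin d)) => (s.ncard : ℝ)) ?_
  have hmem : ∀ n, f n ∈ Metric.ball (0 : EuclideanSpace ℝ (Fin d)) T ↔
      (0 : Fin d → ℝ) + intVec n ∈ ell h.1 (T ^ 2) := by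
    intro n
    rw [mem_ball_zero_iff, zero_add, ell, Set.mem_ofPred_eq, qf_eq_norm_sq,
      sq_lt_sq₀ (norm_nonneg _) hT.le]
  ext v
  constructor
  · rintro ⟨⟨n, rfl⟩, hv⟩
    exact ⟨n, (hmem n).1 hv, rfl⟩
  · rintro ⟨n, hn, rfl⟩
    exact ⟨⟨n, rfl⟩, (hmem n).2 hn⟩

theorem volume_real_ball {d : ℕ} {T : ℝ} (hT : 0 < T) :
    volume.real (Metric.ball (0 : EuclideanSpace ℝ (Fin d)) T) =
      volume.real (ell (1 : Matrix (Fin d) (Fin d) ℝ) (T ^ 2)) := by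
  rw [Measure.real, Measure.real, ← (PiLp.volume_preserving_toLp (Fin d)).measure_preimage
    measurableSet_ball.nullMeasurableSet]
  congr 2
  ext y
  rw [Set.mem_preimage, mem_ball_zero_iff, ell, Set.mem_ofPred_eq, qf_eq_norm_sq, Matrix.vecMul_one,
    sq_lt_sq₀ (norm_nonneg _) hT.le]

/-- The rows of `h` are an integral basis of the lattice, and the box they span has volume `|det
h|`. -/
theorem covolume_latticeOf {d : ℕ} (h : GL (Fin d) ℝ) :
    ZLattice.covolume (latticeOf h) = |h.1.det| := by
  have hdet : IsUnit h.1.det := (Matrix.isUnit_iff_isUnit_det _).1 h.isUnit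
  let b₀ := EuclideanSpace.basisFun (Fin d) ℝ
  let row : Fin d → EuclideanSpace ℝ (Fin d) := fun i => WithLp.toLp 2 (h.1 i)
  have hmat : b₀.toBasis.toMatrix row = h.1.transpose := by
    ext i j
    simp [Module.Basis.toMatrix_apply, b₀, row]
  have hd : b₀.toBasis.det row = h.1.det := by
    rw [Module.Basis.det_apply, hmat, Matrix.det_transpose]
  have hbasis := (Module.Basis.is_basis_iff_det b₀.toBasis (v := row)).2 (by rwa [hd])
  let b : Module.Basis (Fin d) ℝ (EuclideanSpace ℝ (Fin d)) := Module.Basis.mk hbasis.1 hbasis.2.ge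
  have hb : ⇑b = row := Module.Basis.coe_mk _ _
  have hL : latticeOf h = Submodule.span ℤ (Set.range b) := by
    refine le_antisymm ?_ ?_
    · rintro _ ⟨n, rfl⟩
      have h1 : (WithLp.toLp 2 (Matrix.vecMul (fun i => (n i : ℝ)) h.1) :
          EuclideanSpace ℝ (Fin d)) = ∑ i, n i • b i := by
        ext j
        simp [hb, row, Matrix.vecMul, dotProduct]
      rw [h1]
      exact Submodule.sum_mem _ fun i _ =>
        Submodule.smul_mem _ _ (Submodule.subset_span (Set.mem_range_self i))
    · rw [Submodule.span_le]
      rintro _ ⟨i, rfl⟩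
      refine ⟨Pi.single i 1, ?_⟩
      rw [hb]
      have h2 : (fun j => ((Pi.single i (1 : ℤ) : Fin d → ℤ) j : ℝ)) = Pi.single i 1 := by
        ext j
        rcases eq_or_ne j i with rfl | hj <;> simp [*]
      rw [h2, Matrix.single_one_vecMul]
      rfl
  rw [hL, ZLattice.covolume_eq_measure_fundamentalDomain _ _
      (ZSpan.isAddFundamentalDomain b volume),
    ZSpan.measureReal_fundamentalDomain _ _ b₀.toBasis, hb, hd]
  have h3 : volume.real (ZSpan.fundamentalDomain b₀.toBasis) = 1 := by
    rw [Measure.real, measure_congr (ZSpan.fundamentalDomain_ae_parallelepiped b₀.toBasis volume)]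
    have := b₀.volume_parallelepiped
    rw [OrthonormalBasis.coe_toBasis, this]
    simp
  rw [h3, mul_one]

/-- Points of the lattice in the ball are integral vectors in an ellipsoid. As `det u = 1`, the main
term is `vol(B_T) / |det g|`, the volume of the ellipsoid of `g`. -/
theorem remainder_shear_mk {d : ℕ} (g : GL (Fin d) ℝ) {T : ℝ} (hT : 0 < T)
    (x : AboveDiag d → ℝ) :
    remainder T (shear g (Quotient.mk _ ((mcoord d).symm x))) = disc g.1 x T := by
  have hdet : g.1.det ≠ 0 := isUnit_iff_ne_zero.1 ((Matrix.isUnit_iff_isUnit_det _).1 g.isUnit)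
  change remainder T (latticeOf ((ofCoord x : unip d ℝ).1 * g)) = _
  have hmul : ((ofCoord x : unip d ℝ).1 * g).1 = unipMat x * g.1 := rfl
  rw [remainder, ncard_latticeOf_inter_ball _ hT, volume_real_ball hT, covolume_latticeOf, hmul,
    Matrix.det_mul, det_unipMat, one_mul, disc]
  congr 1
  rw [Measure.real, Measure.real, volume_ell hdet, ENNReal.toReal_mul,
    ENNReal.toReal_ofReal (by positivity), div_eq_inv_mul]

/-- The measure on the quotient is pushed forward from `fundDomain d`, whose coordinates fill the
unit cube of entries. -/
theorem lintegral_shearMeasure {d : ℕ} {F : ShearSpace d → ENNReal} (hF : Measurable F) :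
    ∫⁻ u, F u ∂(shearMeasure d) =
      ∫⁻ x in entryCube d, F (Quotient.mk _ ((mcoord d).symm x)) := by
  have hmk : Measurable (Quotient.mk (QuotientGroup.rightRel (unipInt d))) :=
    measurable_quotient_mk''
  have hpre : (mcoord d).symm ⁻¹' fundDomain d = entryCube d := by
    ext x
    simp only [fundDomain, entryCube, Set.mem_preimage, Set.mem_ofPred_eq]
    have hc : ∀ p : AboveDiag d, ((mcoord d).symm x).1 p.1.1 p.1.2 = x p := fun p =>
      congrFun ((coord d ℝ).apply_symm_apply x) p
    exact ⟨fun h p => hc p ▸ h _ _ p.2, fun h i j hij => (hc ⟨(i, j), hij⟩).symm ▸ h ⟨(i, j), hij⟩⟩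
  rw [shearMeasure, lintegral_map hF hmk, du, (mcoord d).symm.restrict_map,
    lintegral_map (f := fun u => F (Quotient.mk _ u)) (hF.comp hmk)
      (mcoord d).symm.measurable, hpre]

end LatticeShear

/-! ### The mean square over the space of shears -/

theorem theorem1 (d : ℕ) (hd : 1 ≤ d) (g : GL (Fin d) ℝ) :
    ∃ c : ℝ, ∀ T : ℝ, 2 ≤ T →
      MeasureTheory.Integrable
          (fun u : LatticeShear.ShearSpace d =>
            |LatticeShear.remainder T (LatticeShear.shear g u)| ^ 2)
          (LatticeShear.shearMeasure d) ∧
        ∫ u : LatticeShear.ShearSpace d,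
            |LatticeShear.remainder T (LatticeShear.shear g u)| ^ 2 ∂(LatticeShear.shearMeasure d)
          ≤ c * T ^ (d - 1) * Real.log T ^ 2 := by
  have hdet : g.1.det ≠ 0 := isUnit_iff_ne_zero.1 ((Matrix.isUnit_iff_isUnit_det _).1 g.isUnit)
  obtain ⟨C, hC0, hC⟩ := LatticeShear.exists_lintegral_disc_sq_le d g.1 hdet
  refine ⟨C, fun T hT => ?_⟩
  have hT0 : 0 < T := by linarith
  have hmeas : Measurable fun u : LatticeShear.ShearSpace d =>
      |LatticeShear.remainder T (LatticeShear.shear g u)| ^ 2 := by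
    -- Measurability on the quotient is checked upstairs, where the remainder is `disc` in
    -- coordinates.
    refine measurable_from_quotient.2 ?_
    have h1 : (fun u : LatticeShear.ShearSpace d =>
        |LatticeShear.remainder T (LatticeShear.shear g u)| ^ 2) ∘ Quotient.mk'' =
        fun u => LatticeShear.disc g.1 (LatticeShear.mcoord d u) T ^ 2 := by
      funext u
      have h2 := LatticeShear.remainder_shear_mk g hT0 (LatticeShear.mcoord d u)
      rw [MeasurableEquiv.symm_apply_apply] at h2
      rw [← h2, ← sq_abs]
      rfl
    rw [h1]
    exact ((LatticeShear.measurable_disc g.1 T).comp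
      (LatticeShear.mcoord d).measurable).pow_const 2
  have hlint : ∫⁻ u, ENNReal.ofReal (|LatticeShear.remainder T (LatticeShear.shear g u)| ^ 2)
      ∂(LatticeShear.shearMeasure d) ≤ ENNReal.ofReal (C * T ^ (d - 1) * Real.log T ^ 2) := by
    rw [LatticeShear.lintegral_shearMeasure hmeas.ennreal_ofReal]
    simp_rw [LatticeShear.remainder_shear_mk g hT0, sq_abs]
    exact hC T hT
  have hnn : ∀ u : LatticeShear.ShearSpace d,
      0 ≤ |LatticeShear.remainder T (LatticeShear.shear g u)| ^ 2 := fun u => by positivity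
  refine ⟨⟨hmeas.aestronglyMeasurable, ?_⟩, ?_⟩
  · rw [hasFiniteIntegral_iff_ofReal (ae_of_all _ hnn)]
    exact hlint.trans_lt ENNReal.ofReal_lt_top
  · rw [integral_eq_lintegral_of_nonneg_ae (ae_of_all _ hnn) hmeas.aestronglyMeasurable]
    exact ENNReal.toReal_le_of_le_ofReal (by positivity) hlint
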